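/- Let $A\in \mathrm{SL}_3(\mathbb Z)$ have a real eigenvalue $\alpha>1$ and two non-real complex conjugate eigenvalues $\beta,\bar\beta$. Let $(a_1,a_2,a_3)^t\in\mathbb R^3\setminus\{0\}$ be an eigenvector of $A$ for $\alpha$ and $(b_1,b_2,b_3)^t\in\mathbb C^3\setminus\{0\}$ an eigenvector for $\beta$. Let $\mathbb H=\{w\in\mathbb C:\operatorname{Im} w>0\}$, let $G_A$ be the group of transformations of $\mathbb C\times\mathbb H$ generated by $(z,w)\mapsto(\beta z,\alpha w)$ and $(z,w)\mapsto(z+b_i,w+a_i)$, $i=1,2,3$, and let $\mathcal S^0=(\mathbb C\times\mathbb H)/G_A$ be the Inoue surface, a smooth manifold of real dimension $4$, with projection $\pi:\mathbb C\times\mathbb H\to\mathcal S^0$. For a closed smooth one-form $\eta$ on a manifold $M$, let $H^k_\eta(M)$ denote the Morse–Novikov cohomology, that is, the degree $k$ cohomology of the complex $(\Omega^\bullet(M), d_\eta)$ of smooth real forms with $d_\eta=d-\eta\wedge\cdot\,$. Then there is exactly one one-form $\theta$ on $\mathcal S^0$ (Tricerri's Lee form) with $\pi^*\theta=\frac{dw_2}{w_2}$,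 where $w_2=\operatorname{Im} w$. It is smooth and closed, and $\theta=\ln\alpha\cdot p^*\vartheta$, where $p:\mathcal S^0\to S^1$, $[z,w]\mapsto e^{2\pi \mathrm i\log_\alpha \operatorname{Im}w}$, and $\vartheta$ is the volume form of the circle normalized to total length $1$. Moreover $$H^1_\theta(\mathcal S^0)=0,\qquad H^2_\theta(\mathcal S^0)\simeq\mathbb R,\qquad H^3_\theta(\mathcal S^0)\simeq\mathbb R,$$ and all the other groups $H^k_\theta(\mathcal S^0)$, in particular $H^0_\theta(\mathcal S^0)$ and $H^4_\theta(\mathcal S^0)$, vanish. -/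

import Mathlib

open scoped Manifold ContDiff Topology Matrix

noncomputable section

namespace MorseNovikov

/-! ### Differential forms on a manifold modelled on a real normed space -/

section Forms

variable {E : Type*} [NormedAddCommGroup E] [NormedSpace ℝ E]
  {E' : Type*} [NormedAddCommGroup E'] [NormedSpace ℝ E']
  {M : Type*} [TopologicalSpace M] [ChartedSpace E M]
  {N : Type*} [TopologicalSpace N] [ChartedSpace E' N]

variable (E M) in
/-- Real-valued differential `k`-forms on `M`, with no regularity imposed. -/
def DForm (k : ℕ) : Type _ :=
  ∀ x : M, (TangentSpace 𝓘(ℝ, E) x) [⋀^Fin k]→L[ℝ] ℝ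

instance (k : ℕ) : AddCommGroup (DForm E M k) :=
  inferInstanceAs (AddCommGroup (∀ x : M, (TangentSpace 𝓘(ℝ, E) x) [⋀^Fin k]→L[ℝ] ℝ))

instance (k : ℕ) : Module ℝ (DForm E M k) :=
  inferInstanceAs (Module ℝ (∀ x : M, (TangentSpace 𝓘(ℝ, E) x) [⋀^Fin k]→L[ℝ] ℝ))
/-- The one-form with the given values, seen as an alternating form of degree one. -/
def oneForm (η : ∀ x : M, TangentSpace 𝓘(ℝ, E) x →L[ℝ] ℝ) : DForm E M 1 :=
  fun x => ContinuousAlternatingMap.ofSubsingleton ℝ (TangentSpace 𝓘(ℝ, E) x) ℝ (0 : Fin 1) (η x)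

/-- The pullback `f^* σ`. -/
def pullback {k : ℕ} (f : M → N) (σ : DForm E' N k) : DForm E M k :=
  fun x => (σ (f x)).compContinuousLinearMap (mfderiv 𝓘(ℝ, E) 𝓘(ℝ, E') f x)

/-- The expression of `σ` in a chart `e`, that is, `(e⁻¹)^* σ`, a form on (the target of `e` in)
the vector space `E`. -/
def chartRep {k : ℕ} (e : OpenPartialHomeomorph M E) (σ : DForm E M k) :
    E → E [⋀^Fin k]→L[ℝ] ℝ :=
  pullback (E := E) (M := E) e.symm σ

lemma chartRep_add {k : ℕ} (e : OpenPartialHomeomorph M E) (σ τ : DForm E M k) :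
    chartRep e (σ + τ) = chartRep e σ + chartRep e τ := rfl

lemma chartRep_smul {k : ℕ} (e : OpenPartialHomeomorph M E) (c : ℝ) (σ : DForm E M k) :
    chartRep e (c • σ) = c • chartRep e σ := rfl

variable (E M) in
/-- The space `Ω^k(M)` of smooth `k`-forms: those that are smooth in every chart of the atlas. -/
def smoothForms (k : ℕ) : Submodule ℝ (DForm E M k) where
  carrier := {σ | ∀ e ∈ atlas E M, ContDiffOn ℝ ∞ (chartRep e σ) e.target}
  zero_mem' := fun e _ => by
    have : chartRep e (0 : DForm E M k) = 0 := rfl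
    rw [this]; exact contDiffOn_const
  add_mem' := fun {σ τ} hσ hτ e he => by
    rw [chartRep_add]; exact (hσ e he).add (hτ e he)
  smul_mem' := fun c σ hσ e he => by
    rw [chartRep_smul]; exact (hσ e he).const_smul c

/-- The exterior derivative, computed at `x` in the preferred chart at `x`. -/
def extD {k : ℕ} (σ : DForm E M k) : DForm E M (k + 1) := fun x =>
  ContinuousAlternatingMap.compContinuousLinearMap
    (extDeriv (chartRep (chartAt E x) σ) (chartAt E x x))
    (mfderiv 𝓘(ℝ, E) 𝓘(ℝ, E) (chartAt E x) x)

/-- The wedge product `η ∧ σ` of a one-form with a `k`-form on a vector space: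
`(η ∧ σ)(v₀, …, v_k) = ∑ i, (-1)^i η(v_i) σ(v₀, …, v̂_i, …, v_k)`. -/
def wedgeAt {k : ℕ} (η : E [⋀^Fin 1]→L[ℝ] ℝ) (σ : E [⋀^Fin k]→L[ℝ] ℝ) :
    E [⋀^Fin (k + 1)]→L[ℝ] ℝ :=
  ContinuousAlternatingMap.alternatizeUncurryFin
    (((ContinuousAlternatingMap.ofSubsingleton ℝ E ℝ (0 : Fin 1)).symm η).smulRight σ)

lemma wedgeAt_add {k : ℕ} (η : E [⋀^Fin 1]→L[ℝ] ℝ) (σ τ : E [⋀^Fin k]→L[ℝ] ℝ) :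
    wedgeAt η (σ + τ) = wedgeAt η σ + wedgeAt η τ := by
  rw [wedgeAt, wedgeAt, wedgeAt, ← ContinuousAlternatingMap.alternatizeUncurryFin_add]
  congr 1
  ext v w
  simp

lemma wedgeAt_smul {k : ℕ} (η : E [⋀^Fin 1]→L[ℝ] ℝ) (c : ℝ) (σ : E [⋀^Fin k]→L[ℝ] ℝ) :
    wedgeAt η (c • σ) = c • wedgeAt η σ := by
  rw [wedgeAt, wedgeAt, ← ContinuousAlternatingMap.alternatizeUncurryFin_smul]
  congr 1
  ext v w
  simp
  ring

/-- The wedge product `η ∧ σ` of a one-form with a `k`-form on `M`. -/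
def wedgeOne {k : ℕ} (η : DForm E M 1) (σ : DForm E M k) : DForm E M (k + 1) :=
  fun x => wedgeAt (E := E) (η x) (σ x)

lemma differentiableAt_chartRep {k : ℕ} {σ : DForm E M k} (hσ : σ ∈ smoothForms E M k) (x : M) :
    DifferentiableAt ℝ (chartRep (chartAt E x) σ) (chartAt E x x) :=
  ((hσ _ (chart_mem_atlas E x)).contDiffAt
    ((chartAt E x).open_target.mem_nhds (mem_chart_target E x))).differentiableAt (by simp)

/-- The twisted differential `d_η σ = dσ - η ∧ σ` on smooth forms. -/
def twistedD (η : DForm E M 1) (k : ℕ) : smoothForms E M k →ₗ[ℝ] DForm E M (k + 1) where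
  toFun σ := extD σ.1 - wedgeOne η σ.1
  map_add' σ τ := by
    have h1 : extD (σ.1 + τ.1) = extD σ.1 + extD τ.1 := by
      funext x
      have := extDeriv_add (differentiableAt_chartRep σ.2 x) (differentiableAt_chartRep τ.2 x)
      simp only [extD, chartRep_add, this]
      rfl
    have h2 : wedgeOne η (σ.1 + τ.1) = wedgeOne η σ.1 + wedgeOne η τ.1 :=
      funext fun x => wedgeAt_add (E := E) (η x) (σ.1 x) (τ.1 x)
    show extD (σ.1 + τ.1) - wedgeOne η (σ.1 + τ.1) = _
    rw [h1, h2]; abel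
  map_smul' c σ := by
    have h1 : extD (c • σ.1) = c • extD σ.1 := by
      funext x
      simp only [extD, chartRep_smul, extDeriv_smul]
      rfl
    have h2 : wedgeOne η (c • σ.1) = c • wedgeOne η σ.1 :=
      funext fun x => wedgeAt_smul (E := E) (η x) c (σ.1 x)
    show extD (c • σ.1) - wedgeOne η (c • σ.1) = _
    rw [h1, h2, ← smul_sub]; rfl

/-- The `d_η`-closed smooth `k`-forms. -/
def cocycles (η : DForm E M 1) (k : ℕ) : Submodule ℝ (smoothForms E M k) :=
  LinearMap.ker (twistedD η k)

/-- The smooth `k`-forms that are `d_η` of a smooth `(k-1)`-form (only `0` when `k = 0`). -/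
def coboundaries (η : DForm E M 1) : (k : ℕ) → Submodule ℝ (smoothForms E M k)
  | 0 => ⊥
  | k + 1 => (LinearMap.range (twistedD η k)).comap (smoothForms E M (k + 1)).subtype

/-- The Morse–Novikov cohomology `H^k_η(M)`: the `d_η`-closed smooth `k`-forms modulo those among
them that are `d_η` of a smooth form. (For a closed smooth one-form `η` the map `d_η` preserves
smoothness and `d_η ∘ d_η = 0`, so this is the cohomology of the complex `(Ω^•(M), d_η)`.) -/
abbrev Cohomology [IsManifold 𝓘(ℝ, E) ∞ M] (η : DForm E M 1) (k : ℕ) : Type _ :=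
  cocycles η k ⧸ (coboundaries η k).submoduleOf (cocycles η k)

end Forms

end MorseNovikov

namespace Inoue

open MorseNovikov

/-- A matrix `A ∈ SL₃(ℤ)` with a real eigenvalue `α > 1` and a non-real eigenvalue `β` (hence also
`β̄`), a real eigenvector `a` for `α` and a complex eigenvector `b` for `β`. -/
structure InoueData where
  A : Matrix.SpecialLinearGroup (Fin 3) ℤ
  α : ℝ
  β : ℂ
  a : Fin 3 → ℝ
  b : Fin 3 → ℂ
  one_lt_α : 1 < α
  β_im_ne_zero : β.im ≠ 0
  a_ne_zero : a ≠ 0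
  b_ne_zero : b ≠ 0
  mulVec_a : A.1.map (Int.cast : ℤ → ℝ) *ᵥ a = α • a
  mulVec_b : A.1.map (Int.cast : ℤ → ℂ) *ᵥ b = β • b

/-- `ℂ × ℍ`, as an open subset of `ℂ × ℂ`. -/
def CH : TopologicalSpace.Opens (ℂ × ℂ) :=
  ⟨{q | 0 < q.2.im}, isOpen_lt continuous_const (Complex.continuous_im.comp continuous_snd)⟩

namespace InoueData

variable (D : InoueData)

lemma α_pos : 0 < D.α := zero_lt_one.trans D.one_lt_α

lemma β_ne_zero : D.β ≠ 0 := fun h => D.β_im_ne_zero (by simp [h])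

/-- The transformation `(z, w) ↦ (β z, α w)`. -/
def dilation : Equiv.Perm CH where
  toFun q := ⟨(D.β * q.1.1, D.α * q.1.2), by
    have := mul_pos D.α_pos q.2
    simpa [CH] using this⟩
  invFun q := ⟨(D.β⁻¹ * q.1.1, (D.α⁻¹ : ℝ) * q.1.2), by
    have := mul_pos (inv_pos.2 D.α_pos) q.2
    rw [← Complex.im_ofReal_mul] at this
    exact this⟩
  left_inv q := by
    have h := D.β_ne_zero
    have h' : (D.α : ℂ) ≠ 0 := by exact_mod_cast D.α_pos.ne'
    ext <;> simp [h, h']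
  right_inv q := by
    have h := D.β_ne_zero
    have h' : (D.α : ℂ) ≠ 0 := by exact_mod_cast D.α_pos.ne'
    ext <;> simp [h, h']

/-- The transformation `(z, w) ↦ (z + b_i, w + a_i)`. -/
def translation (i : Fin 3) : Equiv.Perm CH where
  toFun q := ⟨(q.1.1 + D.b i, q.1.2 + D.a i), by
    have := q.2
    simpa [CH] using this⟩
  invFun q := ⟨(q.1.1 - D.b i, q.1.2 - D.a i), by
    have := q.2
    simpa [CH] using this⟩
  left_inv q := by ext <;> simp
  right_inv q := by ext <;> simp

/-- The group `G_A` of transformations of `ℂ × ℍ`. -/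
def G : Subgroup (Equiv.Perm CH) :=
  Subgroup.closure ({D.dilation} ∪ Set.range D.translation)

/-! #### Explicit form of the elements of `G_A` -/


lemma zpow_mulVec {K : Type*} [Field K] (A : Matrix.SpecialLinearGroup (Fin 3) ℤ) {c : K}
    (hc : c ≠ 0) {v : Fin 3 → K} (h : A.1.map (Int.cast : ℤ → K) *ᵥ v = c • v) (n : ℤ) :
    (A ^ n).1.map (Int.cast : ℤ → K) *ᵥ v = c ^ n • v := by
  have hmul (P Q : Matrix.SpecialLinearGroup (Fin 3) ℤ) :
      (P * Q).1.map (Int.cast : ℤ → K) = P.1.map Int.cast * Q.1.map Int.cast := by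
    have := Matrix.map_mul (L := P.1) (M := Q.1) (f := Int.castRingHom K)
    simpa using this
  have hone : (1 : Matrix.SpecialLinearGroup (Fin 3) ℤ).1.map (Int.cast : ℤ → K) = 1 := by
    simp
  have hinv : (A⁻¹).1.map (Int.cast : ℤ → K) *ᵥ v = c⁻¹ • v := by
    have h1 : (A⁻¹).1.map (Int.cast : ℤ → K) *ᵥ (A.1.map (Int.cast : ℤ → K) *ᵥ v) = v := by
      rw [Matrix.mulVec_mulVec, ← hmul, inv_mul_cancel, hone, Matrix.one_mulVec]
    rw [h, Matrix.mulVec_smul] at h1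
    rw [← h1, smul_smul, inv_mul_cancel₀ hc, one_smul, h1]
  induction n using Int.induction_on with
  | zero => simp
  | succ n ih =>
    rw [zpow_add_one, hmul, ← Matrix.mulVec_mulVec, h, Matrix.mulVec_smul, ih, smul_smul,
      zpow_add_one₀ hc, mul_comm]
  | pred n ih =>
    rw [zpow_sub_one, hmul, ← Matrix.mulVec_mulVec, hinv, Matrix.mulVec_smul, ih, smul_smul,
      zpow_sub_one₀ hc, mul_comm]

lemma zpow_sum {K : Type*} [Field K] (A : Matrix.SpecialLinearGroup (Fin 3) ℤ) {c : K}
    (hc : c ≠ 0) {v : Fin 3 → K} (h : A.1.map (Int.cast : ℤ → K) *ᵥ v = c • v) (n : ℤ)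
    (m : Fin 3 → ℤ) :
    c ^ n * ∑ i, (m i : K) * v i = ∑ j, (((m ᵥ* (A ^ n).1) j : ℤ) : K) * v j := by
  have key := zpow_mulVec A hc h n
  calc c ^ n * ∑ i, (m i : K) * v i = ∑ i, (m i : K) * (c ^ n • v) i := by
        rw [Finset.mul_sum]
        exact Finset.sum_congr rfl fun i _ => by simp only [Pi.smul_apply, smul_eq_mul]; ring
    _ = ∑ i, ∑ j, (m i : K) * (((A ^ n).1 i j : K) * v j) := by
        rw [← key]
        refine Finset.sum_congr rfl fun i _ => ?_
        simp only [Matrix.mulVec, dotProduct, Matrix.map_apply, Finset.mul_sum]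
    _ = _ := by
        rw [Finset.sum_comm]
        refine Finset.sum_congr rfl fun j _ => ?_
        simp only [Matrix.vecMul, dotProduct, Int.cast_sum, Int.cast_mul, Finset.sum_mul]
        exact Finset.sum_congr rfl fun i _ => by ring

/-- `(n, m)` describes `g`: it is `(z, w) ↦ (βⁿ z + ∑ mᵢ bᵢ, αⁿ w + ∑ mᵢ aᵢ)`. -/
def Describes (g : Equiv.Perm CH) (n : ℤ) (m : Fin 3 → ℤ) : Prop :=
  ∀ q : CH, (g q : ℂ × ℂ) =
    (D.β ^ n * q.1.1 + ∑ i, (m i : ℂ) * D.b i,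
      ((D.α ^ n : ℝ) : ℂ) * q.1.2 + ((∑ i, (m i : ℝ) * D.a i : ℝ) : ℂ))

lemma Describes.one : D.Describes 1 0 0 := fun q => by simp

lemma Describes.mul {D : InoueData} {g h : Equiv.Perm CH} {n n' : ℤ} {m m' : Fin 3 → ℤ}
    (hg : D.Describes g n m) (hh : D.Describes h n' m') :
    D.Describes (g * h) (n + n') (m' ᵥ* (D.A ^ n).1 + m) := fun q => by
  have h1 := zpow_sum D.A D.β_ne_zero D.mulVec_b n m'
  have h2 := zpow_sum D.A D.α_pos.ne' D.mulVec_a n m'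
  rw [Equiv.Perm.mul_apply, hg, hh]
  refine Prod.ext ?_ ?_
  · simp only [Pi.add_apply, Int.cast_add, add_mul, Finset.sum_add_distrib, ← h1,
      zpow_add₀ D.β_ne_zero]
    ring
  · simp only [Pi.add_apply, Int.cast_add, add_mul, Finset.sum_add_distrib, ← h2,
      zpow_add₀ D.α_pos.ne']
    push_cast
    ring

lemma Describes.inv {D : InoueData} {g : Equiv.Perm CH} {n : ℤ} {m : Fin 3 → ℤ}
    (hg : D.Describes g n m) :
    D.Describes g⁻¹ (-n) (-(m ᵥ* (D.A ^ (-n)).1)) := fun q => by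
  have h1 := zpow_sum D.A D.β_ne_zero D.mulVec_b (-n) m
  have h2 := zpow_sum D.A D.α_pos.ne' D.mulVec_a (-n) m
  have hα : (D.α : ℂ) ≠ 0 := by exact_mod_cast D.α_pos.ne'
  obtain ⟨p, rfl⟩ := g.surjective q
  have hp : g⁻¹ (g p) = p := Equiv.symm_apply_apply g p
  rw [hp, hg]
  refine Prod.ext ?_ ?_
  · simp only [Pi.neg_apply, Int.cast_neg, neg_mul, Finset.sum_neg_distrib, ← h1]
    rw [zpow_neg]
    field_simp [zpow_ne_zero n D.β_ne_zero]
    ring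
  · simp only [Pi.neg_apply, Int.cast_neg, neg_mul, Finset.sum_neg_distrib, ← h2]
    rw [zpow_neg]
    push_cast
    field_simp [zpow_ne_zero n hα]
    ring

lemma exists_describes {g : Equiv.Perm CH} (hg : g ∈ D.G) : ∃ n m, D.Describes g n m := by
  induction hg using Subgroup.closure_induction with
  | mem x hx =>
    rcases hx with hx | ⟨i, rfl⟩
    · obtain rfl : x = D.dilation := hx
      exact ⟨1, 0, fun q => by simp [dilation]⟩
    · exact ⟨0, Pi.single i 1, fun q => by
        simp [translation, Pi.single_apply, apply_ite (Int.cast : ℤ → ℂ),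
          apply_ite (Int.cast : ℤ → ℝ)]⟩
  | one => exact ⟨0, 0, Describes.one D⟩
  | mul x y _ _ hx hy =>
    obtain ⟨n, m, h⟩ := hx
    obtain ⟨n', m', h'⟩ := hy
    exact ⟨_, _, h.mul h'⟩
  | inv x _ hx =>
    obtain ⟨n, m, h⟩ := hx
    exact ⟨_, _, h.inv⟩

/-- The real linear map `x ↦ (∑ xᵢ bᵢ, ∑ xᵢ aᵢ)`. -/
def period : (Fin 3 → ℝ) →ₗ[ℝ] ℂ × ℝ :=
  LinearMap.prod (∑ i, (LinearMap.proj i).smulRight (D.b i))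
    (∑ i, (LinearMap.proj i).smulRight (D.a i))

lemma period_apply (x : Fin 3 → ℝ) :
    D.period x = (∑ i, (x i : ℂ) * D.b i, ∑ i, x i * D.a i) := by
  simp [period]

lemma ker_period : LinearMap.ker D.period = ⊥ := by
  rw [LinearMap.ker_eq_bot']
  intro x hx
  rw [period_apply, Prod.mk_eq_zero] at hx
  obtain ⟨h1, h2⟩ := hx
  let T : Module.End ℂ (Fin 3 → ℂ) := Matrix.toLin' (D.A.1.map (Int.cast : ℤ → ℂ))
  let μ : Fin 3 → ℂ := ![D.α, D.β, star D.β]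
  let v : Fin 3 → (Fin 3 → ℂ) := ![fun i => (D.a i : ℂ), D.b, fun i => star (D.b i)]
  have hμ : Function.Injective μ := by
    have e1 : (D.α : ℂ) ≠ D.β := fun h => D.β_im_ne_zero (by simp [← h])
    have e2 : (D.α : ℂ) ≠ star D.β := fun h => D.β_im_ne_zero (by
      have := congrArg Complex.im h; simpa using this)
    have e3 : D.β ≠ star D.β := fun h => D.β_im_ne_zero (by
      have := congrArg Complex.im h
      simp at this
      linarith)
    intro i j hij
    fin_cases i <;> fin_cases j <;> simp_all [μ]
  have hv : ∀ i, T.HasEigenvector (μ i) (v i) := by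
    have ha := congrFun D.mulVec_a
    have hb := congrFun D.mulVec_b
    simp only [Matrix.mulVec, dotProduct, Matrix.map_apply, Pi.smul_apply, smul_eq_mul] at ha hb
    intro i
    rw [Module.End.hasEigenvector_iff, Module.End.mem_eigenspace_iff]
    fin_cases i
    · refine ⟨funext fun i => ?_, fun h => D.a_ne_zero (funext fun i => ?_)⟩
      · have := congrArg (Complex.ofReal) (ha i)
        push_cast at this
        simpa [T, v, μ, Matrix.mulVec, dotProduct] using this
      · have := congrFun h i
        simpa [v] using this
    · refine ⟨funext fun i => ?_, D.b_ne_zero⟩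
      simpa [T, v, μ, Matrix.mulVec, dotProduct] using hb i
    · refine ⟨funext fun i => ?_, fun h => D.b_ne_zero (funext fun i => ?_)⟩
      · have := congrArg (starRingEnd ℂ) (hb i)
        simp only [map_sum, map_mul, map_intCast] at this
        simpa [T, v, μ, Matrix.mulVec, dotProduct] using this
      · have := congrFun h i
        simpa [v] using this
  have hli := Module.End.eigenvectors_linearIndependent' T μ hμ v hv
  have hx' : Matrix.of v *ᵥ (fun i => (x i : ℂ)) = 0 := by
    have h1' := congrArg (starRingEnd ℂ) h1
    have h2' := congrArg Complex.ofReal h2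
    simp only [map_sum, map_mul, Complex.conj_ofReal, map_zero] at h1'
    push_cast at h2'
    funext j
    fin_cases j
    · simpa [v, Matrix.mulVec, dotProduct, mul_comm] using h2'
    · simpa [v, Matrix.mulVec, dotProduct, mul_comm] using h1
    · simpa [v, Matrix.mulVec, dotProduct, mul_comm] using h1'
  have hunit : IsUnit (Matrix.of v) := Matrix.linearIndependent_rows_iff_isUnit.1 hli
  have := Matrix.mulVec_injective_iff_isUnit.2 hunit (hx'.trans (Matrix.mulVec_zero _).symm)
  funext i
  simpa using congrFun this i

lemma finite_period_le (R : ℝ) :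
    {m : Fin 3 → ℤ | ‖D.period (fun i => (m i : ℝ))‖ ≤ R}.Finite := by
  obtain ⟨K, -, hK⟩ := D.period.exists_antilipschitzWith D.ker_period
  refine Set.Finite.subset
    (isCompact_closedBall (0 : Fin 3 → ℤ) (K * R)).finite_of_discrete fun m hm => ?_
  have h1 := hK.le_mul_dist (fun i => (m i : ℝ)) 0
  rw [map_zero, dist_zero_right, dist_zero_right] at h1
  have h2 : ‖m‖ ≤ ‖fun i => (m i : ℝ)‖ := by
    refine (pi_norm_le_iff_of_nonneg (norm_nonneg _)).2 fun i => ?_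
    have := norm_le_pi_norm (fun i => (m i : ℝ)) i
    simpa [Int.norm_eq_abs] using this
  rw [mem_closedBall_zero_iff]
  exact h2.trans (h1.trans (mul_le_mul_of_nonneg_left hm K.2))

lemma Describes.im {D : InoueData} {g : Equiv.Perm CH} {n : ℤ} {m : Fin 3 → ℤ}
    (h : D.Describes g n m) (q : CH) : (g q).1.2.im = D.α ^ n * q.1.2.im := by
  rw [h q]
  simp only [Complex.add_im, Complex.im_ofReal_mul, Complex.ofReal_im, add_zero]

instance : ContinuousConstSMul D.G CH where
  continuous_const_smul g := by
    obtain ⟨n, m, h⟩ := D.exists_describes g.2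
    refine Continuous.subtype_mk (f := fun q => ((g.1 q : CH) : ℂ × ℂ)) ?_ _
    simp only [h _]
    fun_prop

instance : IsCancelSMul D.G CH := by
  rw [isCancelSMul_iff_eq_one_of_smul_eq]
  intro g q hq
  obtain ⟨n, m, h⟩ := D.exists_describes g.2
  have hq' : g.1 q = q := hq
  have him := h.im q
  rw [hq'] at him
  have hpos : (0 : ℝ) < q.1.2.im := q.2
  have hn : D.α ^ n = 1 := by
    have : (D.α ^ n - 1) * q.1.2.im = 0 := by linarith
    rcases mul_eq_zero.1 this with h | h
    · linarith
    · exact absurd h hpos.ne'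
  have hn0 : n = 0 := (zpow_eq_one_iff_right₀ D.α_pos.le D.one_lt_α.ne').1 hn
  subst hn0
  have hc := h q
  rw [hq'] at hc
  have hc1 := congrArg Prod.fst hc
  have hc2 := congrArg Prod.snd hc
  simp only [zpow_zero, one_mul, left_eq_add, Complex.ofReal_one] at hc1 hc2
  refine Subtype.ext (Equiv.ext fun p => Subtype.ext ?_)
  rw [h p, hc1, hc2]
  simp

lemma finite_zpow (c C : ℝ) (hc : 0 < c) : {n : ℤ | c ≤ D.α ^ n ∧ D.α ^ n ≤ C}.Finite := by
  have hlog : 0 < Real.log D.α := Real.log_pos D.one_lt_α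
  refine (Set.finite_Icc ⌊Real.log c / Real.log D.α⌋ ⌈Real.log C / Real.log D.α⌉).subset ?_
  rintro n ⟨h1, h2⟩
  have hp : 0 < D.α ^ n := zpow_pos D.α_pos n
  have l1 := Real.log_le_log hc h1
  have l2 := Real.log_le_log hp h2
  rw [Real.log_zpow] at l1 l2
  rw [← div_le_iff₀ hlog] at l1
  rw [← le_div_iff₀ hlog] at l2
  constructor
  · exact_mod_cast (Int.floor_le _).trans l1
  · exact_mod_cast l2.trans (Int.le_ceil _)

instance : ProperlyDiscontinuousSMul D.G CH where
  finite_disjoint_inter_image := by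
    intro K L hK hL
    rcases K.eq_empty_or_nonempty with rfl | hKne
    · simp
    rcases L.eq_empty_or_nonempty with rfl | hLne
    · simp
    have him : Continuous fun q : CH => q.1.2.im := by fun_prop
    have hnorm : Continuous fun q : CH => ‖q.1‖ := by fun_prop
    obtain ⟨k₀, -, hk₀⟩ := hK.exists_isMinOn hKne him.continuousOn
    obtain ⟨k₁, -, hk₁⟩ := hK.exists_isMaxOn hKne him.continuousOn
    obtain ⟨k₂, -, hk₂⟩ := hK.exists_isMaxOn hKne hnorm.continuousOn
    obtain ⟨l₀, -, hl₀⟩ := hL.exists_isMinOn hLne him.continuousOn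
    obtain ⟨l₁, -, hl₁⟩ := hL.exists_isMaxOn hLne him.continuousOn
    obtain ⟨l₂, -, hl₂⟩ := hL.exists_isMaxOn hLne hnorm.continuousOn
    choose F₁ F₂ hF using fun g : D.G => D.exists_describes g.2
    have hinj : Function.Injective fun g => (F₁ g, F₂ g) := by
      intro g g' h
      simp only [Prod.mk.injEq] at h
      refine Subtype.ext (Equiv.ext fun p => Subtype.ext ?_)
      rw [hF g p, hF g' p, h.1, h.2]
    refine Set.Finite.of_finite_image ?_ hinj.injOn
    have p0 : ∀ q : CH, (0 : ℝ) < q.1.2.im := fun q => q.2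
    have hN := D.finite_zpow (l₀.1.2.im / k₁.1.2.im) (l₁.1.2.im / k₀.1.2.im)
      (div_pos (p0 _) (p0 _))
    refine Set.Finite.subset (hN.biUnion fun n _ =>
      (D.finite_period_le (‖l₂.1‖ + (‖D.β ^ n‖ + ‖D.α ^ n‖) * ‖k₂.1‖)).image fun m => (n, m)) ?_
    rintro _ ⟨g, ⟨_, ⟨q, hq, rfl⟩, hgq⟩, rfl⟩
    have hgq' : g.1 q ∈ L := hgq
    have e := (hF g).im q
    have b1 : k₀.1.2.im ≤ q.1.2.im := hk₀ hq
    have b2 : q.1.2.im ≤ k₁.1.2.im := hk₁ hq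
    have b3 : l₀.1.2.im ≤ (g.1 q).1.2.im := hl₀ hgq'
    have b4 : (g.1 q).1.2.im ≤ l₁.1.2.im := hl₁ hgq'
    have b5 : ‖q.1‖ ≤ ‖k₂.1‖ := hk₂ hq
    have b6 : ‖(g.1 q).1‖ ≤ ‖l₂.1‖ := hl₂ hgq'
    have hp : 0 < D.α ^ F₁ g := zpow_pos D.α_pos _
    simp only [Set.mem_iUnion]
    refine ⟨F₁ g, ⟨?_, ?_⟩, F₂ g, ?_, rfl⟩
    · rw [div_le_iff₀ (p0 _)]
      exact b3.trans (e.le.trans (mul_le_mul_of_nonneg_left b2 hp.le))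
    · rw [le_div_iff₀ (p0 _)]
      exact (mul_le_mul_of_nonneg_left b1 hp.le).trans (e.ge.trans b4)
    · have hd := hF g q
      have d1 := congrArg Prod.fst hd
      have d2 := congrArg Prod.snd hd
      simp only at d1 d2
      rw [Set.mem_ofPred_eq, period_apply, Prod.norm_def]
      have n1 := norm_fst_le q.1
      have n2 := norm_snd_le q.1
      have n3 := norm_fst_le (g.1 q).1
      have n4 := norm_snd_le (g.1 q).1
      have q0 := norm_nonneg q.1
      refine max_le ?_ ?_
      · have : ∑ i, (((F₂ g i : ℤ) : ℝ) : ℂ) * D.b i = (g.1 q).1.1 - D.β ^ F₁ g * q.1.1 := by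
          rw [d1]; push_cast; ring
        rw [this]
        refine (norm_sub_le _ _).trans (add_le_add (n3.trans b6) ?_)
        rw [norm_mul]
        exact mul_le_mul (le_add_of_nonneg_right (norm_nonneg _)) (n1.trans b5)
          (norm_nonneg _) (by positivity)
      · have : ((∑ i, (F₂ g i : ℝ) * D.a i : ℝ) : ℂ)
            = (g.1 q).1.2 - ((D.α ^ F₁ g : ℝ) : ℂ) * q.1.2 := by
          rw [d2]; ring
        rw [← Complex.norm_real, this]
        refine (norm_sub_le _ _).trans (add_le_add (n4.trans b6) ?_)
        rw [norm_mul, Complex.norm_real]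
        exact mul_le_mul (le_add_of_nonneg_left (norm_nonneg _)) (n2.trans b5)
          (norm_nonneg _) (by positivity)

instance : LocallyCompactSpace CH := CH.isOpen.locallyCompactSpace

/-- The Inoue surface `S⁰ = (ℂ × ℍ) / G_A`, with the quotient topology and the atlas pushed forward
from `ℂ × ℍ` by local inverses of the projection. -/
abbrev S0 : Type := MulAction.orbitRel.Quotient D.G CH

/-- The projection `ℂ × ℍ → S⁰`. -/
def proj : CH → D.S0 := Quotient.mk _

lemma isLocalHomeomorph_proj : IsLocalHomeomorph D.proj :=
  isQuotientCoveringMap_quotientMk_of_properlyDiscontinuousSMul.isCoveringMap.isLocalHomeomorph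

lemma exists_of_mem_atlas {e : OpenPartialHomeomorph D.S0 (ℂ × ℂ)} (he : e ∈ atlas (ℂ × ℂ) D.S0) :
    ∃ q : CH, e = (D.isLocalHomeomorph_proj.localInverseAt q).trans (chartAt (ℂ × ℂ) q) := by
  obtain ⟨x, rfl⟩ := he
  exact ⟨_, rfl⟩

instance : IsManifold 𝓘(ℝ, ℂ × ℂ) ∞ D.S0 := by
  refine isManifold_of_contDiffOn _ _ _ fun e e' he he' => ?_
  obtain ⟨q, rfl⟩ := D.exists_of_mem_atlas he
  obtain ⟨q', rfl⟩ := D.exists_of_mem_atlas he'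
  set i := D.isLocalHomeomorph_proj.localInverseAt q with hi
  set i' := D.isLocalHomeomorph_proj.localInverseAt q' with hi'
  have hic : i.symm = D.proj := D.isLocalHomeomorph_proj.localInverseAt_symm q
  have hic' : i'.symm = D.proj := D.isLocalHomeomorph_proj.localInverseAt_symm q'
  have hsymm : ∀ y ∈ (chartAt (ℂ × ℂ) q).target, (((chartAt (ℂ × ℂ) q).symm y : CH) : ℂ × ℂ) = y :=
    fun y hy => (chartAt (ℂ × ℂ) q).right_inv hy
  intro y hy
  obtain ⟨hy, -⟩ := hy
  simp only [mfld_simps] at hy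
  obtain ⟨⟨hy1, hy2⟩, hy3⟩ := hy
  set p : CH := (chartAt (ℂ × ℂ) q).symm y with hp
  rw [hic] at hy3
  -- the two lifts of the point differ by an element of the group
  have hpi : D.proj (i' (D.proj p)) = D.proj p := by
    have := i'.left_inv hy3.1
    rwa [hic'] at this
  obtain ⟨g, hg⟩ : ∃ g : D.G, g • p = i' (D.proj p) := Quotient.exact hpi
  obtain ⟨n, m, h⟩ := D.exists_describes g.2
  have hcont : ContinuousAt (fun y => g • (chartAt (ℂ × ℂ) q).symm y) y :=
    (continuous_const_smul g).continuousAt.comp ((chartAt (ℂ × ℂ) q).continuousAt_symm hy1)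
  have hmem : i'.target ∈ 𝓝 (g • (chartAt (ℂ × ℂ) q).symm y) := by
    rw [← hp, hg]
    exact i'.open_target.mem_nhds (i'.map_source hy3.1)
  have hev : ∀ᶠ u in 𝓝 y, u ∈ (chartAt (ℂ × ℂ) q).target ∧
      g • (chartAt (ℂ × ℂ) q).symm u ∈ i'.target :=
    ((chartAt (ℂ × ℂ) q).open_target.mem_nhds hy1 |> Filter.Eventually.and) (hcont hmem)
  refine ContDiffAt.contDiffWithinAt ?_
  refine ContDiffAt.congr_of_eventuallyEq (f := fun u : ℂ × ℂ =>
    (D.β ^ n * u.1 + ∑ i, (m i : ℂ) * D.b i,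
      ((D.α ^ n : ℝ) : ℂ) * u.2 + ((∑ i, (m i : ℝ) * D.a i : ℝ) : ℂ))) (by fun_prop) ?_
  filter_upwards [hev] with u hu
  have e1 : D.proj ((chartAt (ℂ × ℂ) q).symm u) = D.proj (g • (chartAt (ℂ × ℂ) q).symm u) :=
    Quotient.sound ⟨g⁻¹, inv_smul_smul g _⟩
  have e2 : i' (D.proj (g • (chartAt (ℂ × ℂ) q).symm u)) = g • (chartAt (ℂ × ℂ) q).symm u := by
    have := i'.right_inv hu.2
    rwa [hic'] at this
  have e3 := h ((chartAt (ℂ × ℂ) q).symm u)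
  rw [hsymm u hu.1] at e3
  simp only [mfld_simps]
  rw [hic, e1, e2]
  exact e3

/-- The one-form `dw₂ / w₂` on `ℂ × ℍ`, with `w₂ = Im w`. -/
def tricerriForm : DForm (ℂ × ℂ) CH 1 :=
  oneForm fun q => (q.1.2.im)⁻¹ • mfderiv 𝓘(ℝ, ℂ × ℂ) 𝓘(ℝ, ℝ) (fun p : CH => p.1.2.im) q

/-- The fibration `p : S⁰ → S¹`, `[z, w] ↦ exp (2πi log_α (Im w))`. -/
def fibration : D.S0 → Circle :=
  Quotient.lift (fun q : CH => Circle.exp (2 * Real.pi * Real.logb D.α q.1.2.im)) <| by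
    rintro q q' ⟨g, rfl⟩
    obtain ⟨n, m, h⟩ := D.exists_describes g.2
    have h1 : (0 : ℝ) < q'.1.2.im := q'.2
    have h2 := h.im q'
    show Circle.exp (2 * Real.pi * Real.logb D.α (g.1 q').1.2.im) = _
    rw [h2, Real.logb_mul (zpow_pos D.α_pos n).ne' h1.ne', ← Real.rpow_intCast,
      Real.logb_rpow D.α_pos D.one_lt_α.ne', mul_add, add_comm, mul_comm (2 * Real.pi) (n : ℝ)]
    exact Circle.periodic_exp.int_mul n _

end InoueData

/-- The volume form of the circle of length one: `dφ / 2π`, where `φ` is the angle. -/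
def circleForm : DForm (EuclideanSpace ℝ (Fin 1)) Circle 1 :=
  oneForm fun z => (2 * Real.pi)⁻¹ • (Complex.imCLM ∘L
    ContinuousLinearMap.mul ℝ ℂ ((z⁻¹ : Circle) : ℂ) ∘L
      mfderiv (𝓡 1) 𝓘(ℝ, ℂ) (fun u : Circle => (u : ℂ)) z)

end Inoue

end

noncomputable section

/-! In the coordinates `(z, x + i y) ↦ (z, x + i α ^ y)` the universal cover of the surface is `ℂ ×
ℂ`. There the deck transformations are affine, the dilation becoming a linear map followed by `y ↦ y
+ 1`, and the Lee form lifts to `log α • dy`. Since `d(α ^ (-y)) = -log α · α ^ (-y) dy`, dividing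
the lift of a form by `α ^ y` turns `d_θ` into `d` (`untwist_twistedD`). The image is the space
`invForms` of smooth forms that are periodic under the lattice and fixed by `T`, where `T` is `α`
times the pullback by the dilation.

The cohomology of `invForms` is computed by a Wang argument, carried out by hand. Lattice-periodic
forms have the cohomology of a three-torus times a line: averaging over the torus and integrating in
`y` makes every closed form of positive degree cohomologous to a unique constant form without `dy`
(`exists_eq_const_add`, `eq_zero_of_const_exact`). On periodic forms `1 - T` is onto, by summing
translates of cut-off pieces (`exists_sub_shift_eq`). Hence `H^k_θ` consists of the kernel of `1 -
T` on constant horizontal `k`-forms and its cokernel on constant horizontal `(k-1)`-forms.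

It remains to find the eigenvalue `1` of `T` on constant horizontal forms. The dilation acts on the
horizontal space with eigenvalues `β`, `β̄`, `α`, and `α |β|² = det A = 1`. So `T` has eigenvalue
`α` in degree `0`; `αβ`, `αβ̄`, `α²` in degree `1`; `α |β|² = 1`, `α²β`, `α²β̄` in degree `2`; and
`α` in degree `3`. The value `1` occurs once, in degree two, on the area form `ω` of the `z`-plane.
The kernel gives the class of `ω` in `H²`, and the cokernel gives the class of `d(y ω) = dy ∧ ω` in
`H³`. -/

namespace MorseNovikov

universe u

/-! ### Calculus of alternating forms on a vector space. -/

section Calculus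

variable {E : Type*} [NormedAddCommGroup E] [NormedSpace ℝ E]
  {F : Type*} [NormedAddCommGroup F] [NormedSpace ℝ F]

/-- Needed later to pass from injectivity of `1 - T` on constant forms to surjectivity. -/
instance finiteDimensional_continuousAlternatingMap [FiniteDimensional ℝ E] (k : ℕ) :
    FiniteDimensional ℝ (E [⋀^Fin k]→L[ℝ] ℝ) := by
  let i : (E [⋀^Fin k]→L[ℝ] ℝ) →ₗ[ℝ] MultilinearMap ℝ (fun _ : Fin k => E) ℝ :=
    { toFun := fun f => f.toContinuousMultilinearMap.toMultilinearMap
      map_add' := fun _ _ => rfl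
      map_smul' := fun _ _ => rfl }
  refine Module.Finite.of_injective i fun f g h => ?_
  ext v
  exact congrArg (fun m : MultilinearMap ℝ (fun _ : Fin k => E) ℝ => m v) h

/-- The inclusion into multilinear maps is injective, and in finite dimension a linear left inverse
is automatically continuous. Smoothness of a family of alternating maps can therefore be checked on
the underlying multilinear maps. -/
lemma exists_leftInverse_toContinuousMultilinearMapCLM [FiniteDimensional ℝ E] (k : ℕ) :
    ∃ r : ContinuousMultilinearMap ℝ (fun _ : Fin k => E) ℝ →L[ℝ] (E [⋀^Fin k]→L[ℝ] ℝ),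
      ∀ c : E [⋀^Fin k]→L[ℝ] ℝ, r c.toContinuousMultilinearMap = c := by
  have hfin : FiniteDimensional ℝ (ContinuousMultilinearMap ℝ (fun _ : Fin k => E) ℝ) := by
    let i : ContinuousMultilinearMap ℝ (fun _ : Fin k => E) ℝ →ₗ[ℝ]
        MultilinearMap ℝ (fun _ : Fin k => E) ℝ :=
      { toFun := fun f => f.toMultilinearMap
        map_add' := fun _ _ => rfl
        map_smul' := fun _ _ => rfl }
    refine Module.Finite.of_injective i fun f g h => ?_
    ext v
    exact congrArg (fun m : MultilinearMap ℝ (fun _ : Fin k => E) ℝ => m v) h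
  obtain ⟨r, hr⟩ := LinearMap.exists_leftInverse_of_injective
    (ContinuousAlternatingMap.toContinuousMultilinearMapCLM (𝕜 := ℝ) (E := E) (F := ℝ)
      (ι := Fin k) ℝ).toLinearMap (by
        rw [LinearMap.ker_eq_bot]
        exact ContinuousAlternatingMap.toContinuousMultilinearMap_injective)
  exact ⟨LinearMap.toContinuousLinearMap r, fun c => congrArg (fun f => f c) hr⟩

/-- The pullback of a smooth family of alternating maps by a smooth family of linear maps is
smooth. -/
lemma contDiffAt_compContinuousLinearMap [FiniteDimensional ℝ E]
    {E' : Type*} [NormedAddCommGroup E'] [NormedSpace ℝ E'] [FiniteDimensional ℝ E']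
    {k : ℕ} {n : WithTop ℕ∞} {c : F → E [⋀^Fin k]→L[ℝ] ℝ} {L : F → E' →L[ℝ] E} {x : F}
    (hc : ContDiffAt ℝ n c x) (hL : ContDiffAt ℝ n L x) :
    ContDiffAt ℝ n (fun y => (c y).compContinuousLinearMap (L y)) x := by
  obtain ⟨r, hr⟩ := exists_leftInverse_toContinuousMultilinearMapCLM (E := E') k
  have h1 : ContDiffAt ℝ n (fun y => (c y).toContinuousMultilinearMap) x :=
    (ContinuousAlternatingMap.toContinuousMultilinearMapCLM (𝕜 := ℝ) (E := E) (F := ℝ)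
      (ι := Fin k) ℝ).contDiff.contDiffAt.comp x hc
  have h2 : ContDiffAt ℝ n (fun y => ((c y).toContinuousMultilinearMap).compContinuousLinearMap
      (fun _ : Fin k => L y)) x :=
    (ContinuousMultilinearMap.analyticAt_uncurry_compContinuousLinearMap
      (q := (fun _ : Fin k => L x, (c x).toContinuousMultilinearMap))).contDiffAt.comp
      (f := fun y => (fun _ : Fin k => L y, (c y).toContinuousMultilinearMap)) x
      ((contDiffAt_pi.2 fun _ => hL).prodMk h1)
  refine (r.contDiff.contDiffAt.comp x h2).congr_of_eventuallyEq (Filter.Eventually.of_forall ?_)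
  intro y
  exact (hr _).symm

lemma contDiff_extDeriv {k : ℕ} {τ : E → E [⋀^Fin k]→L[ℝ] ℝ} (h : ContDiff ℝ ∞ τ) :
    ContDiff ℝ ∞ (extDeriv τ) := by
  have h1 : ContDiff ℝ ∞ (fderiv ℝ τ) := h.fderiv_right (m := ∞) (by simp)
  exact (ContinuousAlternatingMap.alternatizeUncurryFinCLM (n := k) ℝ E ℝ).contDiff.comp h1

/-! ### Weighted averages along a translation -/

/-- The weighted average `x ↦ ∫₀¹ φ(q) G(x + q v) dq` of `G` in the direction `v`. -/
def lineAvg (φ : ℝ → ℝ) (v : E) (G : E → F) (x : E) : F :=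
  ∫ q in (0 : ℝ)..1, φ q • G (x + q • v)

lemma hasFDerivAt_lineAvg [CompleteSpace F] [FiniteDimensional ℝ E] {φ : ℝ → ℝ} (hφ : Continuous φ)
    (v : E) {G : E → F} (hG : ContDiff ℝ 1 G) (x : E) :
    HasFDerivAt (lineAvg φ v G) (lineAvg φ v (fderiv ℝ G) x) x := by
  have hG' : Continuous (fderiv ℝ G) := hG.continuous_fderiv (by simp)
  have hcont : Continuous fun p : E × ℝ => φ p.2 • fderiv ℝ G (p.1 + p.2 • v) := by fun_prop
  have : ProperSpace E := FiniteDimensional.proper ℝ E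
  -- The dominating constant is the maximum of the differentiated integrand over a compact ball
  -- times the segment.
  obtain ⟨C, hC⟩ := ((isCompact_closedBall x 1).prod (isCompact_Icc (a := (0 : ℝ)) (b := 1))
    ).exists_bound_of_continuousOn hcont.continuousOn
  have c1 (y : E) : Continuous fun q : ℝ => φ q • G (y + q • v) := by
    have := hG.continuous
    fun_prop
  have c2 (y : E) : Continuous fun q : ℝ => φ q • fderiv ℝ G (y + q • v) := by fun_prop
  refine intervalIntegral.hasFDerivAt_integral_of_dominated_of_fderiv_le (bound := fun _ => C)
    (F := fun y q => φ q • G (y + q • v)) (F' := fun y q => φ q • fderiv ℝ G (y + q • v))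
    (Metric.closedBall_mem_nhds x zero_lt_one)
    (Filter.Eventually.of_forall fun y => (c1 y).aestronglyMeasurable)
    ((c1 x).intervalIntegrable _ _) (c2 x).aestronglyMeasurable
    (Filter.Eventually.of_forall fun q hq y hy => ?_) intervalIntegrable_const
    (Filter.Eventually.of_forall fun q _ y _ => ?_)
  · rw [Set.uIoc_of_le zero_le_one] at hq
    exact hC (y, q) ⟨hy, hq.1.le, hq.2⟩
  · have h1 : HasFDerivAt G (fderiv ℝ G (y + q • v)) (y + q • v) :=
      (hG.differentiable (by simp) _).hasFDerivAt
    have h2 : HasFDerivAt (fun y : E => y + q • v) (ContinuousLinearMap.id ℝ E) y :=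
      (hasFDerivAt_id y).add_const _
    have h3 : HasFDerivAt (fun y : E => G (y + q • v)) (fderiv ℝ G (y + q • v)) y := h1.comp y h2
    exact h3.const_smul (φ q)

/-- The derivative of an average is the average of the derivative, so the induction replaces `F` by
`E →L[ℝ] F`. This stays in one universe because `E` and `F` share it. -/
lemma contDiff_nat_lineAvg {E : Type u} [NormedAddCommGroup E] [NormedSpace ℝ E]
    [FiniteDimensional ℝ E] {φ : ℝ → ℝ} (hφ : Continuous φ)
    (v : E) : ∀ (n : ℕ) {F : Type u} [NormedAddCommGroup F] [NormedSpace ℝ F] [CompleteSpace F]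
    {G : E → F}, ContDiff ℝ ∞ G → ContDiff ℝ n (lineAvg φ v G)
  | 0, F, _, _, _, G, hG => by
    have h := fun x => (hasFDerivAt_lineAvg hφ v (hG.of_le (by simp)) x)
    exact contDiff_zero.2 (continuous_iff_continuousAt.2 fun x => (h x).continuousAt)
  | n + 1, F, _, _, _, G, hG => by
    push_cast
    rw [contDiff_succ_iff_hasFDerivAt]
    exact ⟨lineAvg φ v (fderiv ℝ G),
      contDiff_nat_lineAvg hφ v n (hG.fderiv_right (m := ∞) (by simp)),
      hasFDerivAt_lineAvg hφ v (hG.of_le (by simp))⟩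

lemma contDiff_lineAvg {E F : Type u} [NormedAddCommGroup E] [NormedSpace ℝ E]
    [FiniteDimensional ℝ E] [NormedAddCommGroup F] [NormedSpace ℝ F] [CompleteSpace F]
    {φ : ℝ → ℝ} (hφ : Continuous φ) (v : E) {G : E → F} (hG : ContDiff ℝ ∞ G) :
    ContDiff ℝ ∞ (lineAvg φ v G) :=
  contDiff_infty.2 fun n => contDiff_nat_lineAvg hφ v n hG

lemma map_lineAvg {F' : Type*} [NormedAddCommGroup F'] [NormedSpace ℝ F'] [CompleteSpace F]
    [CompleteSpace F'] (A : F →L[ℝ] F') {φ : ℝ → ℝ} (hφ : Continuous φ) (v : E) {G : E → F}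
    (hG : Continuous G) (x : E) :
    A (lineAvg φ v G x) = lineAvg φ v (fun y => A (G y)) x := by
  have hi : IntervalIntegrable (fun q : ℝ => φ q • G (x + q • v)) MeasureTheory.volume 0 1 :=
    Continuous.intervalIntegrable (by fun_prop) _ _
  refine (A.intervalIntegral_comp_comm hi).symm.trans ?_
  simp only [map_smul]
  rfl

/-- With the alternatization map as `A`, this says that averaging commutes with `d`. -/
lemma map_fderiv_lineAvg {F' : Type*} [NormedAddCommGroup F'] [NormedSpace ℝ F'] [CompleteSpace F]
    [CompleteSpace F'] [FiniteDimensional ℝ E] (A : (E →L[ℝ] F) →L[ℝ] F') {φ : ℝ → ℝ}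
    (hφ : Continuous φ) (v : E) {G : E → F} (hG : ContDiff ℝ 1 G) (x : E) :
    A (fderiv ℝ (lineAvg φ v G) x) = lineAvg φ v (fun y => A (fderiv ℝ G y)) x := by
  rw [(hasFDerivAt_lineAvg hφ v hG x).fderiv]
  exact map_lineAvg A hφ v (hG.continuous_fderiv (by simp)) x

lemma extDeriv_lineAvg [FiniteDimensional ℝ E] {φ : ℝ → ℝ} (hφ : Continuous φ) (v : E) {k : ℕ}
    {τ : E → E [⋀^Fin k]→L[ℝ] ℝ} (hτ : ContDiff ℝ ∞ τ) :
    extDeriv (lineAvg φ v τ) = lineAvg φ v (extDeriv τ) :=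
  funext fun x => map_fderiv_lineAvg (F := E [⋀^Fin k]→L[ℝ] ℝ)
    (ContinuousAlternatingMap.alternatizeUncurryFinCLM (n := k) ℝ E ℝ) hφ v (hτ.of_le (by simp)) x

lemma lineAvg_add_eq {φ : ℝ → ℝ} {v u : E} {G : E → F} (h : ∀ x, G (x + u) = G x) (x : E) :
    lineAvg φ v G (x + u) = lineAvg φ v G x := by
  simp only [lineAvg, add_right_comm x u, h]

/-- Averaging a function of period `v` in the direction `v` makes it invariant in that
direction. -/
lemma lineAvg_one_add_smul {v : E} {G : E → F} (h : ∀ x, G (x + v) = G x) (x : E) (r : ℝ) :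
    lineAvg (fun _ => 1) v G (x + r • v) = lineAvg (fun _ => 1) v G x := by
  -- Moving `x` by `r • v` moves the window of integration to `[r, r + 1]`, and the integral of a
  -- periodic function over a full period does not depend on the window.
  have hper : Function.Periodic (fun q : ℝ => G (x + q • v)) 1 := fun q => by
    simp only [add_smul, one_smul, ← add_assoc, h]
  have h1 := hper.intervalIntegral_add_eq r 0
  rw [zero_add] at h1
  simp only [lineAvg, one_smul]
  rw [← h1, add_comm r 1]
  have h2 := intervalIntegral.integral_comp_add_right (a := 0) (b := 1)
    (fun q : ℝ => G (x + q • v)) r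
  rw [zero_add] at h2
  rw [← h2]
  simp only [add_smul, add_assoc, add_comm (r • v)]

/-- Integration by parts along the segment from `x` to `x + v`: the weight `1 - q` vanishes at `q =
1` and is `1` at `q = 0`, so the only boundary term is `G x`. -/
lemma integral_lineAvg_fderiv [CompleteSpace F] (v : E) {G : E → F} (hG : ContDiff ℝ 1 G) (x : E) :
    lineAvg (fun q => 1 - q) v (fun y => fderiv ℝ G y v) x =
      lineAvg (fun _ => 1) v G x - G x := by
  have hc : Continuous (fderiv ℝ G) := hG.continuous_fderiv (by simp)
  have hG0 := hG.continuous
  have h1 (q : ℝ) : HasDerivAt (fun q : ℝ => G (x + q • v)) (fderiv ℝ G (x + q • v) v) q := by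
    have h1 : HasFDerivAt G (fderiv ℝ G (x + q • v)) (x + q • v) :=
      (hG.differentiable (by simp) _).hasFDerivAt
    have h2 : HasDerivAt (fun q : ℝ => x + q • v) v q := by
      simpa using ((hasDerivAt_id q).smul_const v).const_add x
    exact h1.comp_hasDerivAt q h2
  have h2 (q : ℝ) : HasDerivAt (fun q : ℝ => (1 - q) • G (x + q • v))
      ((1 - q) • fderiv ℝ G (x + q • v) v - G (x + q • v)) q := by
    have := ((hasDerivAt_id q).const_sub 1).smul (h1 q)
    rw [neg_one_smul, ← sub_eq_add_neg] at this
    exact this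
  have i1 : IntervalIntegrable (fun q : ℝ => (1 - q) • fderiv ℝ G (x + q • v) v)
    MeasureTheory.volume 0 1 := Continuous.intervalIntegrable (by fun_prop) _ _
  have i2 : IntervalIntegrable (fun q : ℝ => G (x + q • v))
    MeasureTheory.volume 0 1 := Continuous.intervalIntegrable (by fun_prop) _ _
  have h3 := intervalIntegral.integral_eq_sub_of_hasDerivAt (fun q _ => h2 q) (i1.sub i2)
  rw [intervalIntegral.integral_sub i1 i2] at h3
  simp only [sub_self, zero_smul, sub_zero, one_smul, add_zero, zero_sub] at h3
  simp only [lineAvg, one_smul]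
  rw [sub_eq_add_neg, ← h3]
  abel

/-! ### Cartan's formula for constant vector fields -/

/-- The contraction of a form with a constant vector field. -/
def contract {k : ℕ} (v : E) (τ : E → E [⋀^Fin (k + 1)]→L[ℝ] ℝ) : E → E [⋀^Fin k]→L[ℝ] ℝ :=
  fun x => (τ x).curryLeft v

/-- Contraction with `v` as a continuous linear map. -/
def contractCLM (k : ℕ) (v : E) : (E [⋀^Fin (k + 1)]→L[ℝ] ℝ) →L[ℝ] (E [⋀^Fin k]→L[ℝ] ℝ) :=
  (ContinuousLinearMap.apply ℝ _ v).comp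
    (ContinuousAlternatingMap.curryLeftLI (𝕜 := ℝ) (E := E) (F := ℝ) (n := k)).toContinuousLinearMap

lemma contractCLM_apply {k : ℕ} (v : E) (c : E [⋀^Fin (k + 1)]→L[ℝ] ℝ) :
    contractCLM k v c = c.curryLeft v := rfl

lemma contDiff_contract {k : ℕ} (v : E) {τ : E → E [⋀^Fin (k + 1)]→L[ℝ] ℝ} (h : ContDiff ℝ ∞ τ) :
    ContDiff ℝ ∞ (contract v τ) :=
  (contractCLM k v).contDiff.comp h

/-- In the alternating sum with first argument `v`, the term `i = 0` is `f v`. In every other term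
`v` stays in the first slot of the form, and the sign is shifted by one. -/
lemma curryLeft_alternatizeUncurryFin {k : ℕ} (v : E) (f : E →L[ℝ] E [⋀^Fin (k + 1)]→L[ℝ] ℝ) :
    (ContinuousAlternatingMap.alternatizeUncurryFin f).curryLeft v =
      f v - ContinuousAlternatingMap.alternatizeUncurryFin ((contractCLM k v).comp f) := by
  ext w
  rw [ContinuousAlternatingMap.curryLeft_apply_apply,
    ContinuousAlternatingMap.alternatizeUncurryFin_apply, Fin.sum_univ_succ,
    ContinuousAlternatingMap.sub_apply, ContinuousAlternatingMap.alternatizeUncurryFin_apply,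
    sub_eq_add_neg, ← Finset.sum_neg_distrib]
  congr 1
  · simp
  · refine Finset.sum_congr rfl fun i _ => ?_
    simp [contractCLM_apply, pow_succ]
    congr 1
    funext j
    refine Fin.cases ?_ (fun j => ?_) j
    · simp [Fin.removeNth]
    · simp [Fin.removeNth]

/-- Cartan's formula for the constant vector field `v`. -/
lemma extDeriv_contract {k : ℕ} (v : E) {τ : E → E [⋀^Fin (k + 1)]→L[ℝ] ℝ} {x : E}
    (h : DifferentiableAt ℝ τ x) :
    extDeriv (contract v τ) x = fderiv ℝ τ x v - (extDeriv τ x).curryLeft v := by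
  have h1 : fderiv ℝ (contract v τ) x = (contractCLM k v).comp (fderiv ℝ τ x) :=
    ((contractCLM k v).hasFDerivAt.comp x h.hasFDerivAt).fderiv
  rw [extDeriv, extDeriv, curryLeft_alternatizeUncurryFin, h1]
  abel

/-- A closed form differs from its average in the direction `v` by an exact form. -/
lemma extDeriv_lineAvg_contract [FiniteDimensional ℝ E] {k : ℕ} (v : E)
    {τ : E → E [⋀^Fin (k + 1)]→L[ℝ] ℝ} (hτ : ContDiff ℝ ∞ τ) (hd : extDeriv τ = 0) :
    extDeriv (lineAvg (fun q => 1 - q) v (contract v τ)) = lineAvg (fun _ => 1) v τ - τ := by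
  rw [extDeriv_lineAvg (by fun_prop) v (contDiff_contract v hτ)]
  -- For closed `τ` Cartan's formula leaves only the derivative along `v`, which the weight `1 - q`
  -- integrates to the average minus `τ`.
  have h : extDeriv (contract v τ) = fun y => fderiv ℝ τ y v := by
    funext y
    rw [extDeriv_contract v (hτ.differentiable (by simp) y), hd]
    ext; simp
  rw [h]
  funext x
  exact integral_lineAvg_fderiv v (hτ.of_le (by simp)) x

/-- The exterior derivative of `f • τ` for a function `f`. -/
lemma extDeriv_smul_fun {k : ℕ} {f : E → ℝ} {τ : E → E [⋀^Fin k]→L[ℝ] ℝ} {x : E}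
    (hf : DifferentiableAt ℝ f x) (h : DifferentiableAt ℝ τ x) :
    extDeriv (fun y => f y • τ y) x = f x • extDeriv τ x +
      wedgeAt (ContinuousAlternatingMap.ofSubsingleton ℝ E ℝ (0 : Fin 1) (fderiv ℝ f x)) (τ x) := by
  rw [extDeriv, fderiv_fun_smul hf h, ContinuousAlternatingMap.alternatizeUncurryFin_add,
    ContinuousAlternatingMap.alternatizeUncurryFin_smul, wedgeAt, Equiv.symm_apply_apply]
  rfl

end Calculus

end MorseNovikov


/-! ### Horizontal constant forms, the lattice and periodic forms on the cover. -/

namespace Inoue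

open MorseNovikov

/-- Differential forms on the universal cover `ℂ × ℂ`, with coordinates `(z, x + i y)`. -/
abbrev CoverForm (k : ℕ) : Type := ℂ × ℂ → (ℂ × ℂ) [⋀^Fin k]→L[ℝ] ℝ

/-- The vector field `∂/∂y`. -/
def vertical : ℂ × ℂ := (0, Complex.I)

/-- The linear form `dy`. -/
def heightCLM : ℂ × ℂ →L[ℝ] ℝ := Complex.imCLM.comp (ContinuousLinearMap.snd ℝ ℂ ℂ)

@[simp] lemma heightCLM_apply (v : ℂ × ℂ) : heightCLM v = v.2.im := rfl

/-- The projection onto `ℂ × ℝ` along `∂/∂y`. -/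
def horProj : ℂ × ℂ →L[ℝ] ℂ × ℂ :=
  ContinuousLinearMap.id ℝ (ℂ × ℂ) - heightCLM.smulRight vertical

lemma horProj_apply (v : ℂ × ℂ) : horProj v = v - v.2.im • vertical := rfl

lemma horProj_im (v : ℂ × ℂ) : (horProj v).2.im = 0 := by simp [horProj_apply, vertical]

variable (k : ℕ) in
/-- Constant forms that do not involve `dy`. -/
def horForms : Submodule ℝ ((ℂ × ℂ) [⋀^Fin k]→L[ℝ] ℝ) where
  carrier := {c | c.compContinuousLinearMap horProj = c}
  zero_mem' := rfl
  add_mem' := fun {c d} hc hd => by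
    change (c + d).compContinuousLinearMap horProj = c + d
    conv_rhs => rw [← hc, ← hd]
    rfl
  smul_mem' := fun r c hc => by
    change (r • c).compContinuousLinearMap horProj = r • c
    conv_rhs => rw [← hc]
    rfl

lemma horForms_apply {k : ℕ} {c : (ℂ × ℂ) [⋀^Fin k]→L[ℝ] ℝ} (hc : c ∈ horForms k)
    (v : Fin k → ℂ × ℂ) : c v = c fun i => horProj (v i) := by
  have h : c.compContinuousLinearMap horProj = c := hc
  conv_lhs => rw [← h]
  rfl

lemma horForms_ext {k : ℕ} {c : (ℂ × ℂ) [⋀^Fin k]→L[ℝ] ℝ} (hc : c ∈ horForms k)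
    (h : ∀ v : Fin k → ℂ × ℂ, (∀ i, (v i).2.im = 0) → c v = 0) : c = 0 := by
  ext v
  rw [horForms_apply hc]
  exact h _ fun i => horProj_im _

/-- A form killed by contraction with `∂/∂y` vanishes as soon as `∂/∂y` occupies any slot, so each
argument may be replaced by its horizontal projection. -/
lemma mem_horForms_of_curryLeft {k : ℕ} {c : (ℂ × ℂ) [⋀^Fin (k + 1)]→L[ℝ] ℝ}
    (hc : c.curryLeft vertical = 0) : c ∈ horForms (k + 1) := by
  have h0 (i : Fin (k + 1)) (v : Fin (k + 1) → ℂ × ℂ) :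
      c (Function.update v i vertical) = 0 := by
    have h1 : Function.update v i vertical = i.insertNth vertical (i.removeNth v) := by
      rw [Fin.insertNth_removeNth]
    have h2 := congrArg (fun f => f (i.removeNth v)) hc
    simp only [ContinuousAlternatingMap.curryLeft_apply_apply] at h2
    rw [h1, ContinuousAlternatingMap.map_insertNth, h2]
    simp
  -- The set `s` collects the slots already projected; multilinearity projects one more at a time.
  have h1 (v : Fin (k + 1) → ℂ × ℂ) (s : Finset (Fin (k + 1))) :
      c (s.piecewise (fun i => horProj (v i)) v) = c v := by
    induction s using Finset.induction_on with
    | empty => simp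
    | insert j s hj ih =>
      rw [Finset.piecewise_insert, horProj_apply, sub_eq_add_neg, ← neg_smul,
        ContinuousAlternatingMap.map_update_add, ContinuousAlternatingMap.map_update_smul, h0,
        smul_zero, add_zero, ← ih]
      congr 1
      rw [Function.update_eq_self_iff]
      simp [hj]
  change c.compContinuousLinearMap horProj = c
  ext v
  have := h1 v Finset.univ
  rw [Finset.piecewise_univ] at this
  exact this

namespace InoueData

variable (D : InoueData)

/-- The real span of the translation lattice, inside `ℂ × ℂ`. -/
def lat : (Fin 3 → ℝ) →ₗ[ℝ] ℂ × ℂ :=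
  (LinearMap.prodMap LinearMap.id Complex.ofRealCLM.toLinearMap).comp D.period

lemma lat_apply (x : Fin 3 → ℝ) :
    D.lat x = (∑ i, (x i : ℂ) * D.b i, ((∑ i, x i * D.a i : ℝ) : ℂ)) := by
  rw [lat, LinearMap.comp_apply, period_apply]
  rfl

lemma lat_im (x : Fin 3 → ℝ) : (D.lat x).2.im = 0 := by rw [lat_apply, Complex.ofReal_im]

/-- The period map is injective between real spaces of dimension three, hence onto. So invariance
along the three generators is invariance along all horizontal vectors. -/
lemma exists_lat_eq {v : ℂ × ℂ} (hv : v.2.im = 0) : ∃ x, D.lat x = v := by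
  have hs : Function.Surjective D.period := by
    rw [← LinearMap.injective_iff_surjective_of_finrank_eq_finrank (by simp)]
    exact LinearMap.ker_eq_bot.1 D.ker_period
  obtain ⟨x, hx⟩ := hs (v.1, v.2.re)
  refine ⟨x, ?_⟩
  rw [lat, LinearMap.comp_apply, hx]
  refine Prod.ext rfl (Complex.ext ?_ ?_) <;> simp [hv]

/-- The linear part `(z, x + i y) ↦ (βⁿ z, αⁿ x + i y)` of a deck transformation. -/
def deckLin (n : ℤ) : ℂ × ℂ →L[ℝ] ℂ × ℂ :=
  ((ContinuousLinearMap.mul ℝ ℂ (D.β ^ n)).comp (ContinuousLinearMap.fst ℝ ℂ ℂ)).prod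
    ((D.α ^ n • Complex.ofRealCLM.comp
      (Complex.reCLM.comp (ContinuousLinearMap.snd ℝ ℂ ℂ))) + heightCLM.smulRight Complex.I)

lemma deckLin_apply (n : ℤ) (v : ℂ × ℂ) :
    D.deckLin n v = (D.β ^ n * v.1, ((D.α ^ n : ℝ) : ℂ) * v.2.re + v.2.im * Complex.I) := by
  refine Prod.ext rfl ?_
  simp [deckLin]

lemma deckLin_im (n : ℤ) (v : ℂ × ℂ) : (D.deckLin n v).2.im = v.2.im := by
  simp only [deckLin_apply]
  rw [← Complex.ofReal_mul]
  simp only [Complex.add_im, Complex.ofReal_im, Complex.ofReal_re, Complex.mul_im, Complex.I_im,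
    Complex.I_re]
  ring

lemma deckLin_re (n : ℤ) (v : ℂ × ℂ) : (D.deckLin n v).2.re = D.α ^ n * v.2.re := by
  simp only [deckLin_apply]
  rw [← Complex.ofReal_mul]
  simp only [Complex.add_re, Complex.ofReal_im, Complex.ofReal_re, Complex.mul_re, Complex.I_im,
    Complex.I_re]
  ring

lemma deckLin_deckLin (m n : ℤ) (v : ℂ × ℂ) :
    D.deckLin m (D.deckLin n v) = D.deckLin (m + n) v := by
  refine Prod.ext ?_ (Complex.ext ?_ ?_)
  · simp only [deckLin_apply, zpow_add₀ D.β_ne_zero, mul_assoc]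
  · simp only [deckLin_re, zpow_add₀ D.α_pos.ne', mul_assoc]
  · simp only [deckLin_im]

lemma deckLin_zero (v : ℂ × ℂ) : D.deckLin 0 v = v := by
  refine Prod.ext ?_ (Complex.ext ?_ ?_)
  · simp [deckLin_apply]
  · simp [deckLin_re]
  · simp [deckLin_im]

lemma deckLin_vertical (n : ℤ) : D.deckLin n vertical = vertical := by
  simp [deckLin_apply, vertical]

/-- The eigenvector equations make the dilation act on the lattice through the integer matrix `A ^
n`. This is why pulling back by it preserves periodicity. -/
lemma deckLin_lat (n : ℤ) (m : Fin 3 → ℤ) :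
    D.deckLin n (D.lat fun i => (m i : ℝ)) = D.lat fun i => ((m ᵥ* (D.A ^ n).1) i : ℝ) := by
  have h1 := zpow_sum D.A D.β_ne_zero D.mulVec_b n m
  have h2 := zpow_sum D.A D.α_pos.ne' D.mulVec_a n m
  refine Prod.ext ?_ (Complex.ext ?_ ?_)
  · simp only [deckLin_apply, lat_apply]
    push_cast at h1 ⊢
    exact h1
  · rw [deckLin_re]
    simp only [lat_apply, Complex.ofReal_re]
    exact h2
  · rw [deckLin_im, lat_im, lat_im]

/-- Smooth forms on the universal cover that are periodic with respect to the translations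
in `G_A`. -/
def perForms (k : ℕ) : Submodule ℝ (CoverForm k) where
  carrier := {τ | ContDiff ℝ ∞ τ ∧ ∀ (m : Fin 3 → ℤ) (x : ℂ × ℂ),
    τ (x + D.lat fun i => (m i : ℝ)) = τ x}
  zero_mem' := ⟨contDiff_const, fun _ _ => rfl⟩
  add_mem' := fun {_ _} h₁ h₂ => ⟨h₁.1.add h₂.1, fun m x => by
    rw [Pi.add_apply, Pi.add_apply, h₁.2, h₂.2]⟩
  smul_mem' := fun c _ h => ⟨h.1.const_smul c, fun m x => by rw [Pi.smul_apply, Pi.smul_apply, h.2]⟩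

variable {D} {k : ℕ}

lemma perForms_const (c : (ℂ × ℂ) [⋀^Fin k]→L[ℝ] ℝ) : (fun _ => c) ∈ D.perForms k :=
  ⟨contDiff_const, fun _ _ => rfl⟩

end InoueData

lemma two_le_infty : minSmoothness ℝ 2 ≤ (∞ : WithTop ℕ∞) := by
  rw [minSmoothness_of_isRCLikeNormedField]
  exact WithTop.coe_le_coe.2 (le_top : (2 : ℕ∞) ≤ ⊤)

lemma fderiv_apply_eq_zero_of_invariant {E F : Type*} [NormedAddCommGroup E] [NormedSpace ℝ E]
    [NormedAddCommGroup F] [NormedSpace ℝ F] {G : E → F} {x v : E} (hG : DifferentiableAt ℝ G x)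
    (h : ∀ r : ℝ, G (x + r • v) = G x) : fderiv ℝ G x v = 0 := by
  have g2 : HasDerivAt (fun r : ℝ => x + r • v) v 0 := by
    simpa using ((hasDerivAt_id (0 : ℝ)).smul_const v).const_add x
  have g1 : HasFDerivAt G (fderiv ℝ G x) (x + (0 : ℝ) • v) := by
    simpa using hG.hasFDerivAt
  have e1 : HasDerivAt (fun r : ℝ => G (x + r • v)) (fderiv ℝ G x v) 0 :=
    g1.comp_hasDerivAt (0 : ℝ) g2
  rw [funext h] at e1
  exact e1.unique (hasDerivAt_const _ _)

lemma extDeriv_add_right {E : Type*} [NormedAddCommGroup E] [NormedSpace ℝ E] {k : ℕ}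
    {τ : E → E [⋀^Fin k]→L[ℝ] ℝ} {u : E} (h : ∀ x, τ (x + u) = τ x) (x : E) :
    extDeriv τ (x + u) = extDeriv τ x := by
  rw [extDeriv, extDeriv, ← fderiv_comp_add_right, funext h]

lemma extDeriv_sub_of_contDiff {E : Type*} [NormedAddCommGroup E] [NormedSpace ℝ E] {k : ℕ}
    {τ τ' : E → E [⋀^Fin k]→L[ℝ] ℝ} (h : ContDiff ℝ ∞ τ) (h' : ContDiff ℝ ∞ τ') :
    extDeriv (τ - τ') = extDeriv τ - extDeriv τ' := by
  funext x
  have hd := h.differentiable (by simp) x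
  have hd' := h'.differentiable (by simp) x
  have h1 := extDeriv_add (hd.sub hd') hd'
  rw [sub_add_cancel] at h1
  rw [Pi.sub_apply, h1, add_sub_cancel_right]

lemma extDeriv_add_of_contDiff {E : Type*} [NormedAddCommGroup E] [NormedSpace ℝ E] {k : ℕ}
    {τ τ' : E → E [⋀^Fin k]→L[ℝ] ℝ} (h : ContDiff ℝ ∞ τ) (h' : ContDiff ℝ ∞ τ') :
    extDeriv (τ + τ') = extDeriv τ + extDeriv τ' :=
  funext fun x => extDeriv_add (h.differentiable (by simp) x) (h'.differentiable (by simp) x)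

lemma extDeriv_const_form {E : Type*} [NormedAddCommGroup E] [NormedSpace ℝ E] {k : ℕ}
    (c : E [⋀^Fin k]→L[ℝ] ℝ) : extDeriv (fun _ : E => c) = 0 := by
  funext x
  ext v
  simp [extDeriv, ContinuousAlternatingMap.alternatizeUncurryFin_apply]

lemma extDeriv_extDeriv_of_contDiff {E : Type*} [NormedAddCommGroup E] [NormedSpace ℝ E] {k : ℕ}
    {τ : E → E [⋀^Fin k]→L[ℝ] ℝ} (h : ContDiff ℝ ∞ τ) : extDeriv (extDeriv τ) = 0 :=
  extDeriv_extDeriv h two_le_infty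

/-! ### Averaging over the torus: the cohomology of periodic forms. -/

namespace InoueData

variable {D : InoueData} {k : ℕ}

lemma perForms_extDeriv {τ : CoverForm k} (h : τ ∈ D.perForms k) :
    extDeriv τ ∈ D.perForms (k + 1) :=
  ⟨contDiff_extDeriv h.1, fun m => extDeriv_add_right (h.2 m)⟩

lemma perForms_lineAvg {φ : ℝ → ℝ} (hφ : Continuous φ) (v : ℂ × ℂ) {τ : CoverForm k}
    (h : τ ∈ D.perForms k) : lineAvg φ v τ ∈ D.perForms k :=
  ⟨contDiff_lineAvg hφ v h.1, fun m => lineAvg_add_eq (h.2 m)⟩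

lemma perForms_contract (v : ℂ × ℂ) {τ : CoverForm (k + 1)} (h : τ ∈ D.perForms (k + 1)) :
    contract v τ ∈ D.perForms k :=
  ⟨contDiff_contract v h.1, fun m x => by rw [contract, contract, h.2]⟩

variable (D) in
/-- The `i`-th generator of the lattice. -/
def gen (i : Fin 3) : ℂ × ℂ := D.lat fun j => ((Pi.single i 1 : Fin 3 → ℤ) j : ℝ)

lemma lat_eq_sum (x : Fin 3 → ℝ) : D.lat x = ∑ i, x i • D.gen i := by
  simp only [gen, ← map_smul, ← map_sum]
  congr 1
  funext j
  simp [Pi.single_apply]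

variable (D) in
/-- The average of a form over the fibre torus. -/
def torusAvg (τ : CoverForm k) : CoverForm k :=
  lineAvg (fun _ => 1) (D.gen 2) (lineAvg (fun _ => 1) (D.gen 1) (lineAvg (fun _ => 1) (D.gen 0) τ))

lemma perForms_torusAvg {τ : CoverForm k} (h : τ ∈ D.perForms k) : D.torusAvg τ ∈ D.perForms k :=
  perForms_lineAvg continuous_const _ (perForms_lineAvg continuous_const _
    (perForms_lineAvg continuous_const _ h))

lemma extDeriv_torusAvg {τ : CoverForm k} (h : τ ∈ D.perForms k) :
    extDeriv (D.torusAvg τ) = D.torusAvg (extDeriv τ) := by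
  have h1 := perForms_lineAvg (φ := fun _ => 1) continuous_const (D.gen 0) h
  have h2 := perForms_lineAvg (φ := fun _ => 1) continuous_const (D.gen 1) h1
  rw [torusAvg, extDeriv_lineAvg continuous_const _ h2.1, extDeriv_lineAvg continuous_const _ h1.1,
    extDeriv_lineAvg continuous_const _ h.1]
  rfl

lemma torusAvg_const (c : (ℂ × ℂ) [⋀^Fin k]→L[ℝ] ℝ) : D.torusAvg (fun _ => c) = fun _ => c := by
  have h (v : ℂ × ℂ) : lineAvg (fun _ => 1) v (fun _ : ℂ × ℂ => c) = fun _ => c := by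
    funext x
    simp [lineAvg]
  rw [torusAvg, h, h, h]

/-- The fibre average is invariant under all horizontal translations. -/
lemma torusAvg_add {τ : CoverForm k} (h : τ ∈ D.perForms k) {v : ℂ × ℂ} (hv : v.2.im = 0)
    (x : ℂ × ℂ) : D.torusAvg τ (x + v) = D.torusAvg τ x := by
  have h1 := perForms_lineAvg (φ := fun _ => 1) continuous_const (D.gen 0) h
  have h2 := perForms_lineAvg (φ := fun _ => 1) continuous_const (D.gen 1) h1
  -- Each average creates invariance under real multiples of its own generator, and the subsequent
  -- averages preserve it.
  have i0 (r : ℝ) (x) : D.torusAvg τ (x + r • D.gen 0) = D.torusAvg τ x :=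
    lineAvg_add_eq (lineAvg_add_eq fun x => lineAvg_one_add_smul (h.2 _) x r) x
  have i1 (r : ℝ) (x) : D.torusAvg τ (x + r • D.gen 1) = D.torusAvg τ x :=
    lineAvg_add_eq (fun x => lineAvg_one_add_smul (h1.2 _) x r) x
  have i2 (r : ℝ) (x) : D.torusAvg τ (x + r • D.gen 2) = D.torusAvg τ x :=
    lineAvg_one_add_smul (h2.2 _) x r
  obtain ⟨y, rfl⟩ := D.exists_lat_eq hv
  rw [lat_eq_sum, Fin.sum_univ_three, ← add_assoc, ← add_assoc, i2, i1, i0]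

/-- A closed form of positive degree is cohomologous to its fibre average. -/
lemma exists_torusAvg_eq_add {τ : CoverForm (k + 1)} (h : τ ∈ D.perForms (k + 1))
    (hd : extDeriv τ = 0) : ∃ ρ ∈ D.perForms k, τ = D.torusAvg τ + extDeriv ρ := by
  have step (v : ℂ × ℂ) {τ : CoverForm (k + 1)} (h : τ ∈ D.perForms (k + 1))
      (hd : extDeriv τ = 0) : extDeriv (lineAvg (fun _ => 1) v τ) = 0 ∧
      ∃ ρ ∈ D.perForms k, lineAvg (fun _ => 1) v τ = τ + extDeriv ρ := by
    refine ⟨?_, _, perForms_lineAvg (φ := fun q => 1 - q) (by fun_prop) v (perForms_contract v h),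
      ?_⟩
    · rw [extDeriv_lineAvg continuous_const _ h.1, hd]
      funext x
      simp [lineAvg]
    · rw [extDeriv_lineAvg_contract v h.1 hd, add_sub_cancel]
  have h1 := perForms_lineAvg (φ := fun _ => 1) continuous_const (D.gen 0) h
  have h2 := perForms_lineAvg (φ := fun _ => 1) continuous_const (D.gen 1) h1
  obtain ⟨d1, ρ1, p1, e1⟩ := step (D.gen 0) h hd
  obtain ⟨d2, ρ2, p2, e2⟩ := step (D.gen 1) h1 d1
  obtain ⟨-, ρ3, p3, e3⟩ := step (D.gen 2) h2 d2
  refine ⟨(0 : CoverForm k) - (ρ1 + ρ2 + ρ3), sub_mem (zero_mem _) (add_mem (add_mem p1 p2) p3), ?_⟩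
  have p12 := (D.perForms k).add_mem p1 p2
  have p123 := (D.perForms k).add_mem p12 p3
  have h0 : extDeriv (0 : CoverForm k) = 0 := extDeriv_const_form 0
  rw [torusAvg, e3, e2, e1, extDeriv_sub_of_contDiff (zero_mem (D.perForms k)).1 p123.1,
    extDeriv_add_of_contDiff p12.1 p3.1, extDeriv_add_of_contDiff p1.1 p2.1, h0]
  abel

/-- A constant horizontal form that is exact is zero. -/
lemma eq_zero_of_const_exact {c : (ℂ × ℂ) [⋀^Fin (k + 1)]→L[ℝ] ℝ} (hc : c ∈ horForms (k + 1))
    {ρ : CoverForm k} (hρ : ρ ∈ D.perForms k) (h : (fun _ => c) = extDeriv ρ) : c = 0 := by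
  refine horForms_ext hc fun v hv => ?_
  -- Averaging fixes the constant `c`, so `ρ` may be replaced by its average. That average is
  -- constant in horizontal directions, so its differential vanishes on horizontal vectors.
  have h1 : (fun _ => c) = extDeriv (D.torusAvg ρ) := by
    rw [extDeriv_torusAvg hρ, ← h, torusAvg_const]
  have hdiff := (perForms_torusAvg hρ).1.differentiable (by simp) 0
  have h2 : c = extDeriv (D.torusAvg ρ) 0 := congrFun h1 0
  rw [h2, extDeriv, ContinuousAlternatingMap.alternatizeUncurryFin_apply]
  refine Finset.sum_eq_zero fun i _ => ?_
  have h3 : fderiv ℝ (D.torusAvg ρ) 0 (v i) = 0 :=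
    fderiv_apply_eq_zero_of_invariant hdiff fun r => torusAvg_add hρ (by simp [hv i]) 0
  rw [h3]
  simp

/-- A closed form invariant under horizontal translations is the sum of a constant horizontal
form and the differential of a form invariant under horizontal translations. -/
lemma exists_eq_const_add_of_invariant {τ : CoverForm (k + 1)} (h : ContDiff ℝ ∞ τ)
    (hinv : ∀ v : ℂ × ℂ, v.2.im = 0 → ∀ x, τ (x + v) = τ x) (hd : extDeriv τ = 0) :
    ∃ c ∈ horForms (k + 1), ∃ ρ ∈ D.perForms k, τ = (fun _ => c) + extDeriv ρ := by
  -- By horizontal invariance the `dy` part of `τ` depends on the height only. Its primitive in `y`,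
  -- as a form `ρ`, has a differential with the same `dy` part.
  let g : ℝ → (ℂ × ℂ) [⋀^Fin k]→L[ℝ] ℝ := fun q => contract vertical τ (q • vertical)
  have hg : ContDiff ℝ ∞ g :=
    (contDiff_contract vertical h).comp (contDiff_id.smul contDiff_const)
  have hgx (x : ℂ × ℂ) : g x.2.im = (τ x).curryLeft vertical := by
    have h1 := hinv _ (horProj_im x) (x.2.im • vertical)
    rw [horProj_apply, add_sub_cancel] at h1
    change (τ (x.2.im • vertical)).curryLeft vertical = _
    rw [h1]
  let P : ℝ → (ℂ × ℂ) [⋀^Fin k]→L[ℝ] ℝ := fun y => ∫ q in (0 : ℝ)..y, g q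
  have hP (y : ℝ) : HasDerivAt P (g y) y := intervalIntegral.integral_hasDerivAt_right
    (hg.continuous.intervalIntegrable _ _)
    hg.continuous.aestronglyMeasurable.stronglyMeasurableAtFilter hg.continuous.continuousAt
  have hPs : ContDiff ℝ ∞ P := by
    rw [contDiff_infty_iff_deriv]
    refine ⟨fun y => (hP y).differentiableAt, ?_⟩
    rwa [show deriv P = g from funext fun y => (hP y).deriv]
  let ρ : CoverForm k := fun x => P x.2.im
  have hρs : ContDiff ℝ ∞ ρ := hPs.comp heightCLM.contDiff
  have hρinv (v : ℂ × ℂ) (hv : v.2.im = 0) (x : ℂ × ℂ) : ρ (x + v) = ρ x := by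
    simp [ρ, hv]
  have hρ : ρ ∈ D.perForms k := ⟨hρs, fun m x => hρinv _ (D.lat_im _) x⟩
  have hfd (x : ℂ × ℂ) : fderiv ℝ ρ x vertical = (τ x).curryLeft vertical := by
    have : HasFDerivAt (P ∘ heightCLM) _ x :=
      HasFDerivAt.comp x (hP (heightCLM x)).hasFDerivAt heightCLM.hasFDerivAt
    change fderiv ℝ (P ∘ heightCLM) x vertical = _
    rw [this.fderiv, ← hgx]
    simp [vertical]
  -- `ρ` has no `dy` part, being an integral of contractions with `∂/∂y`, so Cartan's formula
  -- reduces the contraction of `dρ` to the `y`-derivative of `ρ`. In degree zero there is nothing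
  -- to contract and the formula is direct.
  have hι (x : ℂ × ℂ) : (extDeriv ρ x).curryLeft vertical = (τ x).curryLeft vertical := by
    cases k with
    | zero =>
      rw [← hfd]
      ext w
      rw [ContinuousAlternatingMap.curryLeft_apply_apply, extDeriv,
        ContinuousAlternatingMap.alternatizeUncurryFin_apply]
      simp
    | succ k =>
      have h0 : contract vertical ρ = 0 := by
        funext x
        change contractCLM k vertical (∫ q in (0 : ℝ)..x.2.im, g q) = 0
        rw [← ContinuousLinearMap.intervalIntegral_comp_comm _
          (hg.continuous.intervalIntegrable _ _)]
        refine (intervalIntegral.integral_congr (g := fun _ => 0) fun q _ => ?_).trans (by simp)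
        exact ContinuousAlternatingMap.curryLeft_same _ _
      have h1 := extDeriv_contract vertical (hρs.differentiable (by simp) x)
      have h2 : extDeriv (0 : CoverForm k) x = 0 := congrFun (extDeriv_const_form 0) x
      rw [h0, h2, hfd] at h1
      exact (sub_eq_zero.1 h1.symm).symm
  -- The remainder is closed and has no `dy` part, so Cartan's formula makes it independent of `y`.
  -- It is also horizontally invariant, hence constant.
  let κ : CoverForm (k + 1) := τ - extDeriv ρ
  have hκs : ContDiff ℝ ∞ κ := h.sub (contDiff_extDeriv hρs)
  have hκd : extDeriv κ = 0 := by
    rw [extDeriv_sub_of_contDiff h (contDiff_extDeriv hρs), hd, extDeriv_extDeriv_of_contDiff hρs,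
      sub_zero]
  have hκι : contract vertical κ = 0 := by
    funext x
    change contractCLM k vertical (τ x - extDeriv ρ x) = 0
    rw [map_sub, contractCLM_apply, contractCLM_apply, hι, sub_self]
  have hκv (x : ℂ × ℂ) : fderiv ℝ κ x vertical = 0 := by
    have h1 := extDeriv_contract vertical (hκs.differentiable (by simp) x)
    rw [hκι, hκd] at h1
    have h0 : extDeriv (0 : CoverForm k) x = 0 := congrFun (extDeriv_const_form 0) x
    rw [h0, Pi.zero_apply, ContinuousAlternatingMap.curryLeft_zero] at h1
    simpa using h1.symm
  have hκ0 (x : ℂ × ℂ) : fderiv ℝ κ x = 0 := by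
    refine ContinuousLinearMap.ext fun v => ?_
    have h1 : fderiv ℝ κ x (horProj v) = 0 :=
      fderiv_apply_eq_zero_of_invariant (hκs.differentiable (by simp) x) fun r => by
        have hr : (r • horProj v).2.im = 0 := by simp [horProj_im]
        change τ _ - extDeriv ρ _ = τ x - extDeriv ρ x
        rw [hinv _ hr, extDeriv_add_right (hρinv _ hr)]
    rw [horProj_apply, map_sub, map_smul, hκv, smul_zero, sub_zero] at h1
    exact h1
  have hκc := is_const_of_fderiv_eq_zero (hκs.differentiable (by simp)) hκ0
  refine ⟨κ 0, mem_horForms_of_curryLeft (congrFun hκι 0), ρ, hρ, ?_⟩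
  funext x
  rw [Pi.add_apply, hκc 0 x]
  exact (sub_add_cancel _ _).symm

/-- A closed periodic form of positive degree is cohomologous to a constant horizontal form. -/
lemma exists_eq_const_add {τ : CoverForm (k + 1)} (h : τ ∈ D.perForms (k + 1))
    (hd : extDeriv τ = 0) :
    ∃ c ∈ horForms (k + 1), ∃ ρ ∈ D.perForms k, τ = (fun _ => c) + extDeriv ρ := by
  obtain ⟨ρ, hρ, e⟩ := exists_torusAvg_eq_add h hd
  have hd' : extDeriv (D.torusAvg τ) = 0 := by
    rw [extDeriv_torusAvg h, hd]
    exact torusAvg_const 0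
  obtain ⟨c, hc, ρ', hρ', e'⟩ := exists_eq_const_add_of_invariant (D := D)
    (perForms_torusAvg h).1 (fun v hv => torusAvg_add h hv) hd'
  refine ⟨c, hc, ρ' + ρ, add_mem hρ' hρ, ?_⟩
  rw [extDeriv_add_of_contDiff hρ'.1 hρ.1, ← add_assoc, ← e', ← e]

end InoueData

end Inoue


/-! ### The operator `T = shift 1` and the surjectivity of `1 - T` on periodic forms. -/

namespace Inoue

open MorseNovikov

namespace InoueData

variable (D : InoueData) {k : ℕ}

/-- The map `(z, x + i y) ↦ (βⁿ z, αⁿ x + i (y + n))`. -/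
def deckShift (n : ℤ) (x : ℂ × ℂ) : ℂ × ℂ := D.deckLin n x + (n : ℝ) • vertical

lemma deckShift_im (n : ℤ) (x : ℂ × ℂ) : (D.deckShift n x).2.im = x.2.im + n := by
  simp [deckShift, deckLin_im, vertical]

lemma deckShift_add (n : ℤ) (x v : ℂ × ℂ) :
    D.deckShift n (x + v) = D.deckShift n x + D.deckLin n v := by
  simp only [deckShift, map_add]
  abel

lemma deckShift_deckShift (m n : ℤ) (x : ℂ × ℂ) :
    D.deckShift m (D.deckShift n x) = D.deckShift (m + n) x := by
  rw [deckShift, deckShift, map_add, map_smul, deckLin_vertical, deckLin_deckLin, deckShift]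
  push_cast
  rw [add_smul, add_assoc, add_comm ((n : ℝ) • vertical)]

lemma contDiff_deckShift (n : ℤ) : ContDiff ℝ ∞ (D.deckShift n) :=
  (D.deckLin n).contDiff.add contDiff_const

lemma fderiv_deckShift (n : ℤ) (x : ℂ × ℂ) : fderiv ℝ (D.deckShift n) x = D.deckLin n :=
  ((D.deckLin n).hasFDerivAt.add_const _).fderiv

/-- The pullback by the `n`-th power of the dilation, multiplied by `αⁿ`. -/
def shift (n : ℤ) : CoverForm k →ₗ[ℝ] CoverForm k where
  toFun τ x := D.α ^ n • (τ (D.deckShift n x)).compContinuousLinearMap (D.deckLin n)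
  map_add' τ τ' := by
    funext x
    ext v
    exact mul_add _ _ _
  map_smul' c τ := by
    funext x
    ext v
    exact mul_left_comm _ _ _

lemma shift_apply (n : ℤ) (τ : CoverForm k) (x : ℂ × ℂ) :
    D.shift n τ x = D.α ^ n • (τ (D.deckShift n x)).compContinuousLinearMap (D.deckLin n) := rfl

lemma shift_shift (m n : ℤ) (τ : CoverForm k) : D.shift m (D.shift n τ) = D.shift (m + n) τ := by
  funext x
  ext v
  simp only [shift_apply, ContinuousAlternatingMap.smul_apply, smul_eq_mul,
    ContinuousAlternatingMap.compContinuousLinearMap_apply, deckShift_deckShift,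
    zpow_add₀ D.α_pos.ne', add_comm n m, mul_assoc, Function.comp_def, deckLin_deckLin]

lemma shift_zero (τ : CoverForm k) : D.shift 0 τ = τ := by
  funext x
  ext v
  simp [shift_apply, deckShift, deckLin_zero, Function.comp_def]

variable {D}

lemma perForms_shift (n : ℤ) {τ : CoverForm k} (h : τ ∈ D.perForms k) :
    D.shift n τ ∈ D.perForms k := by
  refine ⟨?_, fun m x => ?_⟩
  · have h1 : ContDiff ℝ ∞ fun x => (τ (D.deckShift n x)).compContinuousLinearMap (D.deckLin n) :=
      (ContinuousAlternatingMap.compContinuousLinearMapCLM (𝕜 := ℝ) (F := ℝ) (ι := Fin k)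
        (D.deckLin n)).contDiff.comp (h.1.comp (D.contDiff_deckShift n))
    exact h1.const_smul (D.α ^ n)
  · rw [shift_apply, shift_apply, deckShift_add, deckLin_lat, h.2]

lemma extDeriv_shift (n : ℤ) {τ : CoverForm k} (h : ContDiff ℝ ∞ τ) :
    extDeriv (D.shift n τ) = D.shift n (extDeriv τ) := by
  funext x
  have h1 : D.shift n τ = D.α ^ n • fun y => (τ (D.deckShift n y)).compContinuousLinearMap
      (fderiv ℝ (D.deckShift n) y) := by
    funext y
    rw [Pi.smul_apply, fderiv_deckShift, shift_apply]
  rw [h1, extDeriv_smul, extDeriv_pullback (h.differentiable (by simp) _)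
    (D.contDiff_deckShift n).contDiffAt two_le_infty, fderiv_deckShift, shift_apply]

/-- `1 - T` is solvable on a form whose translates under the powers of `T` are locally finite. -/
lemma exists_sub_shift_eq_of_locallyFinite (ε : ℤ) {τ : CoverForm k} (h : τ ∈ D.perForms k)
    (hfin : ∀ x : ℂ × ℂ, ∃ N : ℕ, ∀ᶠ y in 𝓝 x, ∀ n ≥ N, D.shift (ε * n) τ y = 0) :
    ∃ ν ∈ D.perForms k, ν - D.shift ε ν = τ := by
  have hsum (x : ℂ × ℂ) : Summable fun n : ℕ => D.shift (ε * n) τ x := by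
    obtain ⟨N, hN⟩ := hfin x
    refine summable_of_hasFiniteSupport ((Set.finite_lt_nat N).subset fun n hn => ?_)
    by_contra hle
    exact hn (hN.self_of_nhds n (not_lt.1 hle))
  -- The geometric series for the inverse of `1 - T ^ ε`. Locally it is a finite sum, hence smooth.
  refine ⟨fun x => ∑' n : ℕ, D.shift (ε * n) τ x, ⟨?_, fun m x => ?_⟩, ?_⟩
  · refine contDiff_iff_contDiffAt.2 fun x => ?_
    obtain ⟨N, hN⟩ := hfin x
    have h1 : ContDiffAt ℝ ∞ (fun y => ∑ n ∈ Finset.range N, D.shift (ε * n) τ y) x :=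
      ContDiffAt.sum fun n _ => (perForms_shift _ h).1.contDiffAt
    refine h1.congr_of_eventuallyEq ?_
    filter_upwards [hN] with y hy
    exact tsum_eq_sum fun n hn => hy n (by simpa using hn)
  · exact tsum_congr fun n => (perForms_shift _ h).2 m x
  · funext x
    have h1 : D.shift ε (fun x => ∑' n : ℕ, D.shift (ε * n) τ x) x =
        ∑' n : ℕ, D.shift (ε * (n + 1 : ℕ)) τ x := by
      rw [shift_apply]
      have h2 := ContinuousLinearMap.map_tsum
        (D.α ^ ε • ContinuousAlternatingMap.compContinuousLinearMapCLM (F := ℝ) (ι := Fin k)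
          (D.deckLin ε)) (hsum (D.deckShift ε x))
      refine h2.trans (tsum_congr fun n => ?_)
      have h3 := congrFun (D.shift_shift ε (ε * n) τ) x
      rw [shift_apply, show ε + ε * (n : ℤ) = ε * (n + 1 : ℕ) by push_cast; ring] at h3
      exact h3
    rw [Pi.sub_apply, h1, (hsum x).tsum_eq_zero_add]
    simp [shift_zero]

/-- `1 - T` is onto on periodic forms. -/
lemma exists_sub_shift_eq {τ : CoverForm k} (h : τ ∈ D.perForms k) :
    ∃ ν ∈ D.perForms k, ν - D.shift 1 ν = τ := by
  -- The cutoff in `y` splits `τ` into `τ₁`, zero for `y ≥ 1`, and `τ₂`, zero for `y ≤ 0`. The first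
  -- is summed over positive powers of `T`, which evaluate it at increasing heights, the second over
  -- negative powers.
  let χ : ℝ → ℝ := Real.smoothTransition
  have hχ : ContDiff ℝ ∞ fun x : ℂ × ℂ => χ x.2.im :=
    Real.smoothTransition.contDiff.comp heightCLM.contDiff
  have him (x : ℂ × ℂ) (m : Fin 3 → ℤ) : (x + D.lat fun i => (m i : ℝ)).2.im = x.2.im := by
    rw [Prod.snd_add, Complex.add_im, lat_im, add_zero]
  have hcont : Continuous fun x : ℂ × ℂ => x.2.im := heightCLM.continuous
  let τ₁ : CoverForm k := fun x => (1 - χ x.2.im) • τ x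
  let τ₂ : CoverForm k := fun x => χ x.2.im • τ x
  have h₁ : τ₁ ∈ D.perForms k :=
    ⟨(contDiff_const.sub hχ).smul h.1, fun m x => by simp only [τ₁, him, h.2]⟩
  have h₂ : τ₂ ∈ D.perForms k := ⟨hχ.smul h.1, fun m x => by simp only [τ₂, him, h.2]⟩
  obtain ⟨ν₁, p₁, e₁⟩ := exists_sub_shift_eq_of_locallyFinite 1 h₁ fun x => by
    -- A nearby point has height above `x.2.im - 1`, so after `N` steps it lies above height `1`.
    obtain ⟨N, hN⟩ := exists_nat_gt (2 - x.2.im)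
    refine ⟨N, ?_⟩
    filter_upwards [(isOpen_lt continuous_const hcont).mem_nhds
      (show x.2.im - 1 < x.2.im by linarith)]
      with y hy n hn
    have hn' : (N : ℝ) ≤ n := by exact_mod_cast hn
    have : χ (D.deckShift (1 * n) y).2.im = 1 := by
      refine Real.smoothTransition.one_of_one_le ?_
      rw [deckShift_im]
      push_cast
      linarith
    rw [shift_apply]
    simp only [τ₁, this, sub_self, zero_smul]
    exact smul_zero _
  obtain ⟨ν₂, p₂, e₂⟩ := exists_sub_shift_eq_of_locallyFinite (-1) h₂ fun x => by
    obtain ⟨N, hN⟩ := exists_nat_gt (x.2.im + 1)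
    refine ⟨N, ?_⟩
    filter_upwards [(isOpen_lt hcont continuous_const).mem_nhds
      (show x.2.im < x.2.im + 1 by linarith)]
      with y hy n hn
    have hn' : (N : ℝ) ≤ n := by exact_mod_cast hn
    have : χ (D.deckShift (-1 * n) y).2.im = 0 := by
      refine Real.smoothTransition.zero_of_nonpos ?_
      rw [deckShift_im]
      push_cast
      linarith
    rw [shift_apply]
    simp only [τ₂, this, zero_smul]
    exact smul_zero _
  -- From `ν₂ - T⁻¹ ν₂ = τ₂` one gets `(1 - T)(-T⁻¹ ν₂) = τ₂`.
  refine ⟨ν₁ - D.shift (-1) ν₂, sub_mem p₁ (perForms_shift _ p₂), ?_⟩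
  have e : τ = τ₁ + τ₂ := by
    funext x
    rw [Pi.add_apply, ← add_smul, sub_add_cancel, one_smul]
  rw [map_sub, shift_shift, add_neg_cancel, shift_zero, e, ← e₁, ← e₂]
  abel

end InoueData

end Inoue


/-! ### Linear algebra: the fixed vectors of `T` on constant horizontal forms. -/

namespace Inoue

open MorseNovikov

/-- The area form `(i/2) dz ∧ dz̄`. -/
def areaForm : (ℂ × ℂ) [⋀^Fin 2]→L[ℝ] ℝ :=
  wedgeAt
    (ContinuousAlternatingMap.ofSubsingleton ℝ (ℂ × ℂ) ℝ (0 : Fin 1)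
      (Complex.reCLM.comp (ContinuousLinearMap.fst ℝ ℂ ℂ)))
    (ContinuousAlternatingMap.ofSubsingleton ℝ (ℂ × ℂ) ℝ (0 : Fin 1)
      (Complex.imCLM.comp (ContinuousLinearMap.fst ℝ ℂ ℂ)))

lemma areaForm_apply (v : Fin 2 → ℂ × ℂ) :
    areaForm v = (v 0).1.re * (v 1).1.im - (v 1).1.re * (v 0).1.im := by
  simp [areaForm, wedgeAt, ContinuousAlternatingMap.alternatizeUncurryFin_apply, Fin.removeNth]
  ring

/-- The value of a two-form on the oriented unit square of the `z`-plane. -/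
def areaCoeff : ((ℂ × ℂ) [⋀^Fin 2]→L[ℝ] ℝ) →ₗ[ℝ] ℝ where
  toFun c := c ![(1, 0), (Complex.I, 0)]
  map_add' _ _ := rfl
  map_smul' _ _ := rfl

lemma areaCoeff_apply (c : (ℂ × ℂ) [⋀^Fin 2]→L[ℝ] ℝ) :
    areaCoeff c = c ![(1, 0), (Complex.I, 0)] := rfl

lemma areaCoeff_areaForm : areaCoeff areaForm = 1 := by
  simp [areaCoeff_apply, areaForm_apply]

lemma areaForm_mem_horForms : areaForm ∈ horForms 2 := by
  change areaForm.compContinuousLinearMap horProj = areaForm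
  ext v
  simp [areaForm_apply, horProj_apply, vertical]

/-- The `z`-plane has real dimension two, so on it every two-form is a multiple of the determinant.
-/
lemma apply_fst_fst (c : (ℂ × ℂ) [⋀^Fin 2]→L[ℝ] ℝ) (z z' : ℂ) :
    c ![(z, 0), (z', 0)] = (z.re * z'.im - z'.re * z.im) * areaCoeff c := by
  have hz (z : ℂ) : ((z, 0) : ℂ × ℂ) = z.re • ((1 : ℂ), (0 : ℂ)) + z.im • (Complex.I, (0 : ℂ)) := by
    refine Prod.ext (Complex.ext ?_ ?_) ?_ <;> simp
  have h1 (u v : ℂ × ℂ) : c ![u, v] = (c.curryLeft u).curryLeft v ![] := rfl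
  have h2 (u : ℂ × ℂ) : (c.curryLeft u).curryLeft u ![] = 0 := by
    rw [ContinuousAlternatingMap.curryLeft_same]
    rfl
  have h3 : (c.curryLeft (Complex.I, 0)).curryLeft (1, 0) ![] =
      - (c.curryLeft (1, 0)).curryLeft (Complex.I, 0) ![] := by
    have := h2 ((1, 0) + (Complex.I, 0))
    simp only [map_add, ContinuousAlternatingMap.curryLeft_add,
      ContinuousAlternatingMap.add_apply, _root_.add_apply, h2] at this
    linarith
  rw [areaCoeff_apply, h1, h1, hz z, hz z']
  simp only [map_add, map_smul, ContinuousAlternatingMap.curryLeft_add,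
    ContinuousAlternatingMap.curryLeft_smul, ContinuousAlternatingMap.add_apply,
    _root_.add_apply, _root_.smul_apply,
    ContinuousAlternatingMap.smul_apply, h2, h3, smul_eq_mul]
  ring

lemma eq_fst_add_snd {v : ℂ × ℂ} (hv : v.2.im = 0) :
    v = ((v.1, 0) : ℂ × ℂ) + v.2.re • ((0 : ℂ), (1 : ℂ)) := by
  refine Prod.ext (Complex.ext ?_ ?_) (Complex.ext ?_ ?_) <;> simp [hv]

/-- Without fixed vectors `1 - S` is injective on `K`, hence onto by finite dimension. -/
lemma exists_sub_eq_of_no_fixed_vector {V : Type*} [AddCommGroup V] [Module ℝ V]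
    [FiniteDimensional ℝ V] (S : V →ₗ[ℝ] V) {K : Submodule ℝ V} (hK : ∀ c ∈ K, S c ∈ K)
    (hinj : ∀ c ∈ K, S c = c → c = 0) {m : V} (hm : m ∈ K) : ∃ c ∈ K, c - S c = m := by
  let R : K →ₗ[ℝ] K := LinearMap.id - S.restrict hK
  have hR : Function.Injective R := by
    refine (injective_iff_map_eq_zero R).2 fun c h => ?_
    refine Subtype.ext (hinj c c.2 ?_)
    have := congrArg Subtype.val h
    exact (sub_eq_zero.1 this).symm
  obtain ⟨c, hc⟩ := LinearMap.injective_iff_surjective.1 hR ⟨m, hm⟩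
  exact ⟨c, c.2, congrArg Subtype.val hc⟩

namespace InoueData

variable (D : InoueData) {k : ℕ}

/-- The transpose of `A`, acting on `ℝ³`. -/
def latShift : (Fin 3 → ℝ) →ₗ[ℝ] (Fin 3 → ℝ) :=
  Matrix.toLin' (D.A.1.map (Int.cast : ℤ → ℝ))ᵀ

lemma deckLin_one_lat (x : Fin 3 → ℝ) : D.deckLin 1 (D.lat x) = D.lat (D.latShift x) := by
  have h : (D.deckLin 1).toLinearMap.comp D.lat = D.lat.comp D.latShift := by
    refine (Pi.basisFun ℝ (Fin 3)).ext fun i => ?_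
    have h1 := D.deckLin_lat 1 (Pi.single i 1)
    have e1 : (fun j => (((Pi.single i 1 : Fin 3 → ℤ) j : ℤ) : ℝ)) = Pi.basisFun ℝ (Fin 3) i := by
      funext j
      simp [Pi.single_apply]
    rw [e1] at h1
    simp only [LinearMap.comp_apply, ContinuousLinearMap.coe_coe]
    rw [h1]
    congr 1
    funext j
    simp [latShift]
  exact congrArg (fun f => f x) h

lemma det_latShift : LinearMap.det D.latShift = 1 := by
  rw [latShift, LinearMap.det_toLin', Matrix.det_transpose]
  have h := RingHom.map_det (Int.castRingHom ℝ) D.A.1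
  rw [D.A.2] at h
  simpa using h.symm

/-- The period map conjugates the transpose of `A` to multiplication by `β` on `ℂ` and by `α` on
`ℝ`; compare determinants. This relation is what makes `1` an eigenvalue of `T` in degree two. -/
lemma α_mul_normSq_β : D.α * Complex.normSq D.β = 1 := by
  let e : (Fin 3 → ℝ) ≃ₗ[ℝ] ℂ × ℝ :=
    LinearEquiv.ofInjectiveOfFinrankEq D.period (LinearMap.ker_eq_bot.1 D.ker_period) (by simp)
  let f : ℂ × ℝ →ₗ[ℝ] ℂ × ℝ :=
    LinearMap.prodMap (LinearMap.mul ℝ ℂ D.β) (LinearMap.mul ℝ ℝ D.α)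
  have h1 : f = (e : (Fin 3 → ℝ) →ₗ[ℝ] ℂ × ℝ) ∘ₗ D.latShift ∘ₗ
      (e.symm : ℂ × ℝ →ₗ[ℝ] (Fin 3 → ℝ)) := by
    refine LinearMap.ext fun u => ?_
    obtain ⟨x, rfl⟩ := e.surjective u
    have h2 := D.deckLin_one_lat x
    have hl (x) : D.lat x = ((e x).1, ((e x).2 : ℂ)) := rfl
    rw [deckLin_apply, hl, hl] at h2
    have h3 := congrArg Prod.fst h2
    have h4 := congrArg (fun v : ℂ × ℂ => v.2.re) h2
    simp only [zpow_one] at h3 h4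
    simp only [LinearMap.comp_apply, LinearEquiv.coe_coe, LinearEquiv.symm_apply_apply]
    refine Prod.ext h3 ?_
    change D.α * (e x).2 = _
    simpa using h4
  have h2 : LinearMap.det f = 1 := by rw [h1, LinearMap.det_conj, det_latShift]
  rw [LinearMap.det_prodMap] at h2
  have h3 : LinearMap.det (LinearMap.mul ℝ ℂ D.β) = Complex.normSq D.β :=
    Algebra.norm_complex_apply D.β
  rw [h3] at h2
  have h4 : LinearMap.det (LinearMap.mul ℝ ℝ D.α) = D.α := by simp
  rw [h4] at h2
  linarith

/-- The action of `T` on constant forms. -/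
def constShift : ((ℂ × ℂ) [⋀^Fin k]→L[ℝ] ℝ) →ₗ[ℝ] ((ℂ × ℂ) [⋀^Fin k]→L[ℝ] ℝ) where
  toFun c := D.α • c.compContinuousLinearMap (D.deckLin 1)
  map_add' c c' := by
    ext v
    exact mul_add _ _ _
  map_smul' r c := by
    ext v
    exact mul_left_comm _ _ _

lemma constShift_apply (c : (ℂ × ℂ) [⋀^Fin k]→L[ℝ] ℝ) (v : Fin k → ℂ × ℂ) :
    D.constShift c v = D.α * c fun i => D.deckLin 1 (v i) := rfl

lemma shift_const (c : (ℂ × ℂ) [⋀^Fin k]→L[ℝ] ℝ) :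
    D.shift 1 (fun _ => c) = fun _ => D.constShift c := by
  funext x
  rw [shift_apply, zpow_one]
  rfl

lemma constShift_mem {c : (ℂ × ℂ) [⋀^Fin k]→L[ℝ] ℝ} (hc : c ∈ horForms k) :
    D.constShift c ∈ horForms k := by
  change (D.constShift c).compContinuousLinearMap horProj = _
  ext v
  have h (v : ℂ × ℂ) : D.deckLin 1 (horProj v) = horProj (D.deckLin 1 v) := by
    rw [horProj_apply, map_sub, map_smul, deckLin_vertical, horProj_apply, deckLin_im]
  rw [ContinuousAlternatingMap.compContinuousLinearMap_apply, constShift_apply, constShift_apply,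
    horForms_apply hc fun i => D.deckLin 1 (v i)]
  simp only [Function.comp_apply, h]

lemma deckLin_one_fst (z : ℂ) : D.deckLin 1 (z, 0) = (D.β * z, 0) := by
  simp [deckLin_apply]

lemma deckLin_one_snd : D.deckLin 1 ((0 : ℂ), (1 : ℂ)) = D.α • ((0 : ℂ), (1 : ℂ)) := by
  simp [deckLin_apply]

/-- Multiplication by `β` scales areas by `|β|²`, and the factor `α` in `T` compensates exactly. -/
lemma areaCoeff_constShift (c : (ℂ × ℂ) [⋀^Fin 2]→L[ℝ] ℝ) :
    areaCoeff (D.constShift c) = areaCoeff c := by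
  have h1 : (fun i => D.deckLin 1 ((![(1, 0), (Complex.I, 0)] : Fin 2 → ℂ × ℂ) i)) =
      ![(D.β, 0), (D.β * Complex.I, 0)] := by
    funext i
    fin_cases i <;> simp [deckLin_one_fst]
  rw [areaCoeff_apply, constShift_apply, h1, apply_fst_fst, ← mul_assoc]
  have h2 := D.α_mul_normSq_β
  rw [Complex.normSq_apply] at h2
  simp only [Complex.mul_im, Complex.mul_re, Complex.I_im, Complex.I_re, mul_zero, mul_one,
    zero_sub, add_zero]
  rw [show D.α * (D.β.re * D.β.re - -D.β.im * D.β.im) = 1 by linarith, one_mul]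

lemma constShift_areaForm : D.constShift areaForm = areaForm := by
  ext v
  rw [constShift_apply, areaForm_apply, areaForm_apply]
  have h2 := D.α_mul_normSq_β
  rw [Complex.normSq_apply] at h2
  simp only [deckLin_apply, zpow_one, Complex.mul_im, Complex.mul_re]
  linear_combination ((v 0).1.re * (v 1).1.im - (v 1).1.re * (v 0).1.im) * h2

/-- A linear form fixed by `T` up to a positive factor vanishes on the `z`-plane. -/
lemma apply_fst_eq_zero {c : (ℂ × ℂ) [⋀^Fin 1]→L[ℝ] ℝ} {r : ℝ} (hr : r ≠ 0)
    (h : ∀ z : ℂ, c ![(z, 0)] = r * c ![(D.β * z, 0)]) (z : ℂ) : c ![(z, 0)] = 0 := by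
  have hne : 1 - r * D.β ≠ 0 := fun h0 => D.β_im_ne_zero (by
    have h1 := congrArg Complex.im h0
    simp [hr] at h1
    exact h1)
  let ψ : ℂ × ℂ →L[ℝ] ℝ := (ContinuousAlternatingMap.ofSubsingleton ℝ (ℂ × ℂ) ℝ (0 : Fin 1)).symm c
  have hψ (u : ℂ × ℂ) : c ![u] = ψ u := by
    have : c = ContinuousAlternatingMap.ofSubsingleton ℝ (ℂ × ℂ) ℝ (0 : Fin 1) ψ := by simp [ψ]
    rw [this]
    simp
  -- The hypothesis says that `c` kills `(1 - r β) z'` for every `z'`. As `β` is not real, `1 - r β`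
  -- is invertible, so `z` is of this form.
  have h1 := h (z / (1 - r * D.β))
  rw [hψ, hψ, ← smul_eq_mul (r : ℝ) (ψ _), ← map_smul, ← sub_eq_zero, ← map_sub] at h1
  rw [hψ, ← h1]
  congr 1
  refine Prod.ext ?_ (by simp)
  simp
  field_simp

/-- The horizontal space is parametrized by `ℝ³`, so four or more of its vectors are linearly
dependent. -/
lemma horForms_eq_zero_of_four_le (D : InoueData) {c : (ℂ × ℂ) [⋀^Fin k]→L[ℝ] ℝ} (hk : 4 ≤ k)
    (hc : c ∈ horForms k) : c = 0 := by
  refine horForms_ext hc fun v hv => ?_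
  choose x hx using fun i => D.exists_lat_eq (hv i)
  have h := (c.toAlternatingMap.compLinearMap D.lat).map_linearDependent x fun hli => by
    have := hli.fintype_card_le_finrank
    simp at this
    omega
  simpa [Function.comp_def, hx] using h

/-- `T` has no fixed constant horizontal form, except in degree two. -/
lemma eq_zero_of_constShift_eq {c : (ℂ × ℂ) [⋀^Fin k]→L[ℝ] ℝ} (hk : k ≠ 2) (hc : c ∈ horForms k)
    (h : D.constShift c = c) : c = 0 := by
  have hα := D.one_lt_α
  have happ (v) : c v = D.α * c fun i => D.deckLin 1 (v i) := by
    conv_lhs => rw [← h]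
    rfl
  rcases Nat.lt_or_ge k 4 with hk4 | hk4
  swap
  · exact D.horForms_eq_zero_of_four_le hk4 hc
  -- In degree `0` the eigenvalue is `α`; in degree `1` the plane and the line are treated
  -- separately, with `αβ`, `αβ̄` and `α²`; in degree `3` it is `α · det A = α`. None of these is
  -- `1`.
  interval_cases k
  · ext v
    have h1 := happ v
    rw [Subsingleton.elim (fun i => D.deckLin 1 (v i)) v] at h1
    have : (D.α - 1) * c v = 0 := by linarith
    rcases mul_eq_zero.1 this with h | h
    · linarith
    · simpa using h
  · have hv (v : Fin 1 → ℂ × ℂ) : v = ![v 0] := by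
      funext i
      fin_cases i
      rfl
    have h1 := D.apply_fst_eq_zero (c := c) D.α_pos.ne' fun z => by
      rw [happ]
      congr 2
      funext i
      fin_cases i
      exact D.deckLin_one_fst z
    have h2 : c ![((0 : ℂ), (1 : ℂ))] = 0 := by
      have h3 := happ ![((0 : ℂ), (1 : ℂ))]
      rw [hv fun i => D.deckLin 1 (![((0 : ℂ), (1 : ℂ))] i), Matrix.cons_val_zero,
        deckLin_one_snd, ContinuousAlternatingMap.vecCons_smul, smul_eq_mul] at h3
      have h4 : (D.α * D.α - 1) * c ![((0 : ℂ), (1 : ℂ))] = 0 := by linarith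
      exact (mul_eq_zero.1 h4).resolve_left (by nlinarith)
    refine horForms_ext hc fun v him => ?_
    rw [hv v, eq_fst_add_snd (him 0), ContinuousAlternatingMap.vecCons_add,
      ContinuousAlternatingMap.vecCons_smul, h1, h2, smul_zero, add_zero]
  · exact absurd rfl hk
  · refine horForms_ext hc fun v hv => ?_
    choose x hx using fun i => D.exists_lat_eq (hv i)
    let f := c.toAlternatingMap.compLinearMap D.lat
    have hf (y : Fin 3 → Fin 3 → ℝ) : f y = c fun i => D.lat (y i) := rfl
    have h1 : f (D.latShift ∘ x) = f x := by
      rw [f.eq_smul_basis_det (Pi.basisFun ℝ (Fin 3)), AlternatingMap.smul_apply,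
        AlternatingMap.smul_apply, Module.Basis.det_comp, det_latShift, one_mul]
    have h2 : f x = D.α * f (D.latShift ∘ x) := by
      rw [hf, hf, happ]
      simp only [deckLin_one_lat, Function.comp_apply]
    rw [h1, hf] at h2
    simp only [hx] at h2
    have h3 : (D.α - 1) * c v = 0 := by linarith
    exact (mul_eq_zero.1 h3).resolve_left (by linarith)

/-- The constant horizontal two-forms fixed by `T` are the multiples of the area form. -/
lemma eq_zero_of_constShift_eq_of_areaCoeff {c : (ℂ × ℂ) [⋀^Fin 2]→L[ℝ] ℝ} (hc : c ∈ horForms 2)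
    (h : D.constShift c = c) (h0 : areaCoeff c = 0) : c = 0 := by
  have hα := D.α_pos
  have happ (u v) : c ![u, v] = D.α * c ![D.deckLin 1 u, D.deckLin 1 v] := by
    conv_lhs => rw [← h, constShift_apply]
    congr 2
    funext i
    fin_cases i <;> rfl
  let ε : ℂ × ℂ := ((0 : ℂ), (1 : ℂ))
  have hε : c ![ε, ε] = 0 := c.map_eq_zero_of_eq _ (i := 0) (j := 1) rfl (by simp)
  -- On mixed pairs one factor `α` comes from `T` and another from the stretching of `ε`, so the
  -- eigenvalues are `α²β` and `α²β̄`, which are not real. Only the restriction to the `z`-plane is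
  -- left, and `h0` kills it.
  have hεz (z : ℂ) : c ![ε, (z, 0)] = 0 := by
    refine D.apply_fst_eq_zero (c := c.curryLeft ε) (r := D.α * D.α) (by positivity)
      (fun z => ?_) z
    rw [ContinuousAlternatingMap.curryLeft_apply_apply,
      ContinuousAlternatingMap.curryLeft_apply_apply, happ, deckLin_one_fst, deckLin_one_snd,
      ContinuousAlternatingMap.vecCons_smul, smul_eq_mul, mul_assoc]
  have swap (u v : ℂ × ℂ) : c ![u, v] = - c ![v, u] := by
    have := c.toAlternatingMap.map_swap ![v, u] (i := 0) (j := 1) (by simp)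
    rw [← ContinuousAlternatingMap.coe_toAlternatingMap, ← this]
    congr 1
    funext i
    fin_cases i <;> rfl
  have hεv (v : ℂ × ℂ) (hv : v.2.im = 0) : c ![ε, v] = 0 := by
    rw [swap, eq_fst_add_snd hv, ContinuousAlternatingMap.vecCons_add,
      ContinuousAlternatingMap.vecCons_smul, hε, swap, hεz]
    simp
  refine horForms_ext hc fun v hv => ?_
  have e : v = ![v 0, v 1] := by
    funext i
    fin_cases i <;> rfl
  rw [e, eq_fst_add_snd (hv 0), ContinuousAlternatingMap.vecCons_add,
    ContinuousAlternatingMap.vecCons_smul, hεv _ (hv 1), swap, eq_fst_add_snd (hv 1),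
    ContinuousAlternatingMap.vecCons_add, ContinuousAlternatingMap.vecCons_smul, hεz,
    apply_fst_fst, h0]
  simp

lemma exists_sub_constShift_of_injective {K : Submodule ℝ ((ℂ × ℂ) [⋀^Fin k]→L[ℝ] ℝ)}
    (hK : ∀ c ∈ K, D.constShift c ∈ K) (hinj : ∀ c ∈ K, D.constShift c = c → c = 0)
    {m : (ℂ × ℂ) [⋀^Fin k]→L[ℝ] ℝ} (hm : m ∈ K) : ∃ c ∈ K, c - D.constShift c = m :=
  exists_sub_eq_of_no_fixed_vector (D.constShift (k := k)) hK hinj hm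

lemma exists_sub_constShift {m : (ℂ × ℂ) [⋀^Fin k]→L[ℝ] ℝ} (hk : k ≠ 2) (hm : m ∈ horForms k) :
    ∃ c ∈ horForms k, c - D.constShift c = m :=
  D.exists_sub_constShift_of_injective (fun _ => D.constShift_mem)
    (fun _ => D.eq_zero_of_constShift_eq hk) hm

lemma sub_areaCoeff_mem {m : (ℂ × ℂ) [⋀^Fin 2]→L[ℝ] ℝ} (hm : m ∈ horForms 2) :
    m - areaCoeff m • areaForm ∈ horForms 2 ⊓ LinearMap.ker areaCoeff := by
  refine ⟨sub_mem hm (Submodule.smul_mem _ _ areaForm_mem_horForms), ?_⟩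
  simp [areaCoeff_areaForm]

/-- `areaCoeff` is invariant under `T`, so its kernel is preserved. On the horizontal part of that
kernel `T` has no fixed vector and `1 - T` is onto: the area coefficient is the only obstruction. -/
lemma exists_sub_constShift_two {m : (ℂ × ℂ) [⋀^Fin 2]→L[ℝ] ℝ} (hm : m ∈ horForms 2) :
    ∃ c ∈ horForms 2, c - D.constShift c = m - areaCoeff m • areaForm := by
  obtain ⟨c, hc, h⟩ := D.exists_sub_constShift_of_injective
    (K := horForms 2 ⊓ LinearMap.ker areaCoeff)
    (fun c hc => ⟨D.constShift_mem hc.1, (D.areaCoeff_constShift c).trans hc.2⟩)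
    (fun c hc h => D.eq_zero_of_constShift_eq_of_areaCoeff hc.1 h hc.2) (sub_areaCoeff_mem hm)
  exact ⟨c, hc.1, h⟩

lemma eq_smul_areaForm_of_constShift_eq {c : (ℂ × ℂ) [⋀^Fin 2]→L[ℝ] ℝ} (hc : c ∈ horForms 2)
    (h : D.constShift c = c) : c = areaCoeff c • areaForm := by
  have h1 := sub_areaCoeff_mem hc
  refine sub_eq_zero.1 (D.eq_zero_of_constShift_eq_of_areaCoeff h1.1 ?_ h1.2)
  rw [map_sub, map_smul, h, constShift_areaForm]

end InoueData

end Inoue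


/-! ### The Wang argument: cohomology of the invariant forms. -/

namespace Inoue

open MorseNovikov

namespace InoueData

variable (D : InoueData) {k : ℕ}

/-- Periodic forms fixed by `T`. -/
def invForms (k : ℕ) : Submodule ℝ (CoverForm k) :=
  D.perForms k ⊓ LinearMap.eqLocus (D.shift 1) LinearMap.id

variable {D}

lemma mem_invForms {τ : CoverForm k} :
    τ ∈ D.invForms k ↔ τ ∈ D.perForms k ∧ D.shift 1 τ = τ := Iff.rfl

lemma mem_horForms_zero (c : (ℂ × ℂ) [⋀^Fin 0]→L[ℝ] ℝ) : c ∈ horForms 0 := by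
  change c.compContinuousLinearMap horProj = c
  ext v
  rw [ContinuousAlternatingMap.compContinuousLinearMap_apply]
  congr 1
  exact Subsingleton.elim _ _

lemma eq_const_of_closed_zero {τ : CoverForm 0} (h : ContDiff ℝ ∞ τ) (hd : extDeriv τ = 0) :
    τ = fun _ => τ 0 := by
  have h0 (x : ℂ × ℂ) : fderiv ℝ τ x = 0 := by
    refine ContinuousLinearMap.ext fun v => ?_
    ext w
    have h1 := congrArg (fun c => c ![v]) (congrFun hd x)
    simp only [extDeriv, ContinuousAlternatingMap.alternatizeUncurryFin_apply] at h1
    rw [Subsingleton.elim w ![]]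
    simpa using h1
  exact funext fun x => is_const_of_fderiv_eq_zero (h.differentiable (by simp)) h0 x 0

/-- A closed function is constant, and `T` multiplies constants by `α ≠ 1`. -/
lemma eq_zero_of_closed_zero {τ : CoverForm 0} (h : τ ∈ D.invForms 0) (hd : extDeriv τ = 0) :
    τ = 0 := by
  have e := eq_const_of_closed_zero h.1.1 hd
  have h1 := (mem_invForms.1 h).2
  rw [e, shift_const] at h1
  have h2 : τ 0 = 0 := D.eq_zero_of_constShift_eq (by norm_num) (mem_horForms_zero _)
    (congrFun h1 0)
  rw [e, h2]
  rfl

/-- The constant horizontal representative of an invariant closed form is fixed by `T`. -/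
lemma constShift_eq_of_invariant {τ : CoverForm (k + 1)} (h : D.shift 1 τ = τ)
    {c : (ℂ × ℂ) [⋀^Fin (k + 1)]→L[ℝ] ℝ} (hc : c ∈ horForms (k + 1)) {ρ : CoverForm k}
    (hρ : ρ ∈ D.perForms k) (e : τ = (fun _ => c) + extDeriv ρ) : D.constShift c = c := by
  have h1 : D.shift 1 τ = (fun _ => D.constShift c) + extDeriv (D.shift 1 ρ) := by
    rw [e, map_add, shift_const, extDeriv_shift 1 hρ.1]
  have hs := perForms_shift 1 hρ
  -- Applying `T` to the decomposition of `τ` yields a second one. The difference of the two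
  -- constants is exact, hence zero.
  refine sub_eq_zero.1 (eq_zero_of_const_exact (sub_mem (D.constShift_mem hc) hc)
    (sub_mem hρ hs) ?_)
  rw [extDeriv_sub_of_contDiff hρ.1 hs.1]
  rw [h, e] at h1
  have h2 : (fun _ : ℂ × ℂ => D.constShift c - c) =
    (fun _ => D.constShift c) - fun _ => c := rfl
  rw [h2, sub_eq_sub_iff_add_eq_add, add_comm (extDeriv ρ), h1]

/-- A periodic primitive of an invariant form can be corrected by a closed form so that the
defect of invariance becomes a constant in the given class. -/
lemma exists_primitive_of_sub_shift {ρ : CoverForm (k + 1)} (hρ : ρ ∈ D.perForms (k + 1))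
    (h : D.shift 1 (extDeriv ρ) = extDeriv ρ) :
    ∃ m ∈ horForms (k + 1), ∃ ρ' ∈ D.perForms (k + 1), extDeriv ρ' = extDeriv ρ ∧
      ρ' - D.shift 1 ρ' = fun _ => m := by
  have hs := perForms_shift 1 hρ
  have hd : extDeriv (ρ - D.shift 1 ρ) = 0 := by
    rw [extDeriv_sub_of_contDiff hρ.1 hs.1, extDeriv_shift 1 hρ.1, h, sub_self]
  obtain ⟨m, hm, μ, hμ, e⟩ := exists_eq_const_add (sub_mem hρ hs) hd
  -- The defect `ρ - T ρ` is closed, so it equals `m + dμ`. With `ν - T ν = μ`, subtracting `dν`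
  -- from `ρ` removes the exact part and leaves `m`.
  obtain ⟨ν, hν, e'⟩ := exists_sub_shift_eq hμ
  have hdν := perForms_extDeriv hν
  refine ⟨m, hm, ρ - extDeriv ν, sub_mem hρ hdν, ?_, ?_⟩
  · rw [extDeriv_sub_of_contDiff hρ.1 hdν.1, extDeriv_extDeriv_of_contDiff hν.1, sub_zero]
  · rw [map_sub, sub_sub_sub_comm, e, ← extDeriv_shift 1 hν.1,
      ← extDeriv_sub_of_contDiff hν.1 (perForms_shift 1 hν).1, e', add_sub_cancel_right]

lemma invForms_of_sub_shift {ρ : CoverForm k} (hρ : ρ ∈ D.perForms k)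
    (h : ρ - D.shift 1 ρ = 0) : ρ ∈ D.invForms k :=
  ⟨hρ, (sub_eq_zero.1 h).symm⟩

/-- If an invariant form has a periodic primitive, then it has an invariant primitive, up to a
multiple of the class in degree three. -/
lemma exists_invariant_primitive {ρ : CoverForm k} (hk : k ≠ 2) (hρ : ρ ∈ D.perForms k)
    (h : D.shift 1 (extDeriv ρ) = extDeriv ρ) :
    ∃ ρ' ∈ D.invForms k, extDeriv ρ' = extDeriv ρ := by
  obtain ⟨m, hm, ρ₁, hρ₁, e₁, e₂⟩ : ∃ m ∈ horForms k, ∃ ρ' ∈ D.perForms k,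
      extDeriv ρ' = extDeriv ρ ∧ ρ' - D.shift 1 ρ' = fun _ => m := by
    cases k with
    | zero =>
      have hs := perForms_shift 1 hρ
      have hd : extDeriv (ρ - D.shift 1 ρ) = 0 := by
        rw [extDeriv_sub_of_contDiff hρ.1 hs.1, extDeriv_shift 1 hρ.1, h, sub_self]
      exact ⟨_, mem_horForms_zero _, ρ, hρ, rfl, eq_const_of_closed_zero (hρ.1.sub hs.1) hd⟩
    | succ k => exact exists_primitive_of_sub_shift hρ h
  -- Away from degree two the constant defect is itself of the form `c - T c`, so subtracting `c`
  -- restores invariance without changing the differential.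
  obtain ⟨c, hc, e⟩ := D.exists_sub_constShift hk hm
  have hcp : (fun _ => c) ∈ D.perForms k := perForms_const c
  refine ⟨ρ₁ - fun _ => c, invForms_of_sub_shift (sub_mem hρ₁ hcp) ?_, ?_⟩
  · rw [map_sub, sub_sub_sub_comm, e₂, shift_const, ← e]
    exact sub_self _
  · rw [extDeriv_sub_of_contDiff hρ₁.1 hcp.1, extDeriv_const_form, sub_zero, e₁]

/-- The primitive `y ω` of the generator in degree three. -/
def heightArea : CoverForm 2 := fun x => x.2.im • areaForm

lemma contDiff_heightArea : ContDiff ℝ ∞ heightArea := heightCLM.contDiff.smul contDiff_const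

lemma heightArea_mem : heightArea ∈ D.perForms 2 :=
  ⟨contDiff_heightArea, fun m x => by
    simp only [heightArea, Prod.snd_add, Complex.add_im, lat_im, add_zero]⟩

/-- `T` fixes `ω` and raises `y` by one, so `T(y ω) = (y + 1) ω`. Thus `y ω` is not invariant,
although its differential is, and its defect spans the obstruction in degree two. -/
lemma heightArea_sub_shift : heightArea - D.shift 1 heightArea = fun _ => -areaForm := by
  funext x
  have h := D.constShift_areaForm
  rw [Pi.sub_apply, shift_apply, heightArea, heightArea, deckShift_im, zpow_one]
  have h2 : D.α • ((x.2.im + (1 : ℤ)) • areaForm).compContinuousLinearMap (D.deckLin 1) =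
      (x.2.im + 1) • D.constShift areaForm := by
    rw [← map_smul]
    push_cast
    rfl
  rw [h2, h, add_smul, one_smul]
  abel

/-- The part of the defect that a constant cannot remove is `areaCoeff m • ω`. Adding `areaCoeff m •
y ω` to the primitive cancels it, at the price of that multiple of `d(y ω)`. -/
lemma exists_invariant_primitive_two {ρ : CoverForm 2} (hρ : ρ ∈ D.perForms 2)
    (h : D.shift 1 (extDeriv ρ) = extDeriv ρ) :
    ∃ r : ℝ, ∃ ρ' ∈ D.invForms 2, extDeriv ρ = r • extDeriv heightArea + extDeriv ρ' := by
  obtain ⟨m, hm, ρ₁, hρ₁, e₁, e₂⟩ := exists_primitive_of_sub_shift hρ h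
  obtain ⟨c, hc, e⟩ := D.exists_sub_constShift_two hm
  have hcp : (fun _ => c) ∈ D.perForms 2 := perForms_const c
  have hH : areaCoeff m • heightArea ∈ D.perForms 2 := Submodule.smul_mem _ _ heightArea_mem
  have hp := (D.perForms 2).sub_mem hρ₁ hcp
  refine ⟨-areaCoeff m, ρ₁ - (fun _ => c) + areaCoeff m • heightArea,
    invForms_of_sub_shift (add_mem hp hH) ?_, ?_⟩
  · have e3 : (fun _ : ℂ × ℂ => c) - D.shift 1 (fun _ => c) =
        fun _ => m - areaCoeff m • areaForm := by
      rw [shift_const, ← e]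
      rfl
    rw [map_add, map_sub, map_smul, add_sub_add_comm, sub_sub_sub_comm, e₂, e3]
    funext x
    ext v
    have h5 := congrArg (fun c => c v) (congrFun (heightArea_sub_shift (D := D)) x)
    simp only [Pi.sub_apply, ContinuousAlternatingMap.sub_apply,
      ContinuousAlternatingMap.neg_apply] at h5
    simp only [Pi.sub_apply, Pi.add_apply, Pi.smul_apply, Pi.zero_apply,
      ContinuousAlternatingMap.sub_apply, ContinuousAlternatingMap.add_apply,
      ContinuousAlternatingMap.smul_apply, ContinuousAlternatingMap.coe_zero, smul_eq_mul]
    linear_combination areaCoeff m * h5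
  · have h1 : extDeriv (areaCoeff m • heightArea) = areaCoeff m • extDeriv heightArea :=
      funext fun x => extDeriv_smul _ _
    rw [extDeriv_add_of_contDiff hp.1 hH.1, extDeriv_sub_of_contDiff hρ₁.1 hcp.1,
      extDeriv_const_form, sub_zero, e₁, h1, neg_smul]
    abel

/-- Invariant closed forms are exact in degrees other than two and three. -/
theorem exists_primitive {τ : CoverForm (k + 1)} (h2 : k + 1 ≠ 2) (h3 : k + 1 ≠ 3)
    (h : τ ∈ D.invForms (k + 1)) (hd : extDeriv τ = 0) : ∃ ρ ∈ D.invForms k, extDeriv ρ = τ := by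
  obtain ⟨c, hc, ρ, hρ, e⟩ := exists_eq_const_add h.1 hd
  have hT := (mem_invForms.1 h).2
  have hc0 := D.eq_zero_of_constShift_eq h2 hc (constShift_eq_of_invariant hT hc hρ e)
  have e' : τ = extDeriv ρ := by
    rw [e, hc0]
    exact zero_add _
  obtain ⟨ρ', h', e''⟩ := exists_invariant_primitive (by omega) hρ (by rw [← e', hT])
  exact ⟨ρ', h', e''.trans e'.symm⟩

/-- The constant representative is fixed by `T`, hence a multiple of `ω`. The primitive of the rest
has degree one, where no obstruction to invariance exists. -/
theorem exists_primitive_two {τ : CoverForm 2} (h : τ ∈ D.invForms 2) (hd : extDeriv τ = 0) :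
    ∃ r : ℝ, ∃ ρ ∈ D.invForms 1, τ = r • (fun _ => areaForm) + extDeriv ρ := by
  obtain ⟨c, hc, ρ, hρ, e⟩ := exists_eq_const_add h.1 hd
  have hT := (mem_invForms.1 h).2
  have hcT := constShift_eq_of_invariant hT hc hρ e
  have hdρ : extDeriv ρ = τ - fun _ => c := by rw [e, add_sub_cancel_left]
  obtain ⟨ρ', h', e''⟩ := exists_invariant_primitive (by norm_num) hρ
    (by rw [hdρ, map_sub, hT, shift_const, hcT])
  refine ⟨areaCoeff c, ρ', h', ?_⟩
  rw [e'', e]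
  conv_lhs => rw [D.eq_smul_areaForm_of_constShift_eq hc hcT]
  rfl

/-- `T` has no fixed constant in degree three, so a periodic primitive exists. It has degree two,
where making it invariant may cost a multiple of `d(y ω)`. -/
theorem exists_primitive_three {τ : CoverForm 3} (h : τ ∈ D.invForms 3) (hd : extDeriv τ = 0) :
    ∃ r : ℝ, ∃ ρ ∈ D.invForms 2, τ = r • extDeriv heightArea + extDeriv ρ := by
  obtain ⟨c, hc, ρ, hρ, e⟩ := exists_eq_const_add h.1 hd
  have hT := (mem_invForms.1 h).2
  have hc0 := D.eq_zero_of_constShift_eq (by norm_num) hc (constShift_eq_of_invariant hT hc hρ e)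
  have e' : τ = extDeriv ρ := by
    rw [e, hc0]
    exact zero_add _
  rw [e']
  exact exists_invariant_primitive_two hρ (by rw [← e', hT])

lemma areaForm_mem_invForms : (fun _ => areaForm) ∈ D.invForms 2 :=
  mem_invForms.2 ⟨perForms_const _, by rw [shift_const, constShift_areaForm]⟩

lemma extDeriv_heightArea_mem_invForms : extDeriv heightArea ∈ D.invForms 3 := by
  refine invForms_of_sub_shift (perForms_extDeriv heightArea_mem) ?_
  rw [← extDeriv_shift 1 contDiff_heightArea, ← extDeriv_sub_of_contDiff contDiff_heightArea
    (perForms_shift 1 heightArea_mem).1, heightArea_sub_shift, extDeriv_const_form]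

theorem areaForm_not_exact {ρ : CoverForm 1} (hρ : ρ ∈ D.perForms 1) :
    extDeriv ρ ≠ fun _ => areaForm := fun h => by
  have h1 := areaCoeff_areaForm
  rw [eq_zero_of_const_exact areaForm_mem_horForms hρ h.symm, map_zero] at h1
  exact zero_ne_one h1

/-- If `dρ = d(y ω)`, then `ρ - y ω = c + dμ`. Applying `1 - T` gives `ω = c - T c` up to an exact
form, hence exactly, and the invariant `areaCoeff` then reads `1 = 0`. -/
theorem extDeriv_heightArea_not_exact {ρ : CoverForm 2} (hρ : ρ ∈ D.invForms 2) :
    extDeriv ρ ≠ extDeriv heightArea := fun h => by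
  have hH := heightArea_mem (D := D)
  have hd : extDeriv (ρ - heightArea) = 0 := by
    rw [extDeriv_sub_of_contDiff hρ.1.1 hH.1, h, sub_self]
  obtain ⟨c, hc, μ, hμ, e⟩ := exists_eq_const_add (sub_mem hρ.1 hH) hd
  have hs := perForms_shift 1 hμ
  have h1 : (ρ - heightArea) - D.shift 1 (ρ - heightArea) = fun _ => areaForm := by
    rw [map_sub, sub_sub_sub_comm, (mem_invForms.1 hρ).2, sub_self, heightArea_sub_shift]
    funext x
    simp
  rw [e, map_add, add_sub_add_comm, shift_const, ← extDeriv_shift 1 hμ.1,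
    ← extDeriv_sub_of_contDiff hμ.1 hs.1] at h1
  have h2 : areaForm - (c - D.constShift c) = 0 := by
    refine eq_zero_of_const_exact (sub_mem areaForm_mem_horForms
      (sub_mem hc (D.constShift_mem hc))) (sub_mem hμ hs) ?_
    have h3 : (fun _ : ℂ × ℂ => areaForm - (c - D.constShift c)) =
      (fun _ => areaForm) - ((fun _ => c) - fun _ => D.constShift c) := rfl
    rw [h3, ← h1, add_sub_cancel_left]
  have h3 := congrArg areaCoeff h2
  rw [map_sub, map_sub, areaCoeff_constShift, areaCoeff_areaForm, map_zero] at h3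
  norm_num at h3

end InoueData

end Inoue


/-! ### Pulling back forms from a manifold to a vector space. -/

namespace MorseNovikov

section Pullback

variable {E : Type*} [NormedAddCommGroup E] [NormedSpace ℝ E]
  {E' : Type*} [NormedAddCommGroup E'] [NormedSpace ℝ E']
  {M : Type*} [TopologicalSpace M] [ChartedSpace E M] [IsManifold 𝓘(ℝ, E) ∞ M]

/-- The pullback of a form by a map defined on a vector space, as a function. -/
def flatPullback {k : ℕ} (f : E' → M) (σ : DForm E M k) : E' → E' [⋀^Fin k]→L[ℝ] ℝ :=
  pullback (E := E') (M := E') f σ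

lemma mdifferentiableAt_chart {e : OpenPartialHomeomorph M E} (he : e ∈ atlas E M) {x : M}
    (hx : x ∈ e.source) : MDifferentiableAt 𝓘(ℝ, E) 𝓘(ℝ, E) e x :=
  (contMDiffAt_of_mem_maximalAtlas (n := ∞) (IsManifold.subset_maximalAtlas he)
    hx).mdifferentiableAt (by simp)

lemma mdifferentiableAt_chart_symm {e : OpenPartialHomeomorph M E} (he : e ∈ atlas E M) {y : E}
    (hy : y ∈ e.target) : MDifferentiableAt 𝓘(ℝ, E) 𝓘(ℝ, E) e.symm y :=
  (contMDiffAt_symm_of_mem_maximalAtlas (n := ∞) (IsManifold.subset_maximalAtlas he)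
    hy).mdifferentiableAt (by simp)

/-- A form is recovered from its expression in a chart. -/
lemma eq_chartRep_comp {k : ℕ} (σ : DForm E M k) {e : OpenPartialHomeomorph M E}
    (he : e ∈ atlas E M) {x : M} (hx : x ∈ e.source) :
    σ x = ContinuousAlternatingMap.compContinuousLinearMap (chartRep e σ (e x))
      (mfderiv 𝓘(ℝ, E) 𝓘(ℝ, E) e x) := by
  have h1 := mfderiv_comp x (mdifferentiableAt_chart_symm he (e.map_source hx))
    (mdifferentiableAt_chart he hx)
  have h2 : mfderiv 𝓘(ℝ, E) 𝓘(ℝ, E) (e.symm ∘ e) x = ContinuousLinearMap.id ℝ _ := by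
    rw [← mfderiv_id]
    refine Filter.EventuallyEq.mfderiv_eq ?_
    filter_upwards [e.open_source.mem_nhds hx] with y hy using e.left_inv hy
  ext v
  -- The values of `σ` at equal points have different dependent types, so both are read in the model
  -- space `E`.
  have h3 (x' : M) (h : x' = x) : (σ x' : E [⋀^Fin k]→L[ℝ] ℝ) = σ x := by rw [h]
  change σ x v = σ (e.symm (e x)) fun i => mfderiv 𝓘(ℝ, E) 𝓘(ℝ, E) e.symm (e x)
    (mfderiv 𝓘(ℝ, E) 𝓘(ℝ, E) e x (v i))
  have h4 (w : TangentSpace 𝓘(ℝ, E) x) : mfderiv 𝓘(ℝ, E) 𝓘(ℝ, E) e.symm (e x)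
      (mfderiv 𝓘(ℝ, E) 𝓘(ℝ, E) e x w) = w := by
    have := congrArg (fun L => L w) (h1.symm.trans h2)
    exact this
  simp only [h4]
  exact (congrArg (fun c : E [⋀^Fin k]→L[ℝ] ℝ => c v) (h3 _ (e.left_inv hx))).symm

/-- The pullback by a smooth map, computed in a chart of the target. -/
lemma pullback_eventuallyEq {k : ℕ} (σ : DForm E M k) {f : E' → M}
    (hf : ContMDiff 𝓘(ℝ, E') 𝓘(ℝ, E) ∞ f) {e : OpenPartialHomeomorph M E} (he : e ∈ atlas E M)
    {u : E'} (hu : f u ∈ e.source) :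
    ∀ᶠ v in 𝓝 u, flatPullback f σ v =
      (chartRep e σ (e (f v))).compContinuousLinearMap (fderiv ℝ (e ∘ f) v) := by
  filter_upwards [hf.continuous.continuousAt.preimage_mem_nhds (e.open_source.mem_nhds hu)]
    with v hv
  have h1 := mfderiv_comp v (mdifferentiableAt_chart he hv)
    (hf.contMDiffAt.mdifferentiableAt (by simp))
  rw [mfderiv_eq_fderiv] at h1
  have h2 := eq_chartRep_comp σ he hv
  rw [h1]
  ext w
  change σ (f v) (fun i => mfderiv 𝓘(ℝ, E') 𝓘(ℝ, E) f v (w i)) = _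
  rw [h2]
  rfl

lemma contDiffAt_chart_comp {f : E' → M} (hf : ContMDiff 𝓘(ℝ, E') 𝓘(ℝ, E) ∞ f)
    {e : OpenPartialHomeomorph M E} (he : e ∈ atlas E M) {u : E'} (hu : f u ∈ e.source) :
    ContDiffAt ℝ ∞ (e ∘ f) u := by
  have h1 : ContMDiffAt 𝓘(ℝ, E) 𝓘(ℝ, E) ∞ e (f u) :=
    (contMDiffOn_of_mem_maximalAtlas (IsManifold.subset_maximalAtlas he)).contMDiffAt
      (e.open_source.mem_nhds hu)
  exact (h1.comp u hf.contMDiffAt).contDiffAt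

lemma contDiff_pullback [FiniteDimensional ℝ E] [FiniteDimensional ℝ E'] {k : ℕ} {σ : DForm E M k}
    (hσ : σ ∈ smoothForms E M k) {f : E' → M} (hf : ContMDiff 𝓘(ℝ, E') 𝓘(ℝ, E) ∞ f) :
    ContDiff ℝ ∞ (flatPullback f σ) := by
  refine contDiff_iff_contDiffAt.2 fun u => ?_
  have he := chart_mem_atlas E (f u)
  have hu := mem_chart_source E (f u)
  have hc := contDiffAt_chart_comp hf he hu
  refine (contDiffAt_compContinuousLinearMap ?_ ?_).congr_of_eventuallyEq
    (pullback_eventuallyEq σ hf he hu)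
  · exact ContDiffAt.comp u ((hσ _ he).contDiffAt ((chartAt E (f u)).open_target.mem_nhds
      ((chartAt E (f u)).map_source hu))) hc
  · exact hc.fderiv_right (m := ∞) (by simp)

/-- The exterior derivative commutes with pullback to a vector space. -/
lemma extDeriv_pullback_eq {k : ℕ} {σ : DForm E M k}
    (hσ : σ ∈ smoothForms E M k) {f : E' → M} (hf : ContMDiff 𝓘(ℝ, E') 𝓘(ℝ, E) ∞ f) :
    extDeriv (flatPullback f σ) =
      flatPullback f (extD σ) := by
  funext u
  have he := chart_mem_atlas E (f u)
  have hu := mem_chart_source E (f u)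
  have hc := contDiffAt_chart_comp hf he hu
  rw [Filter.EventuallyEq.extDeriv_eq (pullback_eventuallyEq σ hf he hu)]
  -- The preferred chart at `f u` is the one in which `extD` is computed there, so naturality of `d`
  -- between vector spaces suffices.
  have h1 := extDeriv_pullback (f := chartAt E (f u) ∘ f) (x := u)
    (differentiableAt_chartRep hσ (f u)) hc Inoue.two_le_infty
  refine h1.trans ?_
  have h2 := mfderiv_comp u (mdifferentiableAt_chart he hu)
    (hf.contMDiffAt.mdifferentiableAt (by simp))
  rw [mfderiv_eq_fderiv] at h2
  rw [h2]
  rfl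

end Pullback

end MorseNovikov


/-! ### The universal covering of the surface by `ℂ × ℂ`. -/

namespace Inoue

open MorseNovikov

namespace InoueData

variable (D : InoueData) {k : ℕ}

/-- The coordinates `(z, x + i y) ↦ (z, x + i α ^ y)` on `ℂ × ℍ`. -/
def expCoord (v : ℂ × ℂ) : ℂ × ℂ :=
  (v.1, (v.2.re : ℂ) + (Real.exp (v.2.im * Real.log D.α) : ℝ) * Complex.I)

/-- The inverse coordinates `(z, w) ↦ (z, Re w + i log_α (Im w))`. -/
def logCoord (v : ℂ × ℂ) : ℂ × ℂ :=
  (v.1, (v.2.re : ℂ) + (Real.log v.2.im / Real.log D.α : ℝ) * Complex.I)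

lemma log_α_pos : 0 < Real.log D.α := Real.log_pos D.one_lt_α

lemma expCoord_im (v : ℂ × ℂ) : (D.expCoord v).2.im = Real.exp (v.2.im * Real.log D.α) := by
  simp [expCoord, -Complex.ofReal_exp]

lemma expCoord_re (v : ℂ × ℂ) : (D.expCoord v).2.re = v.2.re := by
  simp [expCoord, -Complex.ofReal_exp]

lemma logCoord_im (v : ℂ × ℂ) : (D.logCoord v).2.im = Real.log v.2.im / Real.log D.α := by
  simp [logCoord]

lemma logCoord_re (v : ℂ × ℂ) : (D.logCoord v).2.re = v.2.re := by
  simp [logCoord]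

lemma logCoord_expCoord (v : ℂ × ℂ) : D.logCoord (D.expCoord v) = v := by
  refine Prod.ext rfl (Complex.ext ?_ ?_)
  · rw [logCoord_re, expCoord_re]
  · rw [logCoord_im, expCoord_im, Real.log_exp, mul_div_cancel_right₀ _ D.log_α_pos.ne']

lemma expCoord_logCoord {v : ℂ × ℂ} (hv : 0 < v.2.im) : D.expCoord (D.logCoord v) = v := by
  refine Prod.ext rfl (Complex.ext ?_ ?_)
  · rw [expCoord_re, logCoord_re]
  · rw [expCoord_im, logCoord_im, div_mul_cancel₀ _ D.log_α_pos.ne', Real.exp_log hv]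

lemma contDiff_expCoord : ContDiff ℝ ∞ D.expCoord := by
  have h1 : ContDiff ℝ ∞ fun v : ℂ × ℂ => v.2.re :=
    (Complex.reCLM.comp (ContinuousLinearMap.snd ℝ ℂ ℂ)).contDiff
  have h2 : ContDiff ℝ ∞ fun v : ℂ × ℂ => v.2.im := heightCLM.contDiff
  have h3 : ContDiff ℝ ∞ fun v : ℂ × ℂ => Real.exp (v.2.im * Real.log D.α) :=
    (h2.mul contDiff_const).exp
  exact contDiff_fst.prodMk ((Complex.ofRealCLM.contDiff.comp h1).add
    ((Complex.ofRealCLM.contDiff.comp h3).mul contDiff_const))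

lemma contDiffAt_logCoord {v : ℂ × ℂ} (hv : 0 < v.2.im) : ContDiffAt ℝ ∞ D.logCoord v := by
  have h1 : ContDiff ℝ ∞ fun v : ℂ × ℂ => v.2.re :=
    (Complex.reCLM.comp (ContinuousLinearMap.snd ℝ ℂ ℂ)).contDiff
  have h2 : ContDiff ℝ ∞ fun v : ℂ × ℂ => v.2.im := heightCLM.contDiff
  have h3 : ContDiffAt ℝ ∞ (fun v : ℂ × ℂ => Real.log v.2.im / Real.log D.α) v :=
    (h2.contDiffAt.log hv.ne').div_const _
  exact contDiff_fst.contDiffAt.prodMk ((Complex.ofRealCLM.contDiff.comp h1).contDiffAt.add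
    ((Complex.ofRealCLM.contDiff.contDiffAt.comp v h3).mul contDiffAt_const))

/-- The diffeomorphism from the universal cover `ℂ × ℂ` onto `ℂ × ℍ`. -/
def toCH (v : ℂ × ℂ) : CH :=
  ⟨D.expCoord v, by
    change 0 < (D.expCoord v).2.im
    rw [expCoord_im]
    exact Real.exp_pos _⟩

lemma continuous_toCH : Continuous D.toCH :=
  D.contDiff_expCoord.continuous.subtype_mk _

lemma toCH_injective : Function.Injective D.toCH := fun v v' h => by
  rw [← D.logCoord_expCoord v, ← D.logCoord_expCoord v']
  exact congrArg (fun q : CH => D.logCoord q.1) h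

lemma toCH_logCoord (q : CH) : D.toCH (D.logCoord q.1) = q :=
  Subtype.ext (D.expCoord_logCoord q.2)

/-- The universal covering map. -/
def cover (v : ℂ × ℂ) : D.S0 := D.proj (D.toCH v)

lemma continuous_cover : Continuous D.cover :=
  D.isLocalHomeomorph_proj.continuous.comp D.continuous_toCH

/-- The deck transformation with parameters `(n, m)`. -/
def deck (n : ℤ) (m : Fin 3 → ℤ) (v : ℂ × ℂ) : ℂ × ℂ :=
  D.deckShift n v + D.lat fun i => (m i : ℝ)

lemma contDiff_deck (n : ℤ) (m : Fin 3 → ℤ) : ContDiff ℝ ∞ (D.deck n m) :=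
  (D.contDiff_deckShift n).add contDiff_const

/-- In exponential coordinates, scaling `Im w` by `α ^ n` is the translation of `y` by `n`. The
group thus acts by affine maps, under which constant forms pull back to constant forms. -/
lemma toCH_deck {g : Equiv.Perm CH} {n : ℤ} {m : Fin 3 → ℤ} (h : D.Describes g n m)
    (v : ℂ × ℂ) : D.toCH (D.deck n m v) = g (D.toCH v) := by
  refine Subtype.ext ?_
  rw [h]
  change D.expCoord _ = (D.β ^ n * v.1 + _, ((D.α ^ n : ℝ) : ℂ) * (D.expCoord v).2 + _)
  have h1 : D.α ^ n = Real.exp (n * Real.log D.α) := by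
    rw [mul_comm, ← Real.rpow_def_of_pos D.α_pos, Real.rpow_intCast]
  refine Prod.ext ?_ (Complex.ext ?_ ?_)
  · simp [expCoord, deck, deckShift, deckLin_apply, lat_apply, vertical]
  · rw [expCoord_re, Complex.add_re, Complex.re_ofReal_mul, expCoord_re, Complex.ofReal_re, deck,
      Prod.snd_add, Complex.add_re, lat_apply, Complex.ofReal_re, deckShift, Prod.snd_add,
      Complex.add_re, deckLin_re]
    simp [vertical]
  · rw [expCoord_im, Complex.add_im, Complex.im_ofReal_mul, expCoord_im, Complex.ofReal_im, deck,
      Prod.snd_add, Complex.add_im, lat_im, deckShift_im, add_zero, add_zero, h1, ← Real.exp_add]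
    ring_nf

lemma smul_proj (g : D.G) (q : CH) : D.proj (g • q) = D.proj q :=
  Quotient.sound ⟨g, rfl⟩

/-- Two points with the same image differ by a deck transformation. -/
lemma exists_deck_of_cover_eq {u u' : ℂ × ℂ} (h : D.cover u' = D.cover u) :
    ∃ n m, D.deck n m u = u' ∧ ∀ v, D.cover (D.deck n m v) = D.cover v := by
  obtain ⟨g, hg⟩ : ∃ g : D.G, g • D.toCH u = D.toCH u' := Quotient.exact h
  obtain ⟨n, m, hd⟩ := D.exists_describes g.2
  refine ⟨n, m, D.toCH_injective ?_, fun v => ?_⟩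
  · rw [D.toCH_deck hd]
    exact hg
  · rw [cover, D.toCH_deck hd]
    exact D.smul_proj g _

variable {D}

lemma chart_target_pos {e : OpenPartialHomeomorph D.S0 (ℂ × ℂ)} (he : e ∈ atlas (ℂ × ℂ) D.S0)
    {y : ℂ × ℂ} (hy : y ∈ e.target) : 0 < y.2.im := by
  obtain ⟨q, rfl⟩ := D.exists_of_mem_atlas he
  simp only [mfld_simps] at hy
  have h1 : (((chartAt (ℂ × ℂ) q).symm y : CH) : ℂ × ℂ) = y := (chartAt (ℂ × ℂ) q).right_inv hy.1
  rw [← h1]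
  exact ((chartAt (ℂ × ℂ) q).symm y).2

/-- Inverse charts of `S⁰` factor through the covering map. -/
lemma chart_symm_eq {e : OpenPartialHomeomorph D.S0 (ℂ × ℂ)} (he : e ∈ atlas (ℂ × ℂ) D.S0)
    {y : ℂ × ℂ} (hy : y ∈ e.target) : e.symm y = D.cover (D.logCoord y) := by
  have hpos := chart_target_pos he hy
  obtain ⟨q, rfl⟩ := D.exists_of_mem_atlas he
  simp only [mfld_simps] at hy
  have h1 : (((chartAt (ℂ × ℂ) q).symm y : CH) : ℂ × ℂ) = y := (chartAt (ℂ × ℂ) q).right_inv hy.1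
  have hic : (D.isLocalHomeomorph_proj.localInverseAt q).symm = D.proj :=
    D.isLocalHomeomorph_proj.localInverseAt_symm q
  have h2 : D.toCH (D.logCoord y) = (chartAt (ℂ × ℂ) q).symm y := by
    rw [← D.toCH_logCoord ((chartAt (ℂ × ℂ) q).symm y), h1]
  rw [cover, h2]
  simp only [mfld_simps]
  rw [hic]

/-- In a chart, the covering map is a deck transformation. -/
lemma eventually_logCoord_chart_cover {e : OpenPartialHomeomorph D.S0 (ℂ × ℂ)}
    (he : e ∈ atlas (ℂ × ℂ) D.S0) {u : ℂ × ℂ} (hu : D.cover u ∈ e.source) :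
    ∃ n m, (∀ v, D.cover (D.deck n m v) = D.cover v) ∧
      ∀ᶠ v in 𝓝 u, D.logCoord (e (D.cover v)) = D.deck n m v := by
  have hcov (v : ℂ × ℂ) (hv : D.cover v ∈ e.source) :
      D.cover (D.logCoord (e (D.cover v))) = D.cover v := by
    rw [← chart_symm_eq he (e.map_source hv), e.left_inv hv]
  obtain ⟨n, m, h1, h2⟩ := D.exists_deck_of_cover_eq (hcov u hu)
  refine ⟨n, m, h2, ?_⟩
  -- Two continuous lifts of the covering map, one through the chart and one by the deck
  -- transformation, agree at `u`. Local injectivity of the projection makes them agree nearby.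
  obtain ⟨U, hU, hmem, hinj⟩ :=
    D.isLocalHomeomorph_proj.isLocallyInjective (D.toCH (D.deck n m u))
  have hsrc : ∀ᶠ v in 𝓝 u, D.cover v ∈ e.source :=
    D.continuous_cover.continuousAt.preimage_mem_nhds (e.open_source.mem_nhds hu)
  have c1 : ContinuousAt (fun v => D.toCH (D.deck n m v)) u :=
    (D.continuous_toCH.comp (D.contDiff_deck n m).continuous).continuousAt
  have c2 : ContinuousAt (fun v => D.toCH (D.logCoord (e (D.cover v)))) u := by
    have c3 : ContinuousAt (fun v => e (D.cover v)) u :=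
      ContinuousAt.comp (e.continuousAt hu) D.continuous_cover.continuousAt
    have c4 : ContinuousAt D.logCoord (e (D.cover u)) :=
      (D.contDiffAt_logCoord (chart_target_pos he (e.map_source hu))).continuousAt
    exact D.continuous_toCH.continuousAt.comp
      (ContinuousAt.comp (f := fun v => e (D.cover v)) c4 c3)
  have m1 := c1.preimage_mem_nhds (hU.mem_nhds hmem)
  have m2 := c2.preimage_mem_nhds (hU.mem_nhds (by rw [← h1]; exact hmem))
  filter_upwards [hsrc, m1, m2] with v hv hv1 hv2
  exact D.toCH_injective (hinj hv2 hv1 ((hcov v hv).trans (h2 v).symm))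

/-- Near each point the covering map is an inverse chart composed with `expCoord` after a deck
transformation. -/
lemma contMDiff_cover : ContMDiff 𝓘(ℝ, ℂ × ℂ) 𝓘(ℝ, ℂ × ℂ) ∞ D.cover := by
  intro u
  have he := chart_mem_atlas (ℂ × ℂ) (D.cover u)
  have hu := mem_chart_source (ℂ × ℂ) (D.cover u)
  set e := chartAt (ℂ × ℂ) (D.cover u)
  obtain ⟨n, m, -, h⟩ := eventually_logCoord_chart_cover he hu
  have hsrc : ∀ᶠ v in 𝓝 u, D.cover v ∈ e.source :=
    D.continuous_cover.continuousAt.preimage_mem_nhds (e.open_source.mem_nhds hu)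
  have heq : ∀ᶠ v in 𝓝 u, D.expCoord (D.deck n m v) = e (D.cover v) := by
    filter_upwards [hsrc, h] with v hv hv'
    rw [← hv', D.expCoord_logCoord (chart_target_pos he (e.map_source hv))]
  have h1 : ContMDiffAt 𝓘(ℝ, ℂ × ℂ) 𝓘(ℝ, ℂ × ℂ) ∞ e.symm (D.expCoord (D.deck n m u)) :=
    contMDiffAt_symm_of_mem_maximalAtlas (IsManifold.subset_maximalAtlas he)
      (by rw [heq.self_of_nhds]; exact e.map_source hu)
  have h2 : ContMDiffAt 𝓘(ℝ, ℂ × ℂ) 𝓘(ℝ, ℂ × ℂ) ∞ (fun v => D.expCoord (D.deck n m v)) u :=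
    (D.contDiff_expCoord.comp (D.contDiff_deck n m)).contDiffAt.contMDiffAt
  refine (ContMDiffAt.comp (f := fun v => D.expCoord (D.deck n m v)) u h1 h2
    ).congr_of_eventuallyEq ?_
  filter_upwards [hsrc, heq] with v hv hv'
  rw [Function.comp_apply, hv', e.left_inv hv]

lemma mdifferentiableAt_cover (u : ℂ × ℂ) :
    MDifferentiableAt 𝓘(ℝ, ℂ × ℂ) 𝓘(ℝ, ℂ × ℂ) D.cover u :=
  contMDiff_cover.contMDiffAt.mdifferentiableAt (by simp)

/-- The expression of a form in a chart, in terms of its lift to the universal cover. -/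
lemma chartRep_eq (σ : DForm (ℂ × ℂ) D.S0 k) {e : OpenPartialHomeomorph D.S0 (ℂ × ℂ)}
    (he : e ∈ atlas (ℂ × ℂ) D.S0) {y : ℂ × ℂ} (hy : y ∈ e.target) :
    chartRep e σ y = (flatPullback D.cover σ (D.logCoord y)).compContinuousLinearMap
      (fderiv ℝ D.logCoord y) := by
  have hd := (D.contDiffAt_logCoord (chart_target_pos he hy)).differentiableAt (by simp)
  have h1 : mfderiv 𝓘(ℝ, ℂ × ℂ) 𝓘(ℝ, ℂ × ℂ) e.symm y =
      mfderiv 𝓘(ℝ, ℂ × ℂ) 𝓘(ℝ, ℂ × ℂ) (D.cover ∘ D.logCoord) y := by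
    refine Filter.EventuallyEq.mfderiv_eq ?_
    filter_upwards [e.open_target.mem_nhds hy] with v hv using chart_symm_eq he hv
  have h2 := mfderiv_comp y (mdifferentiableAt_cover (D := D) (D.logCoord y)) hd.mdifferentiableAt
  rw [mfderiv_eq_fderiv] at h2
  have h3 := h1.trans h2
  ext v
  have h4 (w : ℂ × ℂ) : mfderiv 𝓘(ℝ, ℂ × ℂ) 𝓘(ℝ, ℂ × ℂ) e.symm y w =
    mfderiv 𝓘(ℝ, ℂ × ℂ) 𝓘(ℝ, ℂ × ℂ) D.cover (D.logCoord y) (fderiv ℝ D.logCoord y w) :=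
    congrArg (fun L => L w) h3
  change σ (e.symm y) (fun i => mfderiv 𝓘(ℝ, ℂ × ℂ) 𝓘(ℝ, ℂ × ℂ) e.symm y (v i)) = _
  simp only [h4]
  have h5 (x' : D.S0) (h : e.symm y = x') :
    (σ (e.symm y) : (ℂ × ℂ) [⋀^Fin k]→L[ℝ] ℝ) = σ x' := by rw [h]
  exact congrArg (fun c : (ℂ × ℂ) [⋀^Fin k]→L[ℝ] ℝ => c _) (h5 _ (chart_symm_eq he hy))

/-- By `chartRep_eq` the lift determines the expression of a form in every chart, hence the form. -/
lemma flatPullback_cover_injective :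
    Function.Injective (flatPullback D.cover : DForm (ℂ × ℂ) D.S0 k → CoverForm k) := by
  intro σ σ' h
  funext x
  have he := chart_mem_atlas (ℂ × ℂ) x
  have hx := mem_chart_source (ℂ × ℂ) x
  have hy := (chartAt (ℂ × ℂ) x).map_source hx
  rw [eq_chartRep_comp σ he hx, eq_chartRep_comp σ' he hx, chartRep_eq σ he hy,
    chartRep_eq σ' he hy, h]

lemma mem_smoothForms_of_contDiff {σ : DForm (ℂ × ℂ) D.S0 k}
    (h : ContDiff ℝ ∞ (flatPullback D.cover σ)) : σ ∈ smoothForms (ℂ × ℂ) D.S0 k := by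
  intro e he y hy
  have hl := D.contDiffAt_logCoord (chart_target_pos he hy)
  refine ContDiffAt.contDiffWithinAt (ContDiffAt.congr_of_eventuallyEq
    (contDiffAt_compContinuousLinearMap (h.contDiffAt.comp y hl)
      (hl.fderiv_right (m := ∞) (by simp))) ?_)
  filter_upwards [e.open_target.mem_nhds hy] with v hv using chartRep_eq σ he hv

/-- A form on the universal cover that is invariant under all deck transformations descends. -/
lemma exists_flatPullback_eq {τ : CoverForm k}
    (h : ∀ n m x, (τ (D.deck n m x)).compContinuousLinearMap (D.deckLin n) = τ x) :
    ∃ σ : DForm (ℂ × ℂ) D.S0 k, flatPullback D.cover σ = τ := by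
  -- `s x` is a local section of the covering around `x`, and `σ` is the pullback of `τ` by it. Near
  -- `u` the section after the covering map is a deck transformation, so invariance of `τ` gives
  -- back `τ`.
  let s : D.S0 → D.S0 → ℂ × ℂ := fun x => D.logCoord ∘ chartAt (ℂ × ℂ) x
  let σ : DForm (ℂ × ℂ) D.S0 k := fun x =>
    ContinuousAlternatingMap.compContinuousLinearMap (τ (s x x))
      (mfderiv 𝓘(ℝ, ℂ × ℂ) 𝓘(ℝ, ℂ × ℂ) (s x) x)
  refine ⟨σ, funext fun u => ?_⟩
  have he := chart_mem_atlas (ℂ × ℂ) (D.cover u)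
  have hu := mem_chart_source (ℂ × ℂ) (D.cover u)
  obtain ⟨n, m, -, hev⟩ := eventually_logCoord_chart_cover he hu
  have hl := D.contDiffAt_logCoord
    (chart_target_pos he ((chartAt (ℂ × ℂ) (D.cover u)).map_source hu))
  have hs : MDifferentiableAt 𝓘(ℝ, ℂ × ℂ) 𝓘(ℝ, ℂ × ℂ) (s (D.cover u)) (D.cover u) :=
    MDifferentiableAt.comp _ (hl.differentiableAt (by simp)).mdifferentiableAt
      (mdifferentiableAt_chart he hu)
  have h1 := mfderiv_comp u hs (mdifferentiableAt_cover u)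
  have h2 : mfderiv 𝓘(ℝ, ℂ × ℂ) 𝓘(ℝ, ℂ × ℂ) (s (D.cover u) ∘ D.cover) u = D.deckLin n := by
    have hd : HasFDerivAt (D.deck n m) (D.deckLin n) u :=
      ((D.deckLin n).hasFDerivAt.add_const _).add_const _
    rw [mfderiv_eq_fderiv]
    exact (hd.congr_of_eventuallyEq hev).fderiv
  have h3 : s (D.cover u) (D.cover u) = D.deck n m u := hev.self_of_nhds
  rw [← h n m u]
  ext v
  have h4 (w : ℂ × ℂ) : mfderiv 𝓘(ℝ, ℂ × ℂ) 𝓘(ℝ, ℂ × ℂ) (s (D.cover u)) (D.cover u)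
    (mfderiv 𝓘(ℝ, ℂ × ℂ) 𝓘(ℝ, ℂ × ℂ) D.cover u w) = D.deckLin n w :=
    congrArg (fun L => L w) (h1.symm.trans h2)
  change τ (s (D.cover u) (D.cover u)) (fun i => mfderiv 𝓘(ℝ, ℂ × ℂ) 𝓘(ℝ, ℂ × ℂ) (s (D.cover u))
    (D.cover u) (mfderiv 𝓘(ℝ, ℂ × ℂ) 𝓘(ℝ, ℂ × ℂ) D.cover u (v i))) = _
  simp only [h4, h3]
  rfl

/-- The vectors `m` realized by elements of the group with `n = 0` form a subgroup of `ℤ³` that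
contains the standard basis. Hence lifts are periodic under the whole lattice. -/
lemma exists_describes_translation (m : Fin 3 → ℤ) : ∃ g ∈ D.G, D.Describes g 0 m := by
  let H : AddSubgroup (Fin 3 → ℤ) :=
    { carrier := {m | ∃ g ∈ D.G, D.Describes g 0 m}
      zero_mem' := ⟨1, one_mem _, Describes.one D⟩
      add_mem' := by
        rintro m m' ⟨g, hg, h⟩ ⟨g', hg', h'⟩
        refine ⟨g' * g, mul_mem hg' hg, ?_⟩
        simpa using h'.mul h
      neg_mem' := by
        rintro m ⟨g, hg, h⟩
        refine ⟨g⁻¹, inv_mem hg, ?_⟩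
        simpa using h.inv }
  have h1 (i : Fin 3) : Pi.single i (1 : ℤ) ∈ H :=
    ⟨D.translation i, Subgroup.subset_closure (Or.inr ⟨i, rfl⟩), fun q => by
      simp [translation, Pi.single_apply, apply_ite (Int.cast : ℤ → ℂ),
        apply_ite (Int.cast : ℤ → ℝ)]⟩
  have h2 : m = ∑ i, m i • (Pi.single i (1 : ℤ) : Fin 3 → ℤ) := by
    funext j
    simp [Pi.single_apply]
  have h3 : m ∈ H := by
    rw [h2]
    exact sum_mem fun i _ => H.zsmul_mem (h1 i) _
  exact h3

lemma cover_deck_zero (m : Fin 3 → ℤ) (v : ℂ × ℂ) : D.cover (D.deck 0 m v) = D.cover v := by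
  obtain ⟨g, hg, h⟩ := exists_describes_translation (D := D) m
  rw [cover, D.toCH_deck h]
  exact D.smul_proj ⟨g, hg⟩ _

lemma cover_deck_one (v : ℂ × ℂ) : D.cover (D.deck 1 0 v) = D.cover v := by
  have h : D.Describes D.dilation 1 0 := fun q => by simp [dilation]
  rw [cover, D.toCH_deck h]
  exact D.smul_proj ⟨D.dilation, Subgroup.subset_closure (Or.inl rfl)⟩ _

/-- Lifts of forms on `S⁰` are invariant under deck transformations. -/
lemma flatPullback_deck (σ : DForm (ℂ × ℂ) D.S0 k) {n : ℤ} {m : Fin 3 → ℤ}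
    (h : ∀ v, D.cover (D.deck n m v) = D.cover v) (x : ℂ × ℂ) :
    (flatPullback D.cover σ (D.deck n m x)).compContinuousLinearMap (D.deckLin n) =
      flatPullback D.cover σ x := by
  have hd : HasFDerivAt (D.deck n m) (D.deckLin n) x :=
    ((D.deckLin n).hasFDerivAt.add_const _).add_const _
  have h1 := mfderiv_comp x (mdifferentiableAt_cover (D := D) (D.deck n m x))
    hd.differentiableAt.mdifferentiableAt
  rw [mfderiv_eq_fderiv, hd.fderiv, show D.cover ∘ D.deck n m = D.cover from funext h] at h1
  ext v
  have h4 (w : ℂ × ℂ) : mfderiv 𝓘(ℝ, ℂ × ℂ) 𝓘(ℝ, ℂ × ℂ) D.cover x w =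
    mfderiv 𝓘(ℝ, ℂ × ℂ) 𝓘(ℝ, ℂ × ℂ) D.cover (D.deck n m x) (D.deckLin n w) :=
    congrArg (fun L => L w) h1
  change _ = σ (D.cover x) fun i => mfderiv 𝓘(ℝ, ℂ × ℂ) 𝓘(ℝ, ℂ × ℂ) D.cover x (v i)
  simp only [h4]
  have h5 (x' : D.S0) (h : x' = D.cover x) :
    (σ x' : (ℂ × ℂ) [⋀^Fin k]→L[ℝ] ℝ) = σ (D.cover x) := by rw [h]
  exact congrArg (fun c : (ℂ × ℂ) [⋀^Fin k]→L[ℝ] ℝ => c _) (h5 _ (h x))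

end InoueData

end Inoue


/-! ### Untwisting: from `d_θ` on the surface to `d` on the cover. -/

namespace MorseNovikov

lemma wedgeAt_compContinuousLinearMap {E E' : Type*} [NormedAddCommGroup E] [NormedSpace ℝ E]
    [NormedAddCommGroup E'] [NormedSpace ℝ E'] {k : ℕ} (η : E [⋀^Fin 1]→L[ℝ] ℝ)
    (σ : E [⋀^Fin k]→L[ℝ] ℝ) (L : E' →L[ℝ] E) :
    (wedgeAt η σ).compContinuousLinearMap L =
      wedgeAt (η.compContinuousLinearMap L) (σ.compContinuousLinearMap L) := by
  ext v
  simp only [wedgeAt, ContinuousAlternatingMap.compContinuousLinearMap_apply,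
    ContinuousAlternatingMap.alternatizeUncurryFin_apply]
  rfl

lemma wedgeAt_smul_left {E : Type*} [NormedAddCommGroup E] [NormedSpace ℝ E] {k : ℕ} (c : ℝ)
    (η : E [⋀^Fin 1]→L[ℝ] ℝ) (σ : E [⋀^Fin k]→L[ℝ] ℝ) :
    wedgeAt (c • η) σ = c • wedgeAt η σ := by
  rw [wedgeAt, wedgeAt, ← ContinuousAlternatingMap.alternatizeUncurryFin_smul]
  congr 1
  ext v w
  exact mul_assoc _ _ _

/-- The algebra behind `d(α ^ (-y) σ) = α ^ (-y) (dσ - θ ∧ σ)`, with `c = α ^ (-y)` and `l = log α`.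
-/
lemma smul_add_wedgeAt_smul {E : Type*} [NormedAddCommGroup E] [NormedSpace ℝ E] {k : ℕ} (c l : ℝ)
    (η : E [⋀^Fin 1]→L[ℝ] ℝ) (σ : E [⋀^Fin k]→L[ℝ] ℝ) (τ : E [⋀^Fin (k + 1)]→L[ℝ] ℝ) :
    c • τ + wedgeAt (c • (-l) • η) σ = c • (τ - wedgeAt (l • η) σ) := by
  rw [wedgeAt_smul_left, wedgeAt_smul_left, wedgeAt_smul_left]
  ext v
  change c * τ v + c * (-l * wedgeAt η σ v) = c * (τ v - l * wedgeAt η σ v)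
  ring

lemma _root_.Submodule.nonempty_quotient_equiv {V : Type*} [AddCommGroup V] [Module ℝ V]
    {Z B : Submodule ℝ V} {c : V} (hc : c ∈ Z) (hc' : c ∉ B)
    (h : ∀ z ∈ Z, ∃ r : ℝ, z - r • c ∈ B) : Nonempty ((Z ⧸ B.submoduleOf Z) ≃ₗ[ℝ] ℝ) := by
  have hfin : Module.finrank ℝ (Z ⧸ B.submoduleOf Z) = 1 := by
    refine finrank_eq_one (Submodule.Quotient.mk ⟨c, hc⟩) (fun h => ?_) fun w => ?_
    · rw [Submodule.Quotient.mk_eq_zero] at h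
      exact hc' h
    · obtain ⟨z, rfl⟩ := Submodule.Quotient.mk_surjective _ w
      obtain ⟨r, hr⟩ := h z.1 z.2
      refine ⟨r, ?_⟩
      rw [← Submodule.Quotient.mk_smul, eq_comm, Submodule.Quotient.eq]
      exact hr
  have : Module.Finite ℝ (Z ⧸ B.submoduleOf Z) := Module.finite_of_finrank_eq_succ hfin
  exact ⟨LinearEquiv.ofFinrankEq _ _ (by rw [hfin, Module.finrank_self])⟩

end MorseNovikov

namespace Inoue

open MorseNovikov

/-- The linear form `dy`, as an alternating form. -/
def dy : (ℂ × ℂ) [⋀^Fin 1]→L[ℝ] ℝ :=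
  ContinuousAlternatingMap.ofSubsingleton ℝ (ℂ × ℂ) ℝ (0 : Fin 1) heightCLM

namespace InoueData

variable {D : InoueData} {k : ℕ}

variable (D) in
/-- The factor `α ^ y`. -/
def growth (v : ℂ × ℂ) : ℝ := Real.exp (v.2.im * Real.log D.α)

lemma growth_pos (v : ℂ × ℂ) : 0 < D.growth v := Real.exp_pos _

lemma contDiff_growth : ContDiff ℝ ∞ D.growth :=
  (heightCLM.contDiff.mul contDiff_const).exp

lemma contDiff_growth_inv : ContDiff ℝ ∞ fun v => (D.growth v)⁻¹ :=
  contDiff_growth.inv fun v => (growth_pos v).ne'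

lemma hasFDerivAt_growth_inv (v : ℂ × ℂ) :
    HasFDerivAt (fun v => (D.growth v)⁻¹) ((D.growth v)⁻¹ • (-Real.log D.α) • heightCLM) v := by
  have h1 : (fun v => (D.growth v)⁻¹) = fun v => Real.exp (heightCLM v * (-Real.log D.α)) := by
    funext v
    rw [growth, ← Real.exp_neg, mul_neg]
    rfl
  have h2 := (heightCLM.hasFDerivAt (x := v) |>.mul_const (-Real.log D.α)).exp
  rw [h1, show (D.growth v)⁻¹ = Real.exp (heightCLM v * (-Real.log D.α)) from congrFun h1 v]
  exact h2

lemma growth_deck (n : ℤ) (m : Fin 3 → ℤ) (v : ℂ × ℂ) :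
    D.growth (D.deck n m v) = D.α ^ n * D.growth v := by
  have h1 : D.α ^ n = Real.exp (n * Real.log D.α) := by
    rw [mul_comm, ← Real.rpow_def_of_pos D.α_pos, Real.rpow_intCast]
  rw [growth, growth, deck, Prod.snd_add, Complex.add_im, lat_im, deckShift_im, add_zero, h1,
    ← Real.exp_add]
  ring_nf

variable (D) in
/-- The lift of a form to the universal cover, divided by `α ^ y`. -/
def untwist (σ : DForm (ℂ × ℂ) D.S0 k) : CoverForm k :=
  fun v => (D.growth v)⁻¹ • flatPullback D.cover σ v

lemma untwist_sub_smul (σ σ' : DForm (ℂ × ℂ) D.S0 k) (r : ℝ) :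
    D.untwist (σ - r • σ') = D.untwist σ - r • D.untwist σ' := by
  funext v
  ext w
  exact (mul_sub _ _ _).trans (congrArg _ (mul_left_comm _ _ _))

lemma untwist_zero : D.untwist (0 : DForm (ℂ × ℂ) D.S0 k) = 0 := by
  funext v
  ext w
  exact mul_zero _

lemma untwist_injective :
    Function.Injective (D.untwist : DForm (ℂ × ℂ) D.S0 k → CoverForm k) := fun σ σ' h => by
  refine flatPullback_cover_injective (funext fun v => ?_)
  exact smul_right_injective _ (inv_ne_zero (growth_pos v).ne') (congrFun h v)

/-- The lift is invariant under deck transformations, while `growth` is unchanged by lattice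
translations and multiplied by `α` by the dilation. The latter is the origin of the factor `α` in
`T`. -/
lemma untwist_mem {σ : DForm (ℂ × ℂ) D.S0 k} (hσ : σ ∈ smoothForms (ℂ × ℂ) D.S0 k) :
    D.untwist σ ∈ D.invForms k := by
  refine mem_invForms.2 ⟨⟨contDiff_growth_inv.smul (contDiff_pullback hσ contMDiff_cover),
    fun m x => ?_⟩, ?_⟩
  · have h1 := flatPullback_deck σ (cover_deck_zero (D := D) m) x
    have h2 := growth_deck (D := D) 0 m x
    have h3 : D.deck 0 m x = x + D.lat fun i => (m i : ℝ) := by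
      rw [deck, deckShift, deckLin_zero]
      simp
    have h4 : D.deckLin 0 = ContinuousLinearMap.id ℝ (ℂ × ℂ) :=
      ContinuousLinearMap.ext D.deckLin_zero
    rw [h3, zpow_zero, one_mul] at h2
    rw [h3, h4] at h1
    rw [untwist, h2]
    congr 1
  · funext x
    have h1 := flatPullback_deck σ (cover_deck_one (D := D)) x
    have h2 := growth_deck (D := D) 1 0 x
    have h3 : D.deck 1 0 x = D.deckShift 1 x := by
      rw [deck]
      simp only [Pi.zero_apply, Int.cast_zero]
      exact (congrArg (D.deckShift 1 x + ·) (map_zero D.lat)).trans (add_zero _)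
    rw [h3, zpow_one] at h2
    rw [h3] at h1
    rw [shift_apply, untwist, untwist, ← h1, h2, zpow_one]
    ext w
    have := D.α_pos.ne'
    have := (growth_pos (D := D) x).ne'
    change D.α * ((D.α * D.growth x)⁻¹ * _) = (D.growth x)⁻¹ * _
    rw [← mul_assoc, mul_inv, mul_inv_cancel_left₀ D.α_pos.ne']
    rfl

lemma shift_eq_of_mem_invForms {τ : CoverForm k} (h : τ ∈ D.invForms k) (n : ℤ) :
    D.shift n τ = τ := by
  have h1 := (mem_invForms.1 h).2
  induction n using Int.induction_on with
  | zero => exact D.shift_zero τ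
  | succ n ih => rw [← shift_shift, h1, ih]
  | pred n ih =>
    rw [← h1, shift_shift, sub_add_cancel, h1, ih]

/-- Multiplying by `growth` absorbs the factor in `T` and gives a form invariant under all deck
transformations, which descends. -/
lemma exists_untwist_eq {τ : CoverForm k} (h : τ ∈ D.invForms k) :
    ∃ σ ∈ smoothForms (ℂ × ℂ) D.S0 k, D.untwist σ = τ := by
  have hinv (n : ℤ) (m : Fin 3 → ℤ) (x : ℂ × ℂ) :
      (D.growth (D.deck n m x) • τ (D.deck n m x)).compContinuousLinearMap (D.deckLin n) =
        D.growth x • τ x := by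
    have h1 := congrFun (shift_eq_of_mem_invForms h n) x
    rw [shift_apply] at h1
    rw [growth_deck, deck, h.1.2, ← h1]
    ext w
    change D.α ^ n * D.growth x * _ = D.growth x * (D.α ^ n * _)
    rw [mul_comm (D.α ^ n), mul_assoc]
    rfl
  obtain ⟨σ, hσ⟩ := exists_flatPullback_eq (D := D) (τ := fun x => D.growth x • τ x) hinv
  refine ⟨σ, mem_smoothForms_of_contDiff ?_, ?_⟩
  · rw [hσ]
    exact contDiff_growth.smul h.1.1
  · funext x
    rw [untwist, hσ, smul_smul, inv_mul_cancel₀ (growth_pos x).ne', one_smul]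

variable {θ : DForm (ℂ × ℂ) D.S0 1}

/-- After untwisting, the twisted differential becomes the exterior derivative. -/
lemma untwist_twistedD (hθ : flatPullback D.cover θ = fun _ => Real.log D.α • dy)
    (σ : smoothForms (ℂ × ℂ) D.S0 k) :
    D.untwist (twistedD θ k σ) = extDeriv (D.untwist σ.1) := by
  funext x
  have hs := contDiff_pullback σ.2 (contMDiff_cover (D := D))
  -- In the product rule the derivative of `α ^ (-y)` contributes `-log α • dy`, which is minus the
  -- lift of `θ`.
  have h1 : extDeriv (D.untwist σ.1) x = _ := extDeriv_smul_fun
    (hasFDerivAt_growth_inv (D := D) x).differentiableAt (hs.differentiable (by simp) x)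
  rw [h1, (hasFDerivAt_growth_inv x).fderiv, extDeriv_pullback_eq σ.2 contMDiff_cover]
  have h2 : flatPullback D.cover (wedgeOne θ σ.1) x =
      wedgeAt (Real.log D.α • dy) (flatPullback D.cover σ.1 x) := by
    refine (wedgeAt_compContinuousLinearMap (E := ℂ × ℂ) (E' := ℂ × ℂ) (θ (D.cover x))
      (σ.1 (D.cover x)) (mfderiv 𝓘(ℝ, ℂ × ℂ) 𝓘(ℝ, ℂ × ℂ) D.cover x)).trans ?_
    congr 1
    exact congrFun hθ x
  have h3 : D.untwist (twistedD θ k σ) x = (D.growth x)⁻¹ •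
      (flatPullback D.cover (extD σ.1) x - flatPullback D.cover (wedgeOne θ σ.1) x) := rfl
  rw [h3, h2]
  exact (smul_add_wedgeAt_smul _ _ dy _ _).symm

lemma untwist_closed (hθ : flatPullback D.cover θ = fun _ => Real.log D.α • dy)
    {σ : smoothForms (ℂ × ℂ) D.S0 k} (h : σ ∈ cocycles θ k) : extDeriv (D.untwist σ.1) = 0 := by
  have h1 : twistedD θ k σ = 0 := h
  rw [← untwist_twistedD hθ, h1, untwist_zero]

lemma mem_cocycles_of_untwist (hθ : flatPullback D.cover θ = fun _ => Real.log D.α • dy)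
    {σ : smoothForms (ℂ × ℂ) D.S0 k} (h : extDeriv (D.untwist σ.1) = 0) : σ ∈ cocycles θ k := by
  refine LinearMap.mem_ker.2 (untwist_injective ?_)
  rw [untwist_twistedD hθ, h, untwist_zero]

/-- Untwisting is a bijection from smooth forms onto `invForms` and carries `d_θ` to `d`, so
exactness may be tested there. -/
lemma mem_coboundaries_iff (hθ : flatPullback D.cover θ = fun _ => Real.log D.α • dy)
    {σ : smoothForms (ℂ × ℂ) D.S0 (k + 1)} :
    σ ∈ coboundaries θ (k + 1) ↔ ∃ ρ ∈ D.invForms k, extDeriv ρ = D.untwist σ.1 := by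
  constructor
  · rintro ⟨ρ, hρ⟩
    refine ⟨D.untwist ρ.1, untwist_mem ρ.2, ?_⟩
    rw [← untwist_twistedD hθ, hρ]
    rfl
  · rintro ⟨ρ, hρ, e⟩
    obtain ⟨ρ', h1, h2⟩ := exists_untwist_eq hρ
    refine ⟨⟨ρ', h1⟩, untwist_injective ?_⟩
    rw [untwist_twistedD hθ, h2, e]
    rfl

/-- A cohomology group generated by one non-exact cocycle is one-dimensional. -/
lemma nonempty_cohomology_equiv (hθ : flatPullback D.cover θ = fun _ => Real.log D.α • dy)
    {τ₀ : CoverForm (k + 1)} (h₀ : τ₀ ∈ D.invForms (k + 1)) (hd₀ : extDeriv τ₀ = 0)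
    (hne : ∀ ρ ∈ D.invForms k, extDeriv ρ ≠ τ₀)
    (hgen : ∀ τ ∈ D.invForms (k + 1), extDeriv τ = 0 →
      ∃ r : ℝ, ∃ ρ ∈ D.invForms k, τ = r • τ₀ + extDeriv ρ) :
    Nonempty (Cohomology θ (k + 1) ≃ₗ[ℝ] ℝ) := by
  obtain ⟨σ₀, s₀, e₀⟩ := exists_untwist_eq h₀
  refine Submodule.nonempty_quotient_equiv (c := ⟨σ₀, s₀⟩)
    (mem_cocycles_of_untwist hθ (by rw [e₀, hd₀])) (fun h => ?_) fun σ hσ => ?_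
  · obtain ⟨ρ, hρ, e⟩ := (mem_coboundaries_iff hθ).1 h
    exact hne ρ hρ (e.trans e₀)
  · obtain ⟨r, ρ, hρ, e⟩ := hgen _ (untwist_mem σ.2) (untwist_closed hθ hσ)
    refine ⟨r, (mem_coboundaries_iff hθ).2 ⟨ρ, hρ, ?_⟩⟩
    refine Eq.trans ?_ (untwist_sub_smul σ.1 σ₀ r).symm
    rw [e₀, e, add_sub_cancel_left]

lemma subsingleton_cohomology (hθ : flatPullback D.cover θ = fun _ => Real.log D.α • dy)
    (h2 : k + 1 ≠ 2) (h3 : k + 1 ≠ 3) : Subsingleton (Cohomology θ (k + 1)) := by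
  rw [Submodule.Quotient.subsingleton_iff, Submodule.eq_top_iff']
  intro σ
  exact (mem_coboundaries_iff hθ).2
    (exists_primitive h2 h3 (untwist_mem σ.1.2) (untwist_closed hθ σ.2))

lemma subsingleton_cohomology_zero (hθ : flatPullback D.cover θ = fun _ => Real.log D.α • dy) :
    Subsingleton (Cohomology θ 0) := by
  rw [Submodule.Quotient.subsingleton_iff, Submodule.eq_top_iff']
  intro σ
  have h1 : σ.1.1 = 0 := untwist_injective (by
    rw [eq_zero_of_closed_zero (untwist_mem σ.1.2) (untwist_closed hθ σ.2), untwist_zero])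
  have h2 : σ = 0 := Subtype.ext (Subtype.ext h1)
  rw [h2]
  exact zero_mem _

theorem nonempty_cohomology_two_equiv
    (hθ : flatPullback D.cover θ = fun _ => Real.log D.α • dy) :
    Nonempty (Cohomology θ 2 ≃ₗ[ℝ] ℝ) :=
  nonempty_cohomology_equiv hθ areaForm_mem_invForms (extDeriv_const_form _)
    (fun _ hρ => areaForm_not_exact hρ.1) fun _ => exists_primitive_two

theorem nonempty_cohomology_three_equiv
    (hθ : flatPullback D.cover θ = fun _ => Real.log D.α • dy) :
    Nonempty (Cohomology θ 3 ≃ₗ[ℝ] ℝ) :=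
  nonempty_cohomology_equiv hθ extDeriv_heightArea_mem_invForms
    (extDeriv_extDeriv_of_contDiff contDiff_heightArea)
    (fun _ => extDeriv_heightArea_not_exact) fun _ => exists_primitive_three

end InoueData

end Inoue


/-! ### Identification of the Lee form. -/

namespace Inoue

open MorseNovikov

namespace InoueData

variable {D : InoueData} {k : ℕ}

lemma contMDiff_toCH : ContMDiff 𝓘(ℝ, ℂ × ℂ) 𝓘(ℝ, ℂ × ℂ) ∞ D.toCH := fun _ =>
  contMDiffAt_iff_target.2 ⟨D.continuous_toCH.continuousAt,
    D.contDiff_expCoord.contDiffAt.contMDiffAt⟩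

lemma mdifferentiableAt_toCH (u : ℂ × ℂ) :
    MDifferentiableAt 𝓘(ℝ, ℂ × ℂ) 𝓘(ℝ, ℂ × ℂ) D.toCH u :=
  contMDiff_toCH.contMDiffAt.mdifferentiableAt (by simp)

lemma mdifferentiableAt_logCoord_val (q : CH) :
    MDifferentiableAt 𝓘(ℝ, ℂ × ℂ) 𝓘(ℝ, ℂ × ℂ) (fun p : CH => D.logCoord p.1) q :=
  MDifferentiableAt.comp q
    ((D.contDiffAt_logCoord q.2).differentiableAt (by simp)).mdifferentiableAt
    ((contMDiff_subtype_val (n := ∞)).contMDiffAt.mdifferentiableAt (by simp))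

lemma proj_eq : D.proj = D.cover ∘ fun p : CH => D.logCoord p.1 :=
  funext fun q => (congrArg D.proj (D.toCH_logCoord q)).symm

lemma mdifferentiableAt_proj (q : CH) :
    MDifferentiableAt 𝓘(ℝ, ℂ × ℂ) 𝓘(ℝ, ℂ × ℂ) D.proj q := by
  rw [proj_eq]
  exact (mdifferentiableAt_cover _).comp q (mdifferentiableAt_logCoord_val q)

lemma flatPullback_cover_apply (σ : DForm (ℂ × ℂ) D.S0 k) (u : ℂ × ℂ) (v : Fin k → ℂ × ℂ) :
    flatPullback D.cover σ u v = pullback D.proj σ (D.toCH u)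
      fun i => mfderiv 𝓘(ℝ, ℂ × ℂ) 𝓘(ℝ, ℂ × ℂ) D.toCH u (v i) := by
  have h := mfderiv_comp u (mdifferentiableAt_proj (D := D) (D.toCH u)) (mdifferentiableAt_toCH u)
  have h1 (w : ℂ × ℂ) : mfderiv 𝓘(ℝ, ℂ × ℂ) 𝓘(ℝ, ℂ × ℂ) D.cover u w =
    mfderiv 𝓘(ℝ, ℂ × ℂ) 𝓘(ℝ, ℂ × ℂ) D.proj (D.toCH u)
      (mfderiv 𝓘(ℝ, ℂ × ℂ) 𝓘(ℝ, ℂ × ℂ) D.toCH u w) := congrArg (fun L => L w) h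
  change σ (D.cover u) (fun i => mfderiv 𝓘(ℝ, ℂ × ℂ) 𝓘(ℝ, ℂ × ℂ) D.cover u (v i)) = _
  simp only [h1]
  rfl

/-- A form on `S⁰` is determined by its lift to `ℂ × ℍ`. -/
lemma pullback_proj_injective :
    Function.Injective (pullback D.proj : DForm (ℂ × ℂ) D.S0 k → DForm (ℂ × ℂ) CH k) := by
  intro σ σ' h
  refine flatPullback_cover_injective (funext fun u => ?_)
  ext v
  rw [flatPullback_cover_apply, flatPullback_cover_apply, h]

lemma pullback_proj_apply (σ : DForm (ℂ × ℂ) D.S0 k) (q : CH) (v : Fin k → ℂ × ℂ) :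
    pullback D.proj σ q v = flatPullback D.cover σ (D.logCoord q.1)
      fun i => mfderiv 𝓘(ℝ, ℂ × ℂ) 𝓘(ℝ, ℂ × ℂ) (fun p : CH => D.logCoord p.1) q (v i) := by
  have h := mfderiv_comp q (mdifferentiableAt_cover (D := D) (D.logCoord q.1))
    (mdifferentiableAt_logCoord_val q)
  rw [← proj_eq] at h
  have h1 (w : ℂ × ℂ) : mfderiv 𝓘(ℝ, ℂ × ℂ) 𝓘(ℝ, ℂ × ℂ) D.proj q w =
    mfderiv 𝓘(ℝ, ℂ × ℂ) 𝓘(ℝ, ℂ × ℂ) D.cover (D.logCoord q.1)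
      (mfderiv 𝓘(ℝ, ℂ × ℂ) 𝓘(ℝ, ℂ × ℂ) (fun p : CH => D.logCoord p.1) q w) :=
    congrArg (fun L => L w) h
  change σ (D.proj q) (fun i => mfderiv 𝓘(ℝ, ℂ × ℂ) 𝓘(ℝ, ℂ × ℂ) D.proj q (v i)) = _
  simp only [h1]
  have h5 (x' : D.S0) (h : D.proj q = x') :
    (σ (D.proj q) : (ℂ × ℂ) [⋀^Fin k]→L[ℝ] ℝ) = σ x' := by rw [h]
  exact congrArg (fun c : (ℂ × ℂ) [⋀^Fin k]→L[ℝ] ℝ => c _) (h5 _ (congrFun proj_eq q))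

lemma fibration_cover (u : ℂ × ℂ) :
    D.fibration (D.cover u) = Circle.exp (2 * Real.pi * u.2.im) := by
  change Circle.exp (2 * Real.pi * Real.logb D.α (D.expCoord u).2.im) = _
  rw [expCoord_im, Real.logb, Real.log_exp, mul_div_cancel_right₀ _ D.log_α_pos.ne']

lemma mdifferentiableAt_fibration (x : D.S0) :
    MDifferentiableAt 𝓘(ℝ, ℂ × ℂ) (𝓡 1) D.fibration x := by
  have he := chart_mem_atlas (ℂ × ℂ) x
  have hx := mem_chart_source (ℂ × ℂ) x
  set e := chartAt (ℂ × ℂ) x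
  have hl := D.contDiffAt_logCoord (chart_target_pos he (e.map_source hx))
  have h1 : DifferentiableAt ℝ (fun y => 2 * Real.pi * (D.logCoord y).2.im) (e x) :=
    (heightCLM.differentiableAt.comp _ (hl.differentiableAt (by simp))).const_mul _
  have h2 : MDifferentiableAt 𝓘(ℝ, ℂ × ℂ) (𝓡 1)
      (Circle.exp ∘ (fun y => 2 * Real.pi * (D.logCoord y).2.im) ∘ e) x :=
    MDifferentiableAt.comp x
      ((contMDiff_circleExp (m := ∞)).contMDiffAt.mdifferentiableAt (by simp))
      (MDifferentiableAt.comp x h1.mdifferentiableAt (mdifferentiableAt_chart he hx))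
  refine h2.congr_of_eventuallyEq ?_
  filter_upwards [e.open_source.mem_nhds hx] with y hy
  conv_lhs => rw [← e.left_inv hy, chart_symm_eq he (e.map_source hy), fibration_cover]
  rfl

variable (D) in
/-- The Lee form `log α • p^* ϑ` of the Inoue surface. -/
def leeForm : DForm (ℂ × ℂ) D.S0 1 := Real.log D.α • pullback D.fibration circleForm

/-- On the cover the fibration is `exp (2π i y)`, and the circle form is `Im (ζ⁻¹ dζ) / 2π`, which
pulls back to `dy`. -/
lemma flatPullback_leeForm : flatPullback D.cover D.leeForm = fun _ => Real.log D.α • dy := by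
  funext u
  have := finrank_real_complex_fact'
  have hc : MDifferentiableAt (𝓡 1) 𝓘(ℝ, ℂ) (fun z : Circle => (z : ℂ))
      (D.fibration (D.cover u)) :=
    (contMDiff_coe_sphere (E := ℂ) (n := 1) (m := ∞)).contMDiffAt.mdifferentiableAt (by simp)
  have h1 := mfderiv_comp u (hc.comp _ (mdifferentiableAt_fibration (D.cover u)))
    (mdifferentiableAt_cover u)
  rw [mfderiv_comp _ hc (mdifferentiableAt_fibration (D.cover u))] at h1
  have h2 : ((fun z : Circle => (z : ℂ)) ∘ D.fibration) ∘ D.cover =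
      fun u => Complex.exp ((2 * Real.pi * heightCLM u : ℝ) * Complex.I) := by
    funext u
    rw [Function.comp_apply, Function.comp_apply, fibration_cover, Circle.coe_exp]
    rfl
  have h3 : HasFDerivAt (fun u => Complex.exp ((2 * Real.pi * heightCLM u : ℝ) * Complex.I))
      (Complex.exp ((2 * Real.pi * heightCLM u : ℝ) * Complex.I) •
        (Complex.ofRealCLM ∘L ((2 * Real.pi) • heightCLM)).smulRight Complex.I) u :=
    ((Complex.ofRealCLM.hasFDerivAt.comp u
      (heightCLM.hasFDerivAt.const_mul (2 * Real.pi))).mul_const' Complex.I).cexp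
  rw [h2, mfderiv_eq_fderiv, h3.fderiv] at h1
  ext v
  -- Naming the image vector as a plain complex number hides the tangent spaces from the
  -- computation.
  obtain ⟨A, hA⟩ : ∃ A : ℂ, A =
      mfderiv (𝓡 1) 𝓘(ℝ, ℂ) (fun z : Circle => (z : ℂ)) (D.fibration (D.cover u))
        (mfderiv 𝓘(ℝ, ℂ × ℂ) (𝓡 1) D.fibration (D.cover u)
          (mfderiv 𝓘(ℝ, ℂ × ℂ) 𝓘(ℝ, ℂ × ℂ) D.cover u (v 0))) := ⟨_, rfl⟩
  have h4 : (Complex.exp ((2 * Real.pi * heightCLM u : ℝ) * Complex.I)) *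
      (((2 * Real.pi * heightCLM (v 0) : ℝ) : ℂ) * Complex.I) = A :=
    (congrArg (fun L => L (v 0)) h1).trans hA.symm
  have h5 : flatPullback D.cover D.leeForm u v = Real.log D.α * ((2 * Real.pi)⁻¹ *
      ((((D.fibration (D.cover u))⁻¹ : Circle) : ℂ) * A).im) := by
    subst hA
    rfl
  refine h5.trans ?_
  rw [← h4, Circle.coe_inv, fibration_cover, Circle.coe_exp]
  change _ * (_ * ((Complex.exp ((2 * Real.pi * heightCLM u : ℝ) * Complex.I))⁻¹ * _ : ℂ).im) = _
  rw [inv_mul_cancel_left₀ (Complex.exp_ne_zero _), Complex.im_ofReal_mul, Complex.I_im, mul_one,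
    inv_mul_cancel_left₀ (by positivity)]
  rfl

/-- Since `y = log w₂ / log α`, the form `log α • dy` is `d(log w₂) = dw₂ / w₂`. -/
lemma pullback_proj_leeForm : pullback D.proj D.leeForm = tricerriForm := by
  funext q
  have hq : (0 : ℝ) < q.1.2.im := q.2
  have h0 := mfderiv_comp q (heightCLM.differentiableAt.mdifferentiableAt)
    (mdifferentiableAt_logCoord_val (D := D) q)
  have him : MDifferentiableAt 𝓘(ℝ, ℂ × ℂ) 𝓘(ℝ, ℝ) (fun p : CH => p.1.2.im) q :=
    MDifferentiableAt.comp (g := heightCLM) q heightCLM.differentiableAt.mdifferentiableAt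
      ((contMDiff_subtype_val (n := ∞)).contMDiffAt.mdifferentiableAt (by simp))
  have hlog : HasFDerivAt (fun t : ℝ => Real.log t / Real.log D.α)
      (ContinuousLinearMap.toSpanSingleton ℝ ((q.1.2.im)⁻¹ / Real.log D.α)) q.1.2.im :=
    ((Real.hasDerivAt_log hq.ne').div_const _).hasFDerivAt
  have h1 := mfderiv_comp q (f := fun p : CH => p.1.2.im)
    hlog.differentiableAt.mdifferentiableAt him
  have h2 : heightCLM ∘ (fun p : CH => D.logCoord p.1) =
      (fun t : ℝ => Real.log t / Real.log D.α) ∘ fun p : CH => p.1.2.im :=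
    funext fun p => D.logCoord_im p.1
  rw [mfderiv_eq_fderiv, ContinuousLinearMap.fderiv] at h0
  rw [mfderiv_eq_fderiv, hlog.fderiv, ← h2, h0] at h1
  ext v
  obtain ⟨A, hA⟩ : ∃ A : ℝ, A =
    mfderiv 𝓘(ℝ, ℂ × ℂ) 𝓘(ℝ, ℝ) (fun p : CH => p.1.2.im) q (v 0) := ⟨_, rfl⟩
  have h3 : heightCLM (mfderiv 𝓘(ℝ, ℂ × ℂ) 𝓘(ℝ, ℂ × ℂ) (fun p : CH => D.logCoord p.1) q (v 0)) =
      A * ((q.1.2.im)⁻¹ / Real.log D.α) := by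
    subst hA
    exact congrArg (fun L => L (v 0)) h1
  have h4 : tricerriForm q v = (q.1.2.im)⁻¹ * A := by
    subst hA
    rfl
  refine (pullback_proj_apply D.leeForm q v).trans ?_
  rw [flatPullback_leeForm, h4]
  change Real.log D.α * heightCLM _ = _
  rw [h3]
  have := D.log_α_pos.ne'
  field_simp

lemma leeForm_mem_smoothForms : D.leeForm ∈ smoothForms (ℂ × ℂ) D.S0 1 :=
  mem_smoothForms_of_contDiff (by rw [flatPullback_leeForm]; exact contDiff_const)

/-- The lift to the cover is constant, and lifting commutes with `d` and is injective. -/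
lemma extD_leeForm : extD D.leeForm = 0 := by
  refine flatPullback_cover_injective ?_
  rw [← extDeriv_pullback_eq leeForm_mem_smoothForms contMDiff_cover, flatPullback_leeForm]
  exact extDeriv_const_form _

end InoueData

end Inoue

end

/-! ### The main theorem. -/

theorem mainTheorem1 (D : Inoue.InoueData) :
    ∃ θ : MorseNovikov.DForm (ℂ × ℂ) D.S0 1,
      -- `θ` is the unique one-form on `S⁰` that lifts to `dw₂ / w₂` on `ℂ × ℍ`
      (∀ θ' : MorseNovikov.DForm (ℂ × ℂ) D.S0 1,
        MorseNovikov.pullback D.proj θ' = Inoue.InoueData.tricerriForm ↔ θ' = θ) ∧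
      θ ∈ MorseNovikov.smoothForms (ℂ × ℂ) D.S0 1 ∧
      MorseNovikov.extD θ = 0 ∧
      θ = Real.log D.α • MorseNovikov.pullback D.fibration Inoue.circleForm ∧
      Subsingleton (MorseNovikov.Cohomology θ 0) ∧
      Subsingleton (MorseNovikov.Cohomology θ 1) ∧
      Nonempty (MorseNovikov.Cohomology θ 2 ≃ₗ[ℝ] ℝ) ∧
      Nonempty (MorseNovikov.Cohomology θ 3 ≃ₗ[ℝ] ℝ) ∧
      (∀ k : ℕ, 4 ≤ k → Subsingleton (MorseNovikov.Cohomology θ k)) := by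
  open Inoue.InoueData in
  refine ⟨D.leeForm, fun θ' => ⟨fun h => ?_, fun h => ?_⟩, leeForm_mem_smoothForms, extD_leeForm,
    rfl, subsingleton_cohomology_zero flatPullback_leeForm,
    subsingleton_cohomology flatPullback_leeForm (by simp) (by simp),
    nonempty_cohomology_two_equiv flatPullback_leeForm,
    nonempty_cohomology_three_equiv flatPullback_leeForm, fun k hk => ?_⟩
  · exact Inoue.InoueData.pullback_proj_injective
      (h.trans Inoue.InoueData.pullback_proj_leeForm.symm)
  · rw [h, Inoue.InoueData.pullback_proj_leeForm]
  · obtain ⟨k, rfl⟩ : ∃ j, k = j + 1 := ⟨k - 1, by omega⟩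
    exact Inoue.InoueData.subsingleton_cohomology Inoue.InoueData.flatPullback_leeForm
      (by omega) (by omega)
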